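/- Let $\zeta\in\mathbb T$ and let $F=(F_{ij})\in \mathrm{GL}(n,\mathbb C)$, with inverse $F^{-1}=(F^{ij})$, be admissible: there are $(d_i),(d'_i)\in\mathbb Z^n$ and $d\in\mathbb Z$ such that $F_{ij}=0=F^{ji}$ whenever $-d_j+d\neq d'_i$; fix such integers. All C*-algebras and *-homomorphisms are unital, $\otimes$ is the minimal tensor product, $z$ is the coordinate function of $\mathrm C(\mathbb T)$ and $\Delta_{\mathbb T}(z)=z\otimes z$. *Notation.* For a matrix $u=(u_{ij})$ over a C*-algebra put $\overline u_\zeta=(\zeta^{d_i(d_j-d_i)}u_{ij}^*)_{ij}$. Let $A=\mathrm C(\mathrm U_\zeta^+(F))$ be the universal C*-algebra generated by the entries of a matrix $u=(u_{ij})_{1\le i,j\le n}$ such that $u$ and $F\overline u_\zeta F^{-1}$ are unitary. It carries the coaction $\rho^A:A\to A\otimes \mathrm C(\mathbb T)$, $\rho^A(u_{ij})=u_{ij}\otimes z^{d_j-d_i}$. Let $\mathrm C(\mathbb T^2_\zeta)$ be the universal C*-algebra generated by unitaries $U,V$ with $VU=\zeta UV$, and let $\iota_1,\iota_2:\mathrm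 C(\mathbb T)\to \mathrm C(\mathbb T^2_\zeta)$ be the *-homomorphisms with $\iota_1(z)=U$, $\iota_2(z)=V$. For C*-algebras $X,Y$ with coactions $\rho^X,\rho^Y$ of $\mathrm C(\mathbb T)$, define $j_1:X\to X\otimes Y\otimes \mathrm C(\mathbb T_\zeta^2)$ and $j_2:Y\to X\otimes Y\otimes \mathrm C(\mathbb T^2_\zeta)$ by applying $\rho^X$ (resp. $\rho^Y$), then $\iota_1$ (resp. $\iota_2$) to the leg $\mathrm C(\mathbb T)$, and putting $1$ in the remaining leg. The braided tensor product $X\boxtimes_\zeta Y$ is the C*-algebra $j_1(X)j_2(Y)$ (the closed span of the products), with the coaction of $\mathrm C(\mathbb T)$ that makes $j_1$ and $j_2$ equivariant. Equip $\mathrm C(\mathbb T)$ with the coaction $\Delta_{\mathbb T}$. Let $\Delta_A:A\to A\boxtimes_\zeta A$ be the *-homomorphism with $\Delta_A(u_{ij})=\sum_k j_1(u_{ik})j_2(u_{kj})$. The bosonization $\mathrm U^+_\zeta(F)\rtimes\mathbb T$ has the C*-algebra $B=\mathrm C(\mathbb T)\boxtimes_\zeta A$ and the comultiplication $\Delta=\psi\circ(\mathrm{id}_{\mathrm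 C(\mathbb T)}\boxtimes_\zeta\Delta_A):B\to B\otimes B$. Here $(\mathrm{id}\boxtimes_\zeta\Delta_A)(j_1(f)j_2(a))=j_1(f)j_2(\Delta_A(a))$, and $\psi:\mathrm C(\mathbb T)\boxtimes_\zeta (A\boxtimes_\zeta A)\to B\otimes B$ is the *-homomorphism with $\psi(j_1(f))=(j_1\otimes j_1)\Delta_{\mathbb T}(f)$, $\psi(j_2(j_1(a)))=(j_2\otimes j_1)\rho^A(a)$ and $\psi(j_2(j_2(b)))=1\otimes j_2(b)$ for $f\in\mathrm C(\mathbb T)$, $a,b\in A$. In $B$ write $z$ for $j_1(z)$ and $u_{ij}$ for $j_2(u_{ij})$. **Theorem.** 1. $B$ is the universal C*-algebra generated by elements $z$ and $u_{ij}$, $1\le i,j\le n$, subject to: $z$ is unitary; $zu_{ij}=\zeta^{d_i-d_j}u_{ij}z$ for all $i,j$; the matrices $u$ and $F\overline u_\zeta F^{-1}$ are unitary. 2. There is an automorphism $\alpha$ of $A$ with $\alpha(u_{ij})=\zeta^{d_i-d_j}u_{ij}$ for all $i,j$, and $B$, with the embedding $j_2$ of $A$ and the unitary $z$, is the crossed product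 $A\rtimes_\alpha\mathbb Z$. 3. The morphisms that define $\Delta$ exist, $\Delta$ is uniquely determined by them, and $$\Delta(z)=z\otimes z,\qquad \Delta(u_{ij})=\sum_{k=1}^n u_{ik}\otimes z^{d_k-d_i}u_{kj}\qquad(1\le i,j\le n).$$ -/

import Mathlib

open scoped TensorProduct

noncomputable section

namespace BraidedUnitary

theorem starHom_continuous {A B : Type*} [CStarAlgebra A] [CStarAlgebra B] (φ : A →⋆ₐ[ℂ] B) :
    Continuous φ :=
  AddMonoidHomClass.continuous_of_bound φ 1
    (fun a => by rw [one_mul]; exact NonUnitalStarAlgHom.norm_apply_le φ a)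

/-! ### C*-seminorms on *-algebras and the associated C*-completions -/

/-- A C*-seminorm on a unital complex *-algebra. -/
structure CStarSeminorm (R : Type*) [Ring R] [StarRing R] [Algebra ℂ R] extends Seminorm ℂ R where
  mul_le' : ∀ a b, toFun (a * b) ≤ toFun a * toFun b
  star_mul_self' : ∀ a, toFun (star a * a) = toFun a ^ 2

namespace CStarSeminorm

variable {R : Type*} [Ring R] [StarRing R] [Algebra ℂ R]

instance : CoeFun (CStarSeminorm R) (fun _ => R → ℝ) := ⟨fun p => p.toSeminorm⟩

theorem mul_le (p : CStarSeminorm R) (a b : R) : p (a * b) ≤ p a * p b := p.mul_le' a b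

theorem star_mul_self (p : CStarSeminorm R) (a : R) : p (star a * a) = p a ^ 2 :=
  p.star_mul_self' a

theorem nonneg (p : CStarSeminorm R) (a : R) : 0 ≤ p a := apply_nonneg p.toSeminorm a

theorem le_star (p : CStarSeminorm R) (a : R) : p a ≤ p (star a) := by
  have h1 := p.star_mul_self a
  have h2 := p.mul_le (star a) a
  rcases (p.nonneg a).eq_or_lt with h | h
  · rw [← h]; exact p.nonneg _
  · nlinarith

theorem star_eq (p : CStarSeminorm R) (a : R) : p (star a) = p a :=
  le_antisymm (by simpa using p.le_star (star a)) (p.le_star a)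

/-- The pointwise supremum of a pointwise bounded set of C*-seminorms. -/
def sup (S : Set (CStarSeminorm R)) (hS : ∀ a, ∃ C : ℝ, ∀ p ∈ S, p a ≤ C) :
    CStarSeminorm R where
  toFun a := ⨆ p : S, p.1 a
  map_zero' := by simp
  add_le' a b := by
    have hb : ∀ a, BddAbove (Set.range fun p : S => p.1 a) := fun a => by
      obtain ⟨C, hC⟩ := hS a
      exact ⟨C, by rintro _ ⟨p, rfl⟩; exact hC p.1 p.2⟩
    refine Real.iSup_le (fun p => (map_add_le_add p.1.toSeminorm a b).trans
      (add_le_add (le_ciSup (hb a) p) (le_ciSup (hb b) p))) ?_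
    exact add_nonneg (Real.iSup_nonneg fun p => p.1.nonneg a)
      (Real.iSup_nonneg fun p => p.1.nonneg b)
  neg' a := by simp
  smul' c a := by
    simp only [map_smul_eq_mul]
    rw [Real.mul_iSup_of_nonneg (norm_nonneg c)]
  mul_le' a b := by
    have hb : ∀ a, BddAbove (Set.range fun p : S => p.1 a) := fun a => by
      obtain ⟨C, hC⟩ := hS a
      exact ⟨C, by rintro _ ⟨p, rfl⟩; exact hC p.1 p.2⟩
    have h0 : ∀ a, 0 ≤ ⨆ p : S, p.1 a := fun a => Real.iSup_nonneg fun p => p.1.nonneg a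
    exact Real.iSup_le (fun p => (p.1.mul_le a b).trans
      (mul_le_mul (le_ciSup (hb a) p) (le_ciSup (hb b) p) (p.1.nonneg b) (h0 a)))
      (mul_nonneg (h0 a) (h0 b))
  star_mul_self' a := by
    have hb : ∀ a, BddAbove (Set.range fun p : S => p.1 a) := fun a => by
      obtain ⟨C, hC⟩ := hS a
      exact ⟨C, by rintro _ ⟨p, rfl⟩; exact hC p.1 p.2⟩
    have h0 : ∀ a, 0 ≤ ⨆ p : S, p.1 a := fun a => Real.iSup_nonneg fun p => p.1.nonneg a
    apply le_antisymm
    · refine Real.iSup_le (fun p => ?_) (sq_nonneg _)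
      rw [p.1.star_mul_self]
      exact pow_le_pow_left₀ (p.1.nonneg a) (le_ciSup (hb a) p) 2
    · have h : (⨆ p : S, p.1 a) ≤ Real.sqrt (⨆ p : S, p.1 (star a * a)) := by
        refine Real.iSup_le (fun p => Real.le_sqrt_of_sq_le ?_) (Real.sqrt_nonneg _)
        rw [← p.1.star_mul_self]
        exact le_ciSup (hb (star a * a)) p
      calc (⨆ p : S, p.1 a) ^ 2 ≤ Real.sqrt (⨆ p : S, p.1 (star a * a)) ^ 2 :=
            pow_le_pow_left₀ (h0 a) h 2
        _ = _ := Real.sq_sqrt (h0 _)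

theorem le_sup (S : Set (CStarSeminorm R)) (hS : ∀ a, ∃ C : ℝ, ∀ p ∈ S, p a ≤ C)
    {p : CStarSeminorm R} (hp : p ∈ S) (a : R) : p a ≤ sup S hS a := by
  refine le_ciSup (f := fun p : S => p.1 a) ?_ ⟨p, hp⟩
  obtain ⟨C, hC⟩ := hS a
  exact ⟨C, by rintro _ ⟨p, rfl⟩; exact hC p.1 p.2⟩

theorem sup_le (S : Set (CStarSeminorm R)) (hS : ∀ a, ∃ C : ℝ, ∀ p ∈ S, p a ≤ C)
    {a : R} {C : ℝ} (hC : 0 ≤ C) (h : ∀ p ∈ S, p a ≤ C) : sup S hS a ≤ C :=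
  Real.iSup_le (fun p : S => h p.1 p.2) hC

/-- The *-algebra `R`, regarded as a seminormed *-algebra by means of `p`. -/
def Pre (_p : CStarSeminorm R) : Type _ := R

variable (p : CStarSeminorm R)

instance : Ring p.Pre := inferInstanceAs (Ring R)
instance : StarRing p.Pre := inferInstanceAs (StarRing R)
instance : Algebra ℂ p.Pre := inferInstanceAs (Algebra ℂ R)
instance [StarModule ℂ R] : StarModule ℂ p.Pre := inferInstanceAs (StarModule ℂ R)

/-- The identity map from `R` to its seminormed version. -/
def toPre : R →ₐ[ℂ] p.Pre := AlgHom.id ℂ R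

/-- The seminorm `p` on `p.Pre`. -/
def preSeminorm : Seminorm ℂ p.Pre where
  toFun a := p.toSeminorm.toFun a
  map_zero' := p.map_zero'
  add_le' := p.add_le'
  neg' := p.neg'
  smul' := p.smul'

instance : SeminormedRing p.Pre :=
  { (inferInstance : Ring p.Pre), p.preSeminorm.toAddGroupSeminorm.toSeminormedAddCommGroup with
    norm_mul_le := p.mul_le }

theorem norm_toPre (a : R) : ‖p.toPre a‖ = p a := rfl

theorem toPre_surjective : Function.Surjective p.toPre := fun a => ⟨a, rfl⟩

theorem star_toPre (a : R) : star (p.toPre a) = p.toPre (star a) := rfl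

instance : NormedSpace ℂ p.Pre where
  __ := (inferInstance : Module ℂ p.Pre)
  norm_smul_le c a := (map_smul_eq_mul p.preSeminorm c a).le

instance : NormedStarGroup p.Pre where
  norm_star_le a := (p.star_eq a).le

/-- The C*-completion of a *-algebra in a C*-seminorm (elements of seminorm `0` are identified
with `0`). -/
def Completion : Type _ := UniformSpace.Completion p.Pre

instance : NormedRing p.Completion := inferInstanceAs (NormedRing (UniformSpace.Completion p.Pre))
instance : Algebra ℂ p.Completion := inferInstanceAs (Algebra ℂ (UniformSpace.Completion p.Pre))
instance : NormedAlgebra ℂ p.Completion where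
  norm_smul_le c a := norm_smul_le (β := UniformSpace.Completion p.Pre) c a
instance : CompleteSpace p.Completion :=
  inferInstanceAs (CompleteSpace (UniformSpace.Completion p.Pre))

/-- The canonical map of the *-algebra `R` into its C*-completion. -/
def of : R →ₐ[ℂ] p.Completion :=
  { (UniformSpace.Completion.coeRingHom : p.Pre →+* UniformSpace.Completion p.Pre).comp
      (p.toPre : R →+* p.Pre) with
    commutes' := fun _ => rfl }

theorem norm_of (a : R) : ‖p.of a‖ = p a :=
  UniformSpace.Completion.norm_coe (E := p.Pre) a

theorem denseRange_of : DenseRange p.of :=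
  UniformSpace.Completion.denseRange_coe (α := p.Pre)

theorem induction {P : p.Completion → Prop} (hc : IsClosed {x | P x}) (h : ∀ a, P (p.of a))
    (x : p.Completion) : P x :=
  p.denseRange_of.induction_on x hc h

instance : Star p.Completion :=
  ⟨UniformSpace.Completion.map (star : p.Pre → p.Pre)⟩

theorem continuous_star' : Continuous (star : p.Completion → p.Completion) :=
  UniformSpace.Completion.continuous_map

theorem star_of (a : R) : star (p.of a) = p.of (star a) :=
  UniformSpace.Completion.map_coe (α := p.Pre) (β := p.Pre)
    (starNormedAddGroupHom (E := p.Pre)).uniformContinuous a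

instance : StarRing p.Completion where
  star_involutive x := by
    refine p.induction (isClosed_eq (p.continuous_star'.comp p.continuous_star') continuous_id)
      (fun a => ?_) x
    simp [star_of]
  star_mul x y := by
    refine p.denseRange_of.induction_on₂ (p := fun x y => star (x * y) = star y * star x)
      ?_ (fun a b => ?_) x y
    · have := p.continuous_star'
      exact isClosed_eq (by fun_prop) (by fun_prop)
    · simp only [← map_mul, star_of, star_mul]
  star_add x y := by
    refine p.denseRange_of.induction_on₂ (p := fun x y => star (x + y) = star x + star y)
      ?_ (fun a b => ?_) x y
    · have := p.continuous_star'
      exact isClosed_eq (by fun_prop) (by fun_prop)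
    · simp only [← map_add, star_of, star_add]

theorem norm_star_mul_self' (x : p.Completion) : ‖x‖ * ‖x‖ ≤ ‖star x * x‖ := by
  have hs := p.continuous_star'
  refine p.induction (P := fun x => ‖x‖ * ‖x‖ ≤ ‖star x * x‖)
    (isClosed_le (continuous_norm.mul continuous_norm)
      (continuous_norm.comp (hs.mul continuous_id))) (fun a => ?_) x
  rw [star_of, ← map_mul, norm_of, norm_of, p.star_mul_self, sq]

theorem star_smul' [StarModule ℂ R] (c : ℂ) (x : p.Completion) :
    star (c • x) = star c • star x := by
  have hs := p.continuous_star'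
  refine p.induction (P := fun x => star (c • x) = star c • star x)
    (isClosed_eq (hs.comp (continuous_const_smul c)) (hs.const_smul (star c))) (fun a => ?_) x
  rw [← map_smul, star_of, star_of, star_smul, map_smul]

instance : CStarRing p.Completion where
  norm_mul_self_le := p.norm_star_mul_self'

instance [StarModule ℂ R] : StarModule ℂ p.Completion where
  star_smul := p.star_smul'

instance [StarModule ℂ R] : CStarAlgebra p.Completion where

variable {D : Type*} [CStarAlgebra D]

/-- A *-homomorphism out of `R`, viewed on the seminormed version of `R`. -/
def onPre (φ : R →⋆ₐ[ℂ] D) : p.Pre →+* D := (φ : R →+* D)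

theorem continuous_onPre (φ : R →⋆ₐ[ℂ] D) (h : ∀ a, ‖φ a‖ ≤ p a) : Continuous (p.onPre φ) :=
  AddMonoidHomClass.continuous_of_bound (p.onPre φ) 1 (fun a => by rw [one_mul]; exact h a)

/-- The extension of a dominated *-homomorphism to the completion, as a ring homomorphism. -/
def liftRingHom (φ : R →⋆ₐ[ℂ] D) (h : ∀ a, ‖φ a‖ ≤ p a) : p.Completion →+* D :=
  UniformSpace.Completion.extensionHom (p.onPre φ) (p.continuous_onPre φ h)

theorem continuous_liftRingHom (φ : R →⋆ₐ[ℂ] D) (h : ∀ a, ‖φ a‖ ≤ p a) :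
    Continuous (p.liftRingHom φ h) :=
  UniformSpace.Completion.continuous_extension

theorem liftRingHom_of (φ : R →⋆ₐ[ℂ] D) (h : ∀ a, ‖φ a‖ ≤ p a) (a : R) :
    p.liftRingHom φ h (p.of a) = φ a :=
  UniformSpace.Completion.extensionHom_coe (p.onPre φ) (p.continuous_onPre φ h) a

/-- A *-homomorphism into a C*-algebra that is dominated by `p` extends to the C*-completion. -/
def lift (φ : R →⋆ₐ[ℂ] D) (h : ∀ a, ‖φ a‖ ≤ p a) : p.Completion →⋆ₐ[ℂ] D :=
  { p.liftRingHom φ h with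
    commutes' := fun c => (p.liftRingHom_of φ h (algebraMap ℂ R c)).trans (AlgHomClass.commutes φ c)
    map_star' := fun x => by
      have hs := p.continuous_star'
      have hf := p.continuous_liftRingHom φ h
      refine p.induction
        (P := fun x => p.liftRingHom φ h (star x) = star (p.liftRingHom φ h x))
        (isClosed_eq (hf.comp hs) hf.star) (fun a => ?_) x
      rw [star_of, liftRingHom_of, liftRingHom_of, map_star] }

@[simp]
theorem lift_of (φ : R →⋆ₐ[ℂ] D) (h : ∀ a, ‖φ a‖ ≤ p a) (a : R) : p.lift φ h (p.of a) = φ a :=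
  p.liftRingHom_of φ h a

/-- The canonical map into the C*-completion as a *-homomorphism. -/
def ofStar : R →⋆ₐ[ℂ] p.Completion :=
  { p.of with map_star' := fun a => (p.star_of a).symm }

/-- *-homomorphisms out of a C*-completion are determined on `R`. -/
theorem hom_ext [StarModule ℂ R] {φ ψ : p.Completion →⋆ₐ[ℂ] D}
    (h : ∀ a, φ (p.of a) = ψ (p.of a)) : φ = ψ := by
  ext x
  refine p.induction (P := fun x => φ x = ψ x) (isClosed_eq ?_ ?_) h x
  · exact starHom_continuous φ
  · exact starHom_continuous ψ

end CStarSeminorm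

/-! ### Free *-algebras and universal C*-algebras -/

/-- The free unital complex *-algebra on a set `X`: noncommutative polynomials in the letters
`x = inl x` and `x* = inr x`. -/
def FreeStar (X : Type*) : Type _ := FreeAlgebra ℂ (X ⊕ X)

namespace FreeStar

variable {X : Type*}

instance : Ring (FreeStar X) := inferInstanceAs (Ring (FreeAlgebra ℂ (X ⊕ X)))
instance : Algebra ℂ (FreeStar X) := inferInstanceAs (Algebra ℂ (FreeAlgebra ℂ (X ⊕ X)))

/-- A letter of the free *-algebra. -/
def letter (y : X ⊕ X) : FreeStar X := FreeAlgebra.ι ℂ y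

/-- The generator `x` of the free *-algebra. -/
def gen (x : X) : FreeStar X := letter (Sum.inl x)

theorem induction {P : FreeStar X → Prop} (hs : ∀ c : ℂ, P (algebraMap ℂ (FreeStar X) c))
    (hl : ∀ y, P (letter y)) (hm : ∀ a b, P a → P b → P (a * b))
    (ha : ∀ a b, P a → P b → P (a + b)) (a : FreeStar X) : P a :=
  FreeAlgebra.induction ℂ (X ⊕ X) (motive := P) hs hl hm ha a

/-- The homomorphism out of the free *-algebra with prescribed values on letters. -/
def liftAlg {D : Type*} [Ring D] [Algebra ℂ D] (f : X ⊕ X → D) : FreeStar X →ₐ[ℂ] D :=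
  FreeAlgebra.lift ℂ f

theorem liftAlg_letter {D : Type*} [Ring D] [Algebra ℂ D] (f : X ⊕ X → D) (y : X ⊕ X) :
    liftAlg f (letter y) = f y :=
  FreeAlgebra.lift_ι_apply f y

/-- The opposite of the free *-algebra, with scalars acting through complex conjugation. -/
def ConjOp (X : Type*) : Type _ := (FreeStar X)ᵐᵒᵖ

instance : Ring (ConjOp X) := inferInstanceAs (Ring (FreeStar X)ᵐᵒᵖ)

/-- Scalars of `ConjOp X`: the complex conjugates. -/
def conjOpScalar (X : Type*) : ℂ →+* ConjOp X :=
  (algebraMap ℂ (FreeStar X)ᵐᵒᵖ).comp (starRingEnd ℂ)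

instance : Algebra ℂ (ConjOp X) :=
  (conjOpScalar X).toAlgebra' fun c x =>
    Algebra.commutes (R := ℂ) (A := (FreeStar X)ᵐᵒᵖ) (starRingEnd ℂ c) x

/-- The conjugate-linear antihomomorphism exchanging the letters `x` and `x*`. -/
def starAux : FreeStar X →ₐ[ℂ] ConjOp X :=
  liftAlg (D := ConjOp X) fun y => (MulOpposite.op (letter y.swap) : (FreeStar X)ᵐᵒᵖ)

instance : Star (FreeStar X) := ⟨fun a => MulOpposite.unop (starAux a)⟩

theorem star_letter (y : X ⊕ X) : star (letter y) = letter y.swap :=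
  congrArg MulOpposite.unop (liftAlg_letter (D := ConjOp X) _ y)

theorem star_algebraMap (c : ℂ) :
    star (algebraMap ℂ (FreeStar X) c) = algebraMap ℂ (FreeStar X) (star c) :=
  congrArg MulOpposite.unop ((starAux (X := X)).commutes c)

theorem star_mul' (a b : FreeStar X) : star (a * b) = star b * star a :=
  congrArg MulOpposite.unop (map_mul starAux a b)

theorem star_add' (a b : FreeStar X) : star (a + b) = star a + star b :=
  congrArg MulOpposite.unop (map_add starAux a b)

instance : StarRing (FreeStar X) where
  star_involutive a := by
    refine induction (P := fun a => star (star a) = a) (fun c => ?_) (fun y => ?_)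
      (fun a b ha hb => ?_) (fun a b ha hb => ?_) a
    · rw [star_algebraMap, star_algebraMap, star_star]
    · rw [star_letter, star_letter, Sum.swap_swap]
    · rw [star_mul', star_mul', ha, hb]
    · rw [star_add', star_add', ha, hb]
  star_mul := star_mul'
  star_add := star_add'

instance : StarModule ℂ (FreeStar X) where
  star_smul c a := by
    rw [Algebra.smul_def, star_mul, star_algebraMap, Algebra.smul_def, Algebra.commutes]

/-- The universal property of the free *-algebra. -/
def lift {D : Type*} [Ring D] [StarRing D] [Algebra ℂ D] [StarModule ℂ D] (f : X → D) :
    FreeStar X →⋆ₐ[ℂ] D :=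
  { liftAlg (Sum.elim f fun x => star (f x)) with
    map_star' := fun a => by
      change liftAlg (Sum.elim f fun x => star (f x)) (star a)
        = star (liftAlg (Sum.elim f fun x => star (f x)) a)
      refine induction (P := fun a => liftAlg (Sum.elim f fun x => star (f x)) (star a)
        = star (liftAlg (Sum.elim f fun x => star (f x)) a)) (fun c => ?_) (fun y => ?_)
        (fun a b ha hb => ?_) (fun a b ha hb => ?_) a
      · rw [star_algebraMap, AlgHom.commutes, AlgHom.commutes, algebraMap_star_comm]
      · rw [star_letter, liftAlg_letter, liftAlg_letter]
        cases y <;> simp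
      · rw [star_mul, map_mul, map_mul, star_mul, ha, hb]
      · rw [star_add, map_add, map_add, star_add, ha, hb] }

@[simp]
theorem lift_gen {D : Type*} [Ring D] [StarRing D] [Algebra ℂ D] [StarModule ℂ D] (f : X → D)
    (x : X) : lift f (gen x) = f x :=
  liftAlg_letter _ _

theorem letter_inr (x : X) : letter (Sum.inr x) = star (gen x) :=
  (star_letter (Sum.inl x)).symm

theorem hom_ext {D : Type*} [Ring D] [StarRing D] [Algebra ℂ D]
    {φ ψ : FreeStar X →⋆ₐ[ℂ] D} (h : ∀ x, φ (gen x) = ψ (gen x)) : φ = ψ := by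
  ext a
  refine induction (P := fun a => φ a = ψ a) (fun c => ?_) (fun y => ?_)
    (fun a b ha hb => ?_) (fun a b ha hb => ?_) a
  · rw [AlgHomClass.commutes, AlgHomClass.commutes]
  · rcases y with x | x
    · exact h x
    · rw [letter_inr, map_star, map_star, h]
  · rw [map_mul, map_mul, ha, hb]
  · rw [map_add, map_add, ha, hb]

/-- The C*-seminorms on the free *-algebra that vanish on a set `rels` of *-polynomials. -/
def seminorms (rels : Set (FreeStar X)) : Set (CStarSeminorm (FreeStar X)) :=
  {p | ∀ r ∈ rels, p r = 0}

/-- The relations `r = 0`, `r ∈ rels`, bound every generator. -/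
def Bounding (rels : Set (FreeStar X)) : Prop :=
  ∀ x : X, ∃ C : ℝ, ∀ p ∈ seminorms rels, p (gen x) ≤ C

theorem Bounding.bdd {rels : Set (FreeStar X)} (h : Bounding rels) (a : FreeStar X) :
    ∃ C : ℝ, ∀ p ∈ seminorms rels, p a ≤ C := by
  refine induction (P := fun a => ∃ C : ℝ, ∀ p ∈ seminorms rels, p a ≤ C)
    (fun c => ?_) (fun y => ?_) (fun a b ha hb => ?_) (fun a b ha hb => ?_) a
  · refine ⟨‖c‖, fun p _ => ?_⟩
    have h1 : p (1 : FreeStar X) ≤ 1 := by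
      have := p.star_mul_self 1
      rw [star_one, mul_one] at this
      nlinarith [p.nonneg 1]
    rw [Algebra.algebraMap_eq_smul_one, map_smul_eq_mul]
    exact mul_le_of_le_one_right (norm_nonneg c) h1
  · rcases y with x | x
    · exact h x
    · obtain ⟨C, hC⟩ := h x
      exact ⟨C, fun p hp => by rw [letter_inr, p.star_eq]; exact hC p hp⟩
  · obtain ⟨C, hC⟩ := ha
    obtain ⟨C', hC'⟩ := hb
    exact ⟨C * C', fun p hp => (p.mul_le a b).trans
      (mul_le_mul (hC p hp) (hC' p hp) (p.nonneg b) ((p.nonneg a).trans (hC p hp)))⟩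
  · obtain ⟨C, hC⟩ := ha
    obtain ⟨C', hC'⟩ := hb
    exact ⟨C + C', fun p hp => (map_add_le_add p.toSeminorm a b).trans
      (add_le_add (hC p hp) (hC' p hp))⟩

end FreeStar

/-- The C*-seminorm induced by a *-homomorphism into a C*-algebra. -/
def CStarSeminorm.ofHom {R D : Type*} [Ring R] [StarRing R] [Algebra ℂ R] [CStarAlgebra D]
    (φ : R →⋆ₐ[ℂ] D) : CStarSeminorm R where
  toFun a := ‖φ a‖
  map_zero' := by simp
  add_le' a b := by rw [map_add]; exact norm_add_le _ _
  neg' a := by rw [map_neg, norm_neg]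
  smul' c a := by rw [map_smul, norm_smul]
  mul_le' a b := by rw [map_mul]; exact norm_mul_le _ _
  star_mul_self' a := by rw [map_mul, map_star, CStarRing.norm_star_mul_self, sq]

/-- The universal unital C*-algebra generated by a set `X` subject to the *-polynomial relations
`r = 0`, `r ∈ rels`: the completion of the free *-algebra in the largest C*-seminorm that vanishes
on `rels`. -/
def UnivCStar {X : Type*} (rels : Set (FreeStar X)) (h : FreeStar.Bounding rels) : Type _ :=
  (CStarSeminorm.sup (FreeStar.seminorms rels) h.bdd).Completion

namespace UnivCStar

variable {X : Type*} {rels : Set (FreeStar X)} (h : FreeStar.Bounding rels)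

instance : CStarAlgebra (UnivCStar rels h) :=
  inferInstanceAs (CStarAlgebra (CStarSeminorm.sup (FreeStar.seminorms rels) h.bdd).Completion)

/-- The quotient map from the free *-algebra. -/
def of : FreeStar X →⋆ₐ[ℂ] UnivCStar rels h :=
  (CStarSeminorm.sup (FreeStar.seminorms rels) h.bdd).ofStar

/-- The generators. -/
def gen (x : X) : UnivCStar rels h := of h (FreeStar.gen x)

theorem of_rel {r : FreeStar X} (hr : r ∈ rels) : of h r = 0 := by
  have : ‖of h r‖ = 0 := by
    refine le_antisymm ?_ (norm_nonneg _)
    refine (CStarSeminorm.norm_of _ r).trans_le ?_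
    exact CStarSeminorm.sup_le _ _ le_rfl fun p hp => (hp r hr).le
  exact norm_eq_zero.mp this

variable {D : Type*} [CStarAlgebra D]

/-- The universal property. -/
def lift (f : X → D) (hf : ∀ r ∈ rels, FreeStar.lift f r = 0) : UnivCStar rels h →⋆ₐ[ℂ] D :=
  CStarSeminorm.lift _ (FreeStar.lift f) fun a =>
    CStarSeminorm.le_sup (FreeStar.seminorms rels) h.bdd
      (p := CStarSeminorm.ofHom (FreeStar.lift f))
      (fun r hr => by
        change ‖FreeStar.lift f r‖ = 0
        rw [hf r hr, norm_zero]) a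

@[simp]
theorem lift_gen (f : X → D) (hf : ∀ r ∈ rels, FreeStar.lift f r = 0) (x : X) :
    lift h f hf (gen h x) = f x :=
  (CStarSeminorm.lift_of _ _ _ _).trans (FreeStar.lift_gen f x)

theorem hom_ext {φ ψ : UnivCStar rels h →⋆ₐ[ℂ] D} (hg : ∀ x, φ (gen h x) = ψ (gen h x)) :
    φ = ψ := by
  have : φ.comp (of h) = ψ.comp (of h) := FreeStar.hom_ext hg
  exact CStarSeminorm.hom_ext _ fun a => DFunLike.congr_fun this a

end UnivCStar

/-! ### The minimal (spatial) tensor product of C*-algebras -/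

section Rep

/-- Commuting *-homomorphisms `f`, `g` into `C` induce `a ⊗ b ↦ f a * g b`. -/
def algLift {A B C : Type*} [Ring A] [StarRing A] [Algebra ℂ A] [StarModule ℂ A]
    [Ring B] [StarRing B] [Algebra ℂ B] [StarModule ℂ B]
    [Ring C] [StarRing C] [Algebra ℂ C] (f : A →⋆ₐ[ℂ] C) (g : B →⋆ₐ[ℂ] C)
    (h : ∀ a b, Commute (f a) (g b)) : A ⊗[ℂ] B →⋆ₐ[ℂ] C :=
  { Algebra.TensorProduct.lift (f : A →ₐ[ℂ] C) (g : B →ₐ[ℂ] C) h with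
    map_star' := fun x => by
      change Algebra.TensorProduct.lift (f : A →ₐ[ℂ] C) (g : B →ₐ[ℂ] C) h (star x)
        = star (Algebra.TensorProduct.lift (f : A →ₐ[ℂ] C) (g : B →ₐ[ℂ] C) h x)
      induction x with
      | zero => simp
      | add x y hx hy => rw [star_add, map_add, map_add, star_add, hx, hy]
      | tmul a b =>
        rw [TensorProduct.star_tmul, Algebra.TensorProduct.lift_tmul,
          Algebra.TensorProduct.lift_tmul, star_mul]
        change f (star a) * g (star b) = star (g b) * star (f a)
        rw [h (star a) (star b), map_star, map_star] }

theorem algLift_tmul {A B C : Type*} [Ring A] [StarRing A] [Algebra ℂ A] [StarModule ℂ A]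
    [Ring B] [StarRing B] [Algebra ℂ B] [StarModule ℂ B]
    [Ring C] [StarRing C] [Algebra ℂ C] (f : A →⋆ₐ[ℂ] C) (g : B →⋆ₐ[ℂ] C)
    (h : ∀ a b, Commute (f a) (g b)) (a : A) (b : B) :
    algLift f g h (a ⊗ₜ b) = f a * g b :=
  Algebra.TensorProduct.lift_tmul (f : A →ₐ[ℂ] C) (g : B →ₐ[ℂ] C) h a b

/-- The Hilbert space tensor product: the completion of the algebraic tensor product with
`⟪ξ ⊗ η, ξ' ⊗ η'⟫ = ⟪ξ, ξ'⟫ ⟪η, η'⟫`. -/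
abbrev HilbertTensor (H K : Type*) [NormedAddCommGroup H] [InnerProductSpace ℂ H]
    [NormedAddCommGroup K] [InnerProductSpace ℂ K] : Type _ :=
  UniformSpace.Completion (H ⊗[ℂ] K)

variable (H K : Type*) [NormedAddCommGroup H] [InnerProductSpace ℂ H] [CompleteSpace H]
  [NormedAddCommGroup K] [InnerProductSpace ℂ K] [CompleteSpace K]

open UniformSpace

theorem op_ext {H K : Type*} [NormedAddCommGroup H] [InnerProductSpace ℂ H]
    [NormedAddCommGroup K] [InnerProductSpace ℂ K]
    {S T : HilbertTensor H K →L[ℂ] HilbertTensor H K}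
    (h : ∀ ξ : H ⊗[ℂ] K, S ξ = T ξ) : S = T := by
  ext x
  induction x using Completion.induction_on with
  | hp => exact isClosed_eq S.continuous T.continuous
  | ih ξ => exact h ξ

/-- The amplification `T ↦ T ⊗ 1`. -/
def ampLeft : (H →L[ℂ] H) →⋆ₐ[ℂ] (HilbertTensor H K →L[ℂ] HilbertTensor H K) where
  toFun T := (T.rTensor K).completion
  map_one' := op_ext fun ξ => by simp
  map_mul' S T := op_ext fun ξ => by simp [ContinuousLinearMap.rTensor_mul]
  map_zero' := op_ext fun ξ => by simp
  map_add' S T := op_ext fun ξ => by simp [Completion.coe_add]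
  commutes' c := op_ext fun ξ => by
    simp [Algebra.algebraMap_eq_smul_one]
  map_star' T := by
    rw [ContinuousLinearMap.star_eq_adjoint, ContinuousLinearMap.star_eq_adjoint,
      ContinuousLinearMap.eq_adjoint_iff]
    intro x y
    induction x, y using Completion.induction_on₂ with
    | hp => apply isClosed_eq <;> fun_prop
    | ih ξ η =>
      rw [ContinuousLinearMap.completion_apply_coe, ContinuousLinearMap.completion_apply_coe,
        Completion.inner_coe, Completion.inner_coe]
      induction ξ with
      | zero => simp
      | add ξ ξ' h h' => rw [map_add, inner_add_left, inner_add_left, h, h']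
      | tmul ξ₁ ξ₂ =>
        induction η with
        | zero => simp
        | add η η' h h' => rw [map_add, inner_add_right, inner_add_right, h, h']
        | tmul η₁ η₂ =>
          rw [ContinuousLinearMap.rTensor_tmul, ContinuousLinearMap.rTensor_tmul,
            TensorProduct.inner_tmul, TensorProduct.inner_tmul,
            ContinuousLinearMap.adjoint_inner_left]

/-- The amplification `T ↦ 1 ⊗ T`. -/
def ampRight : (K →L[ℂ] K) →⋆ₐ[ℂ] (HilbertTensor H K →L[ℂ] HilbertTensor H K) where
  toFun T := (T.lTensor H).completion
  map_one' := op_ext fun ξ => by simp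
  map_mul' S T := op_ext fun ξ => by simp [ContinuousLinearMap.lTensor_mul]
  map_zero' := op_ext fun ξ => by simp
  map_add' S T := op_ext fun ξ => by simp [Completion.coe_add]
  commutes' c := op_ext fun ξ => by
    simp [Algebra.algebraMap_eq_smul_one]
  map_star' T := by
    rw [ContinuousLinearMap.star_eq_adjoint, ContinuousLinearMap.star_eq_adjoint,
      ContinuousLinearMap.eq_adjoint_iff]
    intro x y
    induction x, y using Completion.induction_on₂ with
    | hp => apply isClosed_eq <;> fun_prop
    | ih ξ η =>
      rw [ContinuousLinearMap.completion_apply_coe, ContinuousLinearMap.completion_apply_coe,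
        Completion.inner_coe, Completion.inner_coe]
      induction ξ with
      | zero => simp
      | add ξ ξ' h h' => rw [map_add, inner_add_left, inner_add_left, h, h']
      | tmul ξ₁ ξ₂ =>
        induction η with
        | zero => simp
        | add η η' h h' => rw [map_add, inner_add_right, inner_add_right, h, h']
        | tmul η₁ η₂ =>
          rw [ContinuousLinearMap.lTensor_tmul, ContinuousLinearMap.lTensor_tmul,
            TensorProduct.inner_tmul, TensorProduct.inner_tmul,
            ContinuousLinearMap.adjoint_inner_left]

theorem commute_amp (S : H →L[ℂ] H) (T : K →L[ℂ] K) :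
    Commute (ampLeft H K S) (ampRight H K T) := by
  refine op_ext fun ξ => ?_
  change (S.rTensor K).completion ((T.lTensor H).completion ξ)
    = (T.lTensor H).completion ((S.rTensor K).completion ξ)
  simp only [ContinuousLinearMap.completion_apply_coe]
  congr 1
  induction ξ with
  | zero => simp
  | add ξ ξ' h h' => simp only [map_add, h, h']
  | tmul ξ₁ ξ₂ => rfl

variable {H K}
variable {A B : Type*} [CStarAlgebra A] [CStarAlgebra B]

/-- The representation `π ⊗ σ` of the algebraic tensor product `A ⊗ B` on the Hilbert space tensor
product, `(π ⊗ σ)(a ⊗ b) = π a ⊗ σ b`. -/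
def tensorRep (π : A →⋆ₐ[ℂ] (H →L[ℂ] H)) (σ : B →⋆ₐ[ℂ] (K →L[ℂ] K)) :
    A ⊗[ℂ] B →⋆ₐ[ℂ] (HilbertTensor H K →L[ℂ] HilbertTensor H K) :=
  algLift (C := HilbertTensor H K →L[ℂ] HilbertTensor H K) ((ampLeft H K).comp π)
    ((ampRight H K).comp σ) fun a b => commute_amp H K (π a) (σ b)

theorem tensorRep_tmul (π : A →⋆ₐ[ℂ] (H →L[ℂ] H)) (σ : B →⋆ₐ[ℂ] (K →L[ℂ] K))
    (a : A) (b : B) :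
    tensorRep π σ (a ⊗ₜ b) = ampLeft H K (π a) * ampRight H K (σ b) :=
  algLift_tmul (C := HilbertTensor H K →L[ℂ] HilbertTensor H K) _ _ _ a b

theorem tensorRep_tmul_apply (π : A →⋆ₐ[ℂ] (H →L[ℂ] H)) (σ : B →⋆ₐ[ℂ] (K →L[ℂ] K))
    (a : A) (b : B) (ξ : H) (η : K) :
    tensorRep π σ (a ⊗ₜ b) ((ξ ⊗ₜ[ℂ] η : H ⊗[ℂ] K) : HilbertTensor H K)
      = ((π a ξ ⊗ₜ[ℂ] σ b η : H ⊗[ℂ] K) : HilbertTensor H K) := by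
  rw [tensorRep_tmul]
  change ((π a).rTensor K).completion (((σ b).lTensor H).completion _) = _
  simp

theorem norm_tensorRep_tmul_le (π : A →⋆ₐ[ℂ] (H →L[ℂ] H)) (σ : B →⋆ₐ[ℂ] (K →L[ℂ] K))
    (a : A) (b : B) : ‖tensorRep π σ (a ⊗ₜ b)‖ ≤ ‖a‖ * ‖b‖ := by
  rw [tensorRep_tmul]
  have h1 : ‖ampLeft H K (π a)‖ ≤ ‖a‖ :=
    NonUnitalStarAlgHom.norm_apply_le ((ampLeft H K).comp π) a
  have h2 : ‖ampRight H K (σ b)‖ ≤ ‖b‖ :=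
    NonUnitalStarAlgHom.norm_apply_le ((ampRight H K).comp σ) b
  refine (norm_mul_le (ampLeft H K (π a)) (ampRight H K (σ b))).trans ?_
  gcongr

end Rep

section MinTensor

variable (A B : Type) [CStarAlgebra A] [CStarAlgebra B]

/-- All seminorms `x ↦ ‖(π ⊗ σ)(x)‖`, where `π` and `σ` are unital *-representations of `A` and
`B` on Hilbert spaces. -/
def spatialSeminorms : Set (CStarSeminorm (A ⊗[ℂ] B)) :=
  {p | ∃ (H K : Type) (_ : NormedAddCommGroup H) (_ : InnerProductSpace ℂ H)
    (_ : CompleteSpace H) (_ : NormedAddCommGroup K) (_ : InnerProductSpace ℂ K)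
    (_ : CompleteSpace K) (π : A →⋆ₐ[ℂ] (H →L[ℂ] H)) (σ : B →⋆ₐ[ℂ] (K →L[ℂ] K)),
    p = CStarSeminorm.ofHom (D := HilbertTensor H K →L[ℂ] HilbertTensor H K) (tensorRep π σ)}

theorem spatialSeminorms_bdd (x : A ⊗[ℂ] B) :
    ∃ C : ℝ, ∀ p ∈ spatialSeminorms A B, p x ≤ C := by
  induction x with
  | zero => exact ⟨0, fun p _ => (map_zero p.toSeminorm).le⟩
  | add x y hx hy =>
    obtain ⟨C, hC⟩ := hx
    obtain ⟨C', hC'⟩ := hy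
    exact ⟨C + C', fun p hp => (map_add_le_add p.toSeminorm x y).trans
      (add_le_add (hC p hp) (hC' p hp))⟩
  | tmul a b =>
    refine ⟨‖a‖ * ‖b‖, ?_⟩
    rintro p ⟨H, K, _, _, _, _, _, _, π, σ, rfl⟩
    exact norm_tensorRep_tmul_le π σ a b

/-- The minimal C*-norm on the algebraic tensor product. -/
def minSeminorm : CStarSeminorm (A ⊗[ℂ] B) :=
  CStarSeminorm.sup (spatialSeminorms A B) (spatialSeminorms_bdd A B)

/-- The minimal tensor product of two unital C*-algebras. -/
def MinTensor : Type := (minSeminorm A B).Completion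

infixl:70 " ⊗min " => MinTensor

instance : CStarAlgebra (A ⊗min B) :=
  inferInstanceAs (CStarAlgebra (minSeminorm A B).Completion)

end MinTensor

namespace MinTensor

variable {A B C D : Type} [CStarAlgebra A] [CStarAlgebra B] [CStarAlgebra C] [CStarAlgebra D]

/-- The canonical map from the algebraic to the minimal tensor product. -/
def of : A ⊗[ℂ] B →⋆ₐ[ℂ] A ⊗min B := (minSeminorm A B).ofStar

/-- The elementary tensor `a ⊗ b` in the minimal tensor product. -/
def tmul (a : A) (b : B) : A ⊗min B := of (a ⊗ₜ[ℂ] b)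

theorem norm_of (x : A ⊗[ℂ] B) : ‖of x‖ = minSeminorm A B x := CStarSeminorm.norm_of _ x

theorem norm_tensorRep_le {H K : Type} [NormedAddCommGroup H] [InnerProductSpace ℂ H]
    [CompleteSpace H] [NormedAddCommGroup K] [InnerProductSpace ℂ K] [CompleteSpace K]
    (π : A →⋆ₐ[ℂ] (H →L[ℂ] H)) (σ : B →⋆ₐ[ℂ] (K →L[ℂ] K)) (x : A ⊗[ℂ] B) :
    ‖tensorRep π σ x‖ ≤ minSeminorm A B x :=
  CStarSeminorm.le_sup (spatialSeminorms A B) (spatialSeminorms_bdd A B)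
    (p := CStarSeminorm.ofHom (D := HilbertTensor H K →L[ℂ] HilbertTensor H K) (tensorRep π σ)) ⟨H, K, _, _, _, _, _, _, π, σ, rfl⟩ x

theorem tmul_mul_tmul (a a' : A) (b b' : B) :
    tmul a b * tmul a' b' = tmul (a * a') (b * b') := by
  simp only [tmul, ← map_mul, Algebra.TensorProduct.tmul_mul_tmul]

theorem star_tmul (a : A) (b : B) : star (tmul a b) = tmul (star a) (star b) := by
  simp only [tmul, ← map_star, TensorProduct.star_tmul]

theorem tmul_one_one : tmul (1 : A) (1 : B) = 1 := map_one of

theorem smul_tmul (c : ℂ) (a : A) (b : B) : tmul (c • a) b = c • tmul a b := by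
  simp only [tmul, ← map_smul, TensorProduct.smul_tmul']

theorem tmul_smul (c : ℂ) (a : A) (b : B) : tmul a (c • b) = c • tmul a b := by
  simp only [tmul, ← map_smul, TensorProduct.tmul_smul]

theorem hom_ext {φ ψ : A ⊗min B →⋆ₐ[ℂ] C} (h : ∀ a b, φ (tmul a b) = ψ (tmul a b)) : φ = ψ := by
  refine CStarSeminorm.hom_ext _ fun x => ?_
  change φ (of x) = ψ (of x)
  induction x with
  | zero => simp
  | add x y hx hy => rw [map_add, map_add, map_add, hx, hy]
  | tmul a b => exact h a b

/-- `a ↦ a ⊗ 1`. -/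
def inl : A →⋆ₐ[ℂ] A ⊗min B where
  toFun a := tmul a 1
  map_one' := tmul_one_one
  map_mul' a b := by rw [tmul_mul_tmul, mul_one]
  map_zero' := by rw [tmul, TensorProduct.zero_tmul, map_zero]
  map_add' a b := by rw [tmul, TensorProduct.add_tmul, map_add]; rfl
  commutes' c := by
    rw [Algebra.algebraMap_eq_smul_one, smul_tmul, tmul_one_one, Algebra.algebraMap_eq_smul_one]
  map_star' a := by rw [star_tmul, star_one]

/-- `b ↦ 1 ⊗ b`. -/
def inr : B →⋆ₐ[ℂ] A ⊗min B where
  toFun b := tmul 1 b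
  map_one' := tmul_one_one
  map_mul' a b := by rw [tmul_mul_tmul, mul_one]
  map_zero' := by rw [tmul, TensorProduct.tmul_zero, map_zero]
  map_add' a b := by rw [tmul, TensorProduct.tmul_add, map_add]; rfl
  commutes' c := by
    rw [Algebra.algebraMap_eq_smul_one, tmul_smul, tmul_one_one, Algebra.algebraMap_eq_smul_one]
  map_star' a := by rw [star_tmul, star_one]

theorem inl_apply (a : A) : (inl a : A ⊗min B) = tmul a 1 := rfl
theorem inr_apply (b : B) : (inr b : A ⊗min B) = tmul 1 b := rfl

/-- The *-homomorphism `f ⊗ g` between algebraic tensor products. -/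
def algMap (f : A →⋆ₐ[ℂ] C) (g : B →⋆ₐ[ℂ] D) : A ⊗[ℂ] B →⋆ₐ[ℂ] C ⊗[ℂ] D :=
  { Algebra.TensorProduct.map (f : A →ₐ[ℂ] C) (g : B →ₐ[ℂ] D) with
    map_star' := fun x => by
      change Algebra.TensorProduct.map (f : A →ₐ[ℂ] C) (g : B →ₐ[ℂ] D) (star x)
        = star (Algebra.TensorProduct.map (f : A →ₐ[ℂ] C) (g : B →ₐ[ℂ] D) x)
      induction x with
      | zero => simp
      | add x y hx hy => rw [star_add, map_add, map_add, star_add, hx, hy]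
      | tmul a b => simp [map_star] }

theorem algMap_tmul (f : A →⋆ₐ[ℂ] C) (g : B →⋆ₐ[ℂ] D) (a : A) (b : B) :
    algMap f g (a ⊗ₜ b) = f a ⊗ₜ g b := rfl

theorem tensorRep_algMap {H K : Type} [NormedAddCommGroup H] [InnerProductSpace ℂ H]
    [CompleteSpace H] [NormedAddCommGroup K] [InnerProductSpace ℂ K] [CompleteSpace K]
    (π : C →⋆ₐ[ℂ] (H →L[ℂ] H)) (σ : D →⋆ₐ[ℂ] (K →L[ℂ] K)) (f : A →⋆ₐ[ℂ] C) (g : B →⋆ₐ[ℂ] D)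
    (x : A ⊗[ℂ] B) : tensorRep π σ (algMap f g x) = tensorRep (π.comp f) (σ.comp g) x := by
  induction x with
  | zero => simp
  | add x y hx hy => rw [map_add, map_add, map_add, hx, hy]
  | tmul a b => rw [algMap_tmul, tensorRep_tmul, tensorRep_tmul]; rfl

theorem minSeminorm_algMap_le (f : A →⋆ₐ[ℂ] C) (g : B →⋆ₐ[ℂ] D) (x : A ⊗[ℂ] B) :
    minSeminorm C D (algMap f g x) ≤ minSeminorm A B x := by
  refine CStarSeminorm.sup_le _ _ ((minSeminorm A B).nonneg x) ?_
  rintro p ⟨H, K, _, _, _, _, _, _, π, σ, rfl⟩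
  change ‖tensorRep π σ (algMap f g x)‖ ≤ _
  rw [tensorRep_algMap]
  exact norm_tensorRep_le (π.comp f) (σ.comp g) x

/-- The *-homomorphism `f ⊗ g` between minimal tensor products. -/
def map (f : A →⋆ₐ[ℂ] C) (g : B →⋆ₐ[ℂ] D) : A ⊗min B →⋆ₐ[ℂ] C ⊗min D :=
  CStarSeminorm.lift _ (of.comp (algMap f g)) fun x => by
    rw [StarAlgHom.comp_apply, norm_of]
    exact minSeminorm_algMap_le f g x

@[simp]
theorem map_tmul (f : A →⋆ₐ[ℂ] C) (g : B →⋆ₐ[ℂ] D) (a : A) (b : B) :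
    map f g (tmul a b) = tmul (f a) (g b) :=
  CStarSeminorm.lift_of _ _ _ _

end MinTensor

/-! ### The circle, the noncommutative torus, and `𝕋`-C*-algebras -/

section Circle

/-- The C*-algebra `C(𝕋)` of continuous functions on the circle. -/
abbrev CT : Type := C(Circle, ℂ)

/-- The coordinate function `z`, a unitary of `C(𝕋)`. -/
def coordZ : unitary CT :=
  ⟨⟨fun w => (w : ℂ), by fun_prop⟩, by
    rw [Unitary.mem_iff]
    constructor <;> ext w
    · change (starRingEnd ℂ) (w : ℂ) * (w : ℂ) = 1
      rw [Complex.conj_mul', Circle.norm_coe]; simp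
    · change (w : ℂ) * (starRingEnd ℂ) (w : ℂ) = 1
      rw [Complex.mul_conj', Circle.norm_coe]; simp⟩

variable {D : Type*} [CStarAlgebra D]

theorem mem_circle_of_mem_spectrum (v : unitary D) {x : ℂ} (hx : x ∈ spectrum ℂ (v : D)) :
    x ∈ Submonoid.unitSphere ℂ :=
  spectrum.subset_circle_of_unitary v.2 hx

/-- The unital *-homomorphism `C(𝕋) → D` that sends the coordinate `z` to a given unitary `v` of
`D` (continuous functional calculus). -/
def circleHom (v : unitary D) : CT →⋆ₐ[ℂ] D :=
  have : IsStarNormal (v : D) := ⟨by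
    rw [commute_iff_eq, Unitary.star_mul_self_of_mem v.2, Unitary.mul_star_self_of_mem v.2]⟩
  (cfcHom (R := ℂ) (a := (v : D)) this).comp
    (ContinuousMap.compStarAlgHom' ℂ ℂ
      ⟨fun x : spectrum ℂ (v : D) => (⟨x.1, mem_circle_of_mem_spectrum v x.2⟩ : Circle),
        by fun_prop⟩)

theorem circleHom_coordZ (v : unitary D) : circleHom v (coordZ : CT) = v :=
  cfcHom_id (R := ℂ) (a := (v : D)) _

/-- The image of a unitary under a unital *-homomorphism. -/
def mapU {A B : Type*} [CStarAlgebra A] [CStarAlgebra B] (φ : A →⋆ₐ[ℂ] B) :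
    unitary A →* unitary B where
  toFun a := ⟨φ a, Unitary.map_mem φ a.2⟩
  map_one' := Subtype.ext (map_one φ)
  map_mul' _ _ := Subtype.ext (map_mul φ _ _)

theorem map_zpow_coe {A B : Type*} [CStarAlgebra A] [CStarAlgebra B] (φ : A →⋆ₐ[ℂ] B)
    (a : unitary A) (k : ℤ) : φ ((a ^ k : unitary A) : A) = ((mapU φ a ^ k : unitary B) : B) :=
  congrArg Subtype.val (map_zpow (mapU φ) a k)

theorem circleHom_zpow (v : unitary D) (k : ℤ) :
    circleHom v ((coordZ ^ k : unitary CT) : CT) = ((v ^ k : unitary D) : D) := by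
  rw [map_zpow_coe]
  congr 2
  exact Subtype.ext (circleHom_coordZ v)

theorem star_coe_zpow (v : unitary D) (k : ℤ) :
    star ((v ^ k : unitary D) : D) = ((v ^ (-k) : unitary D) : D) := by
  rw [← Unitary.coe_star, Unitary.star_eq_inv, zpow_neg]

theorem coe_zpow_mul (v : unitary D) (k l : ℤ) :
    ((v ^ k : unitary D) : D) * ((v ^ l : unitary D) : D) = ((v ^ (k + l) : unitary D) : D) := by
  rw [zpow_add]; rfl

/-- The integer powers of `z` span a dense subspace of `C(𝕋)`. -/
theorem dense_span_zpow :
    (Submodule.span ℂ (Set.range fun k : ℤ => ((coordZ ^ k : unitary CT) : CT))).topologicalClosure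
      = ⊤ := by
  have h : (StarAlgebra.adjoin ℂ {(coordZ : CT)}).topologicalClosure = ⊤ := by
    refine ContinuousMap.starSubalgebra_topologicalClosure_eq_top_of_separatesPoints _ ?_
    intro x y hxy
    exact ⟨_, ⟨_, StarAlgebra.self_mem_adjoin_singleton ℂ (coordZ : CT), rfl⟩,
      fun h => hxy (Subtype.ext h)⟩
  have h2 : ∀ x ∈ StarAlgebra.adjoin ℂ {(coordZ : CT)},
      x ∈ Submodule.span ℂ (Set.range fun k : ℤ => ((coordZ ^ k : unitary CT) : CT)) := by
    intro x hx
    induction hx using StarAlgebra.adjoin_induction with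
    | mem x hx =>
      rw [Set.mem_singleton_iff] at hx
      subst hx
      exact Submodule.subset_span ⟨1, by simp⟩
    | algebraMap c =>
      rw [Algebra.algebraMap_eq_smul_one]
      exact Submodule.smul_mem _ _ (Submodule.subset_span ⟨0, by simp⟩)
    | add x y _ _ hx hy => exact add_mem hx hy
    | mul x y _ _ hx hy =>
      have := Submodule.mul_mem_mul hx hy
      rw [Submodule.span_mul_span] at this
      refine Submodule.span_mono ?_ this
      rintro _ ⟨_, ⟨k, rfl⟩, _, ⟨l, rfl⟩, rfl⟩
      exact ⟨k + l, (coe_zpow_mul coordZ k l).symm⟩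
    | star x hm hx =>
      clear hm
      induction hx using Submodule.span_induction with
      | mem x hx =>
        obtain ⟨k, rfl⟩ := hx
        exact Submodule.subset_span ⟨-k, (star_coe_zpow coordZ k).symm⟩
      | zero => rw [star_zero]; exact zero_mem _
      | add x y _ _ hx hy => rw [star_add]; exact add_mem hx hy
      | smul c x _ hx => rw [star_smul]; exact Submodule.smul_mem _ _ hx
  rw [eq_top_iff]
  intro x _
  have hx : x ∈ closure ((StarAlgebra.adjoin ℂ {(coordZ : CT)} : StarSubalgebra ℂ CT) : Set CT) := by
    rw [← StarSubalgebra.topologicalClosure_coe, h]; trivial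
  exact closure_mono h2 hx

end Circle

section Torus

/-- The relations of the noncommutative torus: `U = gen 0` and `V = gen 1` are unitary and
`V U = ζ U V`. -/
def torusRels (ζ : Circle) : Set (FreeStar (Fin 2)) :=
  let U : FreeStar (Fin 2) := FreeStar.gen 0
  let V : FreeStar (Fin 2) := FreeStar.gen 1
  {star U * U - 1, U * star U - 1, star V * V - 1, V * star V - 1, V * U - (ζ : ℂ) • (U * V)}

theorem CStarSeminorm.apply_one_le {R : Type*} [Ring R] [StarRing R] [Algebra ℂ R]
    (p : CStarSeminorm R) : p 1 ≤ 1 := by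
  have := p.star_mul_self 1
  rw [star_one, mul_one] at this
  nlinarith [p.nonneg 1]

theorem CStarSeminorm.apply_le_one {R : Type*} [Ring R] [StarRing R] [Algebra ℂ R]
    (p : CStarSeminorm R) {a : R} (h : p (star a * a - 1) = 0) : p a ≤ 1 := by
  have h1 : p (star a * a) ≤ p (star a * a - 1) + p 1 := by
    have := map_add_le_add p.toSeminorm (star a * a - 1) 1
    rwa [sub_add_cancel] at this
  have h2 := p.apply_one_le
  rw [p.star_mul_self] at h1
  nlinarith [p.nonneg a]

theorem torusRels_bounding (ζ : Circle) : FreeStar.Bounding (torusRels ζ) := by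
  intro x
  refine ⟨1, fun p hp => p.apply_le_one (hp _ ?_)⟩
  fin_cases x <;> simp [torusRels]

/-- `C(𝕋²_ζ)`, the universal C*-algebra generated by unitaries `U`, `V` with `V U = ζ U V`. -/
def NCTorus (ζ : Circle) : Type := UnivCStar (torusRels ζ) (torusRels_bounding ζ)

instance (ζ : Circle) : CStarAlgebra (NCTorus ζ) :=
  inferInstanceAs (CStarAlgebra (UnivCStar (torusRels ζ) (torusRels_bounding ζ)))

namespace NCTorus

variable (ζ : Circle)

/-- The generators, `gen ζ 0 = U` and `gen ζ 1 = V`. -/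
def gen (i : Fin 2) : NCTorus ζ := UnivCStar.gen (torusRels_bounding ζ) i

theorem gen_mem_unitary (i : Fin 2) : gen ζ i ∈ unitary (NCTorus ζ) := by
  have h1 : star (FreeStar.gen i) * FreeStar.gen i - 1 ∈ torusRels ζ := by
    fin_cases i <;> simp [torusRels]
  have h2 : FreeStar.gen i * star (FreeStar.gen i) - 1 ∈ torusRels ζ := by
    fin_cases i <;> simp [torusRels]
  have h1' := UnivCStar.of_rel (torusRels_bounding ζ) h1
  have h2' := UnivCStar.of_rel (torusRels_bounding ζ) h2
  rw [map_sub, map_mul, map_star, map_one, sub_eq_zero] at h1' h2'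
  exact (Unitary.mem_iff (R := NCTorus ζ)).mpr ⟨h1', h2'⟩

/-- The generator `U`. -/
def U : unitary (NCTorus ζ) := ⟨gen ζ 0, gen_mem_unitary ζ 0⟩

/-- The generator `V`. -/
def V : unitary (NCTorus ζ) := ⟨gen ζ 1, gen_mem_unitary ζ 1⟩

theorem V_mul_U : (V ζ : NCTorus ζ) * U ζ = (ζ : ℂ) • ((U ζ : NCTorus ζ) * V ζ) := by
  have h : (FreeStar.gen 1 * FreeStar.gen 0 - (ζ : ℂ) • (FreeStar.gen 0 * FreeStar.gen 1) :
      FreeStar (Fin 2)) ∈ torusRels ζ := by simp [torusRels]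
  have h' := UnivCStar.of_rel (torusRels_bounding ζ) h
  rw [map_sub, map_smul, map_mul, map_mul, sub_eq_zero] at h'
  exact h'

/-- The unitary scalar `c`. -/
def scalarU {D : Type*} [CStarAlgebra D] : Circle →* unitary D where
  toFun c := ⟨(c : ℂ) • (1 : D), by
    rw [Unitary.mem_iff]
    constructor <;> simp [smul_smul, Complex.conj_mul', Complex.mul_conj', Circle.norm_coe]⟩
  map_one' := Subtype.ext (by simp)
  map_mul' a b := Subtype.ext (by simp [smul_smul, mul_comm])

theorem commute_scalarU {D : Type*} [CStarAlgebra D] (c : Circle) (v : unitary D) :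
    Commute (scalarU c) v := Subtype.ext (by simp [scalarU])

theorem zpow_comm {G : Type*} [Group G] {u v c : G} (hcu : Commute c u) (hcv : Commute c v)
    (h : v * u = c * (u * v)) (k l : ℤ) : v ^ l * u ^ k = c ^ (l * k) * (u ^ k * v ^ l) := by
  have h1 : v * u * v⁻¹ = c * u := by rw [h]; group
  have h2 : ∀ k : ℤ, v * u ^ k * v⁻¹ = c ^ k * u ^ k := fun k => by
    rw [← conj_zpow, h1, hcu.mul_zpow]
  have h3 : u ^ (-k) * v * u ^ k = c ^ k * v := by
    have := h2 k
    rw [mul_inv_eq_iff_eq_mul] at this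
    rw [mul_assoc, this, zpow_neg, mul_assoc, ← mul_assoc, ← (hcu.zpow_zpow k k).inv_right.eq]
    group
  have h4 : u ^ (-k) * v ^ l * u ^ k = c ^ (l * k) * v ^ l := by
    have : u ^ (-k) * v ^ l * u ^ k = (u ^ (-k) * v * u ^ k) ^ l := by
      rw [zpow_neg]
      have := conj_zpow (i := l) (a := (u ^ k)⁻¹) (b := v)
      rw [inv_inv] at this
      exact this.symm
    rw [this, h3, (hcv.zpow_left k).mul_zpow, ← zpow_mul, mul_comm k l]
  calc v ^ l * u ^ k = u ^ k * (u ^ (-k) * v ^ l * u ^ k) := by group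
    _ = u ^ k * (c ^ (l * k) * v ^ l) := by rw [h4]
    _ = _ := by rw [← mul_assoc, ← (hcu.zpow_zpow (l * k) k).eq, mul_assoc]

theorem V_zpow_mul_U_zpow (l k : ℤ) :
    ((V ζ ^ l : unitary (NCTorus ζ)) : NCTorus ζ) * ((U ζ ^ k : unitary (NCTorus ζ)) : NCTorus ζ)
      = ((ζ ^ (l * k) : Circle) : ℂ) •
        (((U ζ ^ k : unitary (NCTorus ζ)) : NCTorus ζ) *
          ((V ζ ^ l : unitary (NCTorus ζ)) : NCTorus ζ)) := by
  have h : V ζ * U ζ = scalarU ζ * (U ζ * V ζ) := Subtype.ext (by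
    change (V ζ : NCTorus ζ) * U ζ = ((ζ : ℂ) • (1 : NCTorus ζ)) * ((U ζ : NCTorus ζ) * V ζ)
    rw [V_mul_U, smul_one_mul])
  have := congrArg Subtype.val
    (zpow_comm (commute_scalarU ζ (U ζ)) (commute_scalarU ζ (V ζ)) h k l)
  rw [← map_zpow] at this
  refine this.trans ?_
  change (((ζ ^ (l * k) : Circle) : ℂ) • (1 : NCTorus ζ)) * _ = _
  rw [smul_one_mul]
  rfl

end NCTorus

end Torus

/-- A `𝕋`-C*-algebra structure on the unital C*-algebra `X`: a coaction
`ρ : X → X ⊗ C(𝕋)` of `C(𝕋)`. It is recorded through its spectral subspaces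
`X(k) = {x | ρ x = x ⊗ z ^ k}`: the requirement is that their sum is dense in `X`.
For a unital *-homomorphism `ρ : X → X ⊗ C(𝕋)` this is equivalent to coassociativity
`(ρ ⊗ id) ρ = (id ⊗ Δ) ρ` together with the density of `ρ(X)(1 ⊗ C(𝕋))` in `X ⊗ C(𝕋)`. If the sum
of the `X(k)` is dense, then both conditions hold because they can be checked on the `X(k)`, where
`(ρ ⊗ id) ρ x = x ⊗ z ^ k ⊗ z ^ k = (id ⊗ Δ) ρ x` and `ρ x (1 ⊗ z ^ (-k) f) = x ⊗ f`; conversely a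
coaction is a continuous action of `𝕋`, whose Fourier components span a dense subspace. -/
structure CircleCoaction (X : Type) [CStarAlgebra X] where
  /-- The map `ρ : X → X ⊗ C(𝕋)`. -/
  coact : X →⋆ₐ[ℂ] X ⊗min CT
  /-- The homogeneous elements span a dense subspace. -/
  dense_homogeneous :
    (Submodule.span ℂ {x : X | ∃ k : ℤ,
      coact x = MinTensor.tmul x ((coordZ ^ k : unitary CT) : CT)}).topologicalClosure = ⊤

namespace CircleCoaction

variable {X Y : Type} [CStarAlgebra X] [CStarAlgebra Y]

/-- `x` is homogeneous of degree `k` if `ρ x = x ⊗ z ^ k`. -/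
def IsHomogeneous (ρ : CircleCoaction X) (k : ℤ) (x : X) : Prop :=
  ρ.coact x = MinTensor.tmul x ((coordZ ^ k : unitary CT) : CT)

theorem IsHomogeneous.mul {ρ : CircleCoaction X} {k l : ℤ} {x y : X}
    (hx : ρ.IsHomogeneous k x) (hy : ρ.IsHomogeneous l y) : ρ.IsHomogeneous (k + l) (x * y) := by
  rw [IsHomogeneous] at *
  rw [map_mul, hx, hy, MinTensor.tmul_mul_tmul, coe_zpow_mul]

theorem IsHomogeneous.star {ρ : CircleCoaction X} {k : ℤ} {x : X}
    (hx : ρ.IsHomogeneous k x) : ρ.IsHomogeneous (-k) (star x) := by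
  rw [IsHomogeneous] at *
  rw [map_star, hx, MinTensor.star_tmul, star_coe_zpow]

/-- A unital *-homomorphism is `𝕋`-equivariant if it intertwines the coactions. -/
def IsEquivariant (ρ : CircleCoaction X) (σ : CircleCoaction Y) (φ : X →⋆ₐ[ℂ] Y) : Prop :=
  σ.coact.comp φ = (MinTensor.map φ (StarAlgHom.id ℂ CT)).comp ρ.coact

end CircleCoaction

/-- The unitary `a ⊗ b` of `A ⊗ B`, for unitaries `a` and `b`. -/
def tmulU {A B : Type} [CStarAlgebra A] [CStarAlgebra B] (a : unitary A) (b : unitary B) :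
    unitary (A ⊗min B) :=
  ⟨MinTensor.tmul (a : A) (b : B), by
    rw [Unitary.mem_iff, MinTensor.star_tmul, MinTensor.tmul_mul_tmul, MinTensor.tmul_mul_tmul,
      Unitary.star_mul_self_of_mem a.2, Unitary.mul_star_self_of_mem a.2,
      Unitary.star_mul_self_of_mem b.2, Unitary.mul_star_self_of_mem b.2]
    exact ⟨MinTensor.tmul_one_one, MinTensor.tmul_one_one⟩⟩

theorem tmulU_zpow {A B : Type} [CStarAlgebra A] [CStarAlgebra B] (a : unitary A) (b : unitary B)
    (k : ℤ) : tmulU a b ^ k = tmulU (a ^ k) (b ^ k) := by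
  have h : ∀ a a' : unitary A, ∀ b b' : unitary B, tmulU a b * tmulU a' b' = tmulU (a * a') (b * b') :=
    fun a a' b b' => Subtype.ext (MinTensor.tmul_mul_tmul _ _ _ _)
  let f : unitary A × unitary B →* unitary (A ⊗min B) :=
    { toFun := fun p => tmulU p.1 p.2
      map_one' := Subtype.ext MinTensor.tmul_one_one
      map_mul' := fun p q => (h _ _ _ _).symm }
  exact (map_zpow f (a, b) k).symm

/-- The comultiplication `Δ_𝕋 : C(𝕋) → C(𝕋) ⊗ C(𝕋)`, `Δ_𝕋 z = z ⊗ z`. -/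
def deltaT : CT →⋆ₐ[ℂ] CT ⊗min CT := circleHom (tmulU coordZ coordZ)

/-- `C(𝕋)` with the coaction `Δ_𝕋`. -/
def coactionT : CircleCoaction CT where
  coact := deltaT
  dense_homogeneous := by
    rw [eq_top_iff, ← dense_span_zpow]
    refine Submodule.topologicalClosure_mono (Submodule.span_mono ?_)
    rintro _ ⟨k, rfl⟩
    exact ⟨k, by rw [deltaT, circleHom_zpow, tmulU_zpow]; rfl⟩

theorem coactionT_isHomogeneous : coactionT.IsHomogeneous 1 (coordZ : CT) := by
  rw [CircleCoaction.IsHomogeneous, zpow_one]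
  exact circleHom_coordZ _

/-! ### The braided tensor product -/

section Braided

variable (ζ : Circle) {X Y : Type} [CStarAlgebra X] [CStarAlgebra Y]
  (ρX : CircleCoaction X) (ρY : CircleCoaction Y)

/-- `j₁ : X → X ⊗ Y ⊗ C(𝕋²_ζ)`, given by `x ↦ x ⊗ 1 ⊗ U ^ k` on homogeneous elements of degree
`k`. -/
def preJ₁ : X →⋆ₐ[ℂ] (X ⊗min Y) ⊗min NCTorus ζ :=
  (MinTensor.map (MinTensor.inl : X →⋆ₐ[ℂ] X ⊗min Y) (circleHom (NCTorus.U ζ))).comp ρX.coact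

/-- `j₂ : Y → X ⊗ Y ⊗ C(𝕋²_ζ)`, given by `y ↦ 1 ⊗ y ⊗ V ^ l` on homogeneous elements of degree
`l`. -/
def preJ₂ : Y →⋆ₐ[ℂ] (X ⊗min Y) ⊗min NCTorus ζ :=
  (MinTensor.map (MinTensor.inr : Y →⋆ₐ[ℂ] X ⊗min Y) (circleHom (NCTorus.V ζ))).comp ρY.coact

/-- The C*-subalgebra of `X ⊗ Y ⊗ C(𝕋²_ζ)` generated by `j₁(X)` and `j₂(Y)`; it is the closed linear
span of the products `j₁(x) j₂(y)`. -/
def braidedSubalgebra : StarSubalgebra ℂ ((X ⊗min Y) ⊗min NCTorus ζ) :=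
  (StarAlgebra.adjoin ℂ (Set.range (preJ₁ ζ ρX (Y := Y)) ∪
    Set.range (preJ₂ ζ ρY (X := X)))).topologicalClosure

/-- The braided tensor product `X ⊠_ζ Y`. -/
def BraidedTensor : Type := braidedSubalgebra ζ ρX ρY

theorem isClosed_braidedSubalgebra : IsClosed (braidedSubalgebra ζ ρX ρY :
    Set ((X ⊗min Y) ⊗min NCTorus ζ)) :=
  StarSubalgebra.isClosed_topologicalClosure _

instance : CStarAlgebra (BraidedTensor ζ ρX ρY) :=
  have := isClosed_braidedSubalgebra ζ ρX ρY
  inferInstanceAs (CStarAlgebra (braidedSubalgebra ζ ρX ρY))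

namespace BraidedTensor

/-- The inclusion `X ⊠_ζ Y ⊆ X ⊗ Y ⊗ C(𝕋²_ζ)`. -/
def incl : BraidedTensor ζ ρX ρY →⋆ₐ[ℂ] (X ⊗min Y) ⊗min NCTorus ζ :=
  (braidedSubalgebra ζ ρX ρY).subtype

theorem incl_injective : Function.Injective (incl ζ ρX ρY) := Subtype.val_injective

/-- `j₁ : X → X ⊠_ζ Y`. -/
def j₁ : X →⋆ₐ[ℂ] BraidedTensor ζ ρX ρY :=
  StarAlgHom.codRestrict (preJ₁ ζ ρX (Y := Y)) (braidedSubalgebra ζ ρX ρY) fun x =>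
    StarSubalgebra.le_topologicalClosure _
      (StarAlgebra.subset_adjoin ℂ _ (Or.inl (Set.mem_range_self x)))

/-- `j₂ : Y → X ⊠_ζ Y`. -/
def j₂ : Y →⋆ₐ[ℂ] BraidedTensor ζ ρX ρY :=
  StarAlgHom.codRestrict (preJ₂ ζ ρY (X := X)) (braidedSubalgebra ζ ρX ρY) fun y =>
    StarSubalgebra.le_topologicalClosure _
      (StarAlgebra.subset_adjoin ℂ _ (Or.inr (Set.mem_range_self y)))

variable {ρX ρY}

theorem incl_j₁ {k : ℤ} {x : X} (hx : ρX.IsHomogeneous k x) : incl ζ ρX ρY (j₁ ζ ρX ρY x) =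
    MinTensor.tmul (MinTensor.tmul x 1) ((NCTorus.U ζ ^ k : unitary (NCTorus ζ)) : NCTorus ζ) := by
  change MinTensor.map _ _ (ρX.coact x) = _
  rw [hx, MinTensor.map_tmul, circleHom_zpow]
  rfl

theorem incl_j₂ {l : ℤ} {y : Y} (hy : ρY.IsHomogeneous l y) : incl ζ ρX ρY (j₂ ζ ρX ρY y) =
    MinTensor.tmul (MinTensor.tmul 1 y) ((NCTorus.V ζ ^ l : unitary (NCTorus ζ)) : NCTorus ζ) := by
  change MinTensor.map _ _ (ρY.coact y) = _
  rw [hy, MinTensor.map_tmul, circleHom_zpow]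
  rfl

/-- The braided commutation relation. -/
theorem j₂_mul_j₁ {k l : ℤ} {x : X} {y : Y} (hx : ρX.IsHomogeneous k x)
    (hy : ρY.IsHomogeneous l y) : j₂ ζ ρX ρY y * j₁ ζ ρX ρY x =
      ((ζ ^ (l * k) : Circle) : ℂ) • (j₁ ζ ρX ρY x * j₂ ζ ρX ρY y) := by
  apply incl_injective ζ ρX ρY
  rw [map_mul, map_smul, map_mul, incl_j₁ ζ hx, incl_j₂ ζ hy, MinTensor.tmul_mul_tmul,
    MinTensor.tmul_mul_tmul, MinTensor.tmul_mul_tmul, MinTensor.tmul_mul_tmul,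
    NCTorus.V_zpow_mul_U_zpow, MinTensor.tmul_smul]
  simp only [one_mul, mul_one]

end BraidedTensor

end Braided

section BraidedSpan

variable (ζ : Circle) {X Y : Type} [CStarAlgebra X] [CStarAlgebra Y]
  (ρX : CircleCoaction X) (ρY : CircleCoaction Y)

namespace BraidedTensor

/-- The products `j₁ x * j₂ y` of homogeneous elements. -/
def homProducts : Set (BraidedTensor ζ ρX ρY) :=
  {b | ∃ (k l : ℤ) (x : X) (y : Y), ρX.IsHomogeneous k x ∧ ρY.IsHomogeneous l y ∧
    b = j₁ ζ ρX ρY x * j₂ ζ ρX ρY y}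

variable {ρX ρY}

theorem _root_.BraidedUnitary.CircleCoaction.isHomogeneous_one {X : Type} [CStarAlgebra X]
    (ρ : CircleCoaction X) : ρ.IsHomogeneous 0 1 := by
  rw [CircleCoaction.IsHomogeneous, map_one, zpow_zero]
  exact MinTensor.tmul_one_one.symm

theorem j₁_mul_j₂ {k l : ℤ} {x : X} {y : Y} (hx : ρX.IsHomogeneous k x)
    (hy : ρY.IsHomogeneous l y) : j₁ ζ ρX ρY x * j₂ ζ ρX ρY y =
      ((ζ ^ (-(l * k)) : Circle) : ℂ) • (j₂ ζ ρX ρY y * j₁ ζ ρX ρY x) := by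
  rw [j₂_mul_j₁ ζ hx hy, smul_smul, ← Circle.coe_mul, ← zpow_add, neg_add_cancel, zpow_zero,
    Circle.coe_one, one_smul]

theorem mul_mem_span {a b : BraidedTensor ζ ρX ρY}
    (ha : a ∈ Submodule.span ℂ (homProducts ζ ρX ρY))
    (hb : b ∈ Submodule.span ℂ (homProducts ζ ρX ρY)) :
    a * b ∈ Submodule.span ℂ (homProducts ζ ρX ρY) := by
  have h := Submodule.mul_mem_mul ha hb
  rw [Submodule.span_mul_span] at h
  refine Submodule.span_le.mpr ?_ h
  rintro _ ⟨_, ⟨k, l, x, y, hx, hy, rfl⟩, _, ⟨k', l', x', y', hx', hy', rfl⟩, rfl⟩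
  have : (j₁ ζ ρX ρY x * j₂ ζ ρX ρY y) * (j₁ ζ ρX ρY x' * j₂ ζ ρX ρY y') =
      ((ζ ^ (l * k') : Circle) : ℂ) • (j₁ ζ ρX ρY (x * x') * j₂ ζ ρX ρY (y * y')) := by
    rw [map_mul, map_mul, mul_assoc, ← mul_assoc (j₂ ζ ρX ρY y), j₂_mul_j₁ ζ hx' hy, smul_mul_assoc,
      mul_smul_comm]
    simp only [mul_assoc]
  change (j₁ ζ ρX ρY x * j₂ ζ ρX ρY y) * (j₁ ζ ρX ρY x' * j₂ ζ ρX ρY y') ∈ _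
  rw [this]
  exact Submodule.smul_mem _ _ (Submodule.subset_span ⟨_, _, _, _, hx.mul hx', hy.mul hy', rfl⟩)

theorem star_mem_span {a : BraidedTensor ζ ρX ρY}
    (ha : a ∈ Submodule.span ℂ (homProducts ζ ρX ρY)) :
    star a ∈ Submodule.span ℂ (homProducts ζ ρX ρY) := by
  induction ha using Submodule.span_induction with
  | mem a ha =>
    obtain ⟨k, l, x, y, hx, hy, rfl⟩ := ha
    rw [star_mul, ← map_star, ← map_star, j₂_mul_j₁ ζ hx.star hy.star]
    exact Submodule.smul_mem _ _ (Submodule.subset_span ⟨_, _, _, _, hx.star, hy.star, rfl⟩)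
  | zero => rw [star_zero]; exact zero_mem _
  | add a b _ _ ha hb => rw [star_add]; exact add_mem ha hb
  | smul c a _ ha => rw [star_smul]; exact Submodule.smul_mem _ _ ha

variable (ρX ρY)

/-- The span of the products of homogeneous elements, a *-subalgebra. -/
def homSubalgebra : StarSubalgebra ℂ (BraidedTensor ζ ρX ρY) where
  carrier := Submodule.span ℂ (homProducts ζ ρX ρY)
  mul_mem' := mul_mem_span ζ
  add_mem' := add_mem
  algebraMap_mem' c := by
    rw [Algebra.algebraMap_eq_smul_one]
    refine Submodule.smul_mem _ _ (Submodule.subset_span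
      ⟨0, 0, 1, 1, ρX.isHomogeneous_one, ρY.isHomogeneous_one, ?_⟩)
    rw [map_one, map_one, mul_one]
  star_mem' := star_mem_span ζ

theorem apply_mem_of_homogeneous {Z : Type} [CStarAlgebra Z] (ρ : CircleCoaction Z)
    {D : Type*} [CStarAlgebra D] (φ : Z →⋆ₐ[ℂ] D) (S : StarSubalgebra ℂ D)
    (h : ∀ k x, ρ.IsHomogeneous k x → φ x ∈ S) (x : Z) : φ x ∈ S.topologicalClosure := by
  have hx : x ∈ closure ((Submodule.span ℂ {x : Z | ∃ k : ℤ, ρ.IsHomogeneous k x} :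
      Submodule ℂ Z) : Set Z) := by
    rw [← Submodule.topologicalClosure_coe]
    have := ρ.dense_homogeneous
    change (Submodule.span ℂ {x : Z | ∃ k : ℤ, ρ.IsHomogeneous k x}).topologicalClosure = ⊤ at this
    rw [this]; trivial
  refine map_mem_closure (starHom_continuous φ) hx fun y hy => ?_
  change φ y ∈ S
  induction hy using Submodule.span_induction with
  | mem y hy => obtain ⟨k, hk⟩ := hy; exact h k y hk
  | zero => rw [map_zero]; exact zero_mem S
  | add a b _ _ ha hb => rw [map_add]; exact add_mem ha hb
  | smul c a _ ha => rw [map_smul]; exact S.smul_mem ha c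

/-- `X ⊠_ζ Y` is generated as a C*-algebra by `j₁(X)` and `j₂(Y)`. -/
theorem adjoin_eq_top : (StarAlgebra.adjoin ℂ (Set.range (j₁ ζ ρX ρY) ∪
    Set.range (j₂ ζ ρX ρY))).topologicalClosure = ⊤ := by
  rw [eq_top_iff]
  intro b _
  have hind : Topology.IsInducing (incl ζ ρX ρY) := Topology.IsInducing.subtypeVal
  have hb' : incl ζ ρX ρY b ∈ closure ((StarAlgebra.adjoin ℂ (Set.range (preJ₁ ζ ρX (Y := Y)) ∪
    Set.range (preJ₂ ζ ρY (X := X))) : StarSubalgebra ℂ _) :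
      Set ((X ⊗min Y) ⊗min NCTorus ζ)) := b.2
  have hmap : (StarAlgebra.adjoin ℂ (Set.range (preJ₁ ζ ρX (Y := Y)) ∪
      Set.range (preJ₂ ζ ρY (X := X)))) = (StarAlgebra.adjoin ℂ (Set.range (j₁ ζ ρX ρY) ∪
      Set.range (j₂ ζ ρX ρY))).map (incl ζ ρX ρY) := by
    rw [StarAlgHom.map_adjoin, Set.image_union, ← Set.range_comp, ← Set.range_comp]
    rfl
  rw [hmap] at hb'
  change b ∈ closure ((StarAlgebra.adjoin ℂ (Set.range (j₁ ζ ρX ρY) ∪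
    Set.range (j₂ ζ ρX ρY)) : StarSubalgebra ℂ (BraidedTensor ζ ρX ρY)) :
      Set (BraidedTensor ζ ρX ρY))
  rw [hind.closure_eq_preimage_closure_image]
  exact hb'

/-- `X ⊠_ζ Y = j₁(X) j₂(Y)`: the linear span of the products `j₁(x) j₂(y)` is dense. -/
theorem span_eq_top : (Submodule.span ℂ {b : BraidedTensor ζ ρX ρY | ∃ (x : X) (y : Y),
    b = j₁ ζ ρX ρY x * j₂ ζ ρX ρY y}).topologicalClosure = ⊤ := by
  have h : (homSubalgebra ζ ρX ρY).topologicalClosure = ⊤ := by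
    rw [eq_top_iff, ← adjoin_eq_top ζ ρX ρY]
    refine StarSubalgebra.topologicalClosure_minimal (StarAlgebra.adjoin_le ?_)
      (StarSubalgebra.isClosed_topologicalClosure _)
    rintro _ (⟨x, rfl⟩ | ⟨y, rfl⟩)
    · refine apply_mem_of_homogeneous ρX _ _ (fun k x hx => ?_) x
      exact Submodule.subset_span ⟨k, 0, x, 1, hx, ρY.isHomogeneous_one, by rw [map_one, mul_one]⟩
    · refine apply_mem_of_homogeneous ρY _ _ (fun k y hy => ?_) y
      exact Submodule.subset_span ⟨0, k, 1, y, ρX.isHomogeneous_one, hy, by rw [map_one, one_mul]⟩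
  rw [eq_top_iff]
  intro b _
  have hb : b ∈ (homSubalgebra ζ ρX ρY).topologicalClosure := by rw [h]; trivial
  refine closure_mono (fun c hc => ?_) hb
  refine Submodule.span_mono ?_ hc
  rintro _ ⟨_, _, x, y, _, _, rfl⟩
  exact ⟨x, y, rfl⟩

end BraidedTensor

end BraidedSpan

/-! ### The braided free unitary quantum group -/

section FreeUnitary

variable {n : ℕ}

/-- The admissibility of `F = (F i j)` with inverse `F⁻¹ = (F^{ij})`, witnessed by integers `d i`,
`d' i` and `δ`: `F i j = 0 = F^{ji}` whenever `-d j + δ ≠ d' i`. -/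
def Admissible (F : GL (Fin n) ℂ) (d d' : Fin n → ℤ) (δ : ℤ) : Prop :=
  ∀ i j, -d j + δ ≠ d' i →
    (F : Matrix (Fin n) (Fin n) ℂ) i j = 0 ∧ ((F⁻¹ : GL (Fin n) ℂ) : Matrix (Fin n) (Fin n) ℂ) j i = 0

section Star

variable {D E : Type*} [Ring D] [StarRing D] [Algebra ℂ D] [Ring E] [StarRing E] [Algebra ℂ E]

/-- The conjugate `ū_ζ = (ζ ^ (d i * (d j - d i)) • (u i j)*)` of a matrix `u`. -/
def conjMatrix (ζ : Circle) (d : Fin n → ℤ) (u : Matrix (Fin n) (Fin n) D) :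
    Matrix (Fin n) (Fin n) D :=
  Matrix.of fun i j => ((ζ ^ (d i * (d j - d i)) : Circle) : ℂ) • star (u i j)

/-- The matrix `F ū_ζ F⁻¹`. -/
def twistedConj (ζ : Circle) (F : GL (Fin n) ℂ) (d : Fin n → ℤ) (u : Matrix (Fin n) (Fin n) D) :
    Matrix (Fin n) (Fin n) D :=
  (F : Matrix (Fin n) (Fin n) ℂ).map (algebraMap ℂ D) * conjMatrix ζ d u *
    ((F⁻¹ : GL (Fin n) ℂ) : Matrix (Fin n) (Fin n) ℂ).map (algebraMap ℂ D)

/-- Both `u` and `F ū_ζ F⁻¹` are unitary matrices. -/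
def IsUnitaryPair (ζ : Circle) (F : GL (Fin n) ℂ) (d : Fin n → ℤ) (u : Matrix (Fin n) (Fin n) D) :
    Prop :=
  u ∈ unitary (Matrix (Fin n) (Fin n) D) ∧ twistedConj ζ F d u ∈ unitary (Matrix (Fin n) (Fin n) D)

theorem twistedConj_apply (ζ : Circle) (F : GL (Fin n) ℂ) (d : Fin n → ℤ)
    (u : Matrix (Fin n) (Fin n) D) (i j : Fin n) : twistedConj ζ F d u i j =
      ∑ β, ∑ α, ((F : Matrix (Fin n) (Fin n) ℂ) i α *
        ((F⁻¹ : GL (Fin n) ℂ) : Matrix (Fin n) (Fin n) ℂ) β j) • conjMatrix ζ d u α β := by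
  simp only [twistedConj, Matrix.mul_apply, Matrix.map_apply, Finset.sum_mul]
  refine Finset.sum_congr rfl fun β _ => Finset.sum_congr rfl fun α _ => ?_
  rw [← Algebra.commutes, ← mul_assoc, ← map_mul, ← Algebra.smul_def, mul_comm]

theorem conjMatrix_map (ζ : Circle) (d : Fin n → ℤ) (φ : D →⋆ₐ[ℂ] E)
    (u : Matrix (Fin n) (Fin n) D) : conjMatrix ζ d (u.map φ) = (conjMatrix ζ d u).map φ := by
  ext i j
  simp [conjMatrix, map_star]

theorem twistedConj_map (ζ : Circle) (F : GL (Fin n) ℂ) (d : Fin n → ℤ) (φ : D →⋆ₐ[ℂ] E)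
    (u : Matrix (Fin n) (Fin n) D) : twistedConj ζ F d (u.map φ) = (twistedConj ζ F d u).map φ := by
  ext i j
  rw [twistedConj_apply, Matrix.map_apply, twistedConj_apply, conjMatrix_map]
  simp

theorem map_mem_unitary (φ : D →⋆ₐ[ℂ] E) {u : Matrix (Fin n) (Fin n) D}
    (h : u ∈ unitary (Matrix (Fin n) (Fin n) D)) :
    u.map φ ∈ unitary (Matrix (Fin n) (Fin n) E) := by
  have hs : star (u.map φ) = (star u).map φ := by
    ext i j
    exact (map_star φ _).symm
  have hm : ∀ a b : Matrix (Fin n) (Fin n) D, a.map φ * b.map φ = (a * b).map φ := fun a b =>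
    (Matrix.map_mul (f := (φ : D →+* E))).symm
  have h1 : (1 : Matrix (Fin n) (Fin n) D).map φ = 1 :=
    Matrix.map_one _ (map_zero φ) (map_one φ)
  rw [Unitary.mem_iff] at h ⊢
  rw [hs, hm, hm, h.1, h.2]
  exact ⟨h1, h1⟩

theorem IsUnitaryPair.map {ζ : Circle} {F : GL (Fin n) ℂ} {d : Fin n → ℤ} (φ : D →⋆ₐ[ℂ] E)
    {u : Matrix (Fin n) (Fin n) D} (h : IsUnitaryPair ζ F d u) :
    IsUnitaryPair ζ F d (u.map φ) :=
  ⟨map_mem_unitary φ h.1, by rw [twistedConj_map]; exact map_mem_unitary φ h.2⟩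

end Star

/-- The relations of `C(U_ζ⁺(F))`, in generators `u = (u i j)`: the entries of `u* u - 1`,
`u u* - 1`, `u'* u' - 1`, and `u' u'* - 1`, where `u' = F ū_ζ F⁻¹`. -/
def unitaryRels (ζ : Circle) (F : GL (Fin n) ℂ) (d : Fin n → ℤ) :
    Set (FreeStar (Fin n × Fin n)) :=
  let u : Matrix (Fin n) (Fin n) (FreeStar (Fin n × Fin n)) :=
    Matrix.of fun i j => FreeStar.gen (i, j)
  let u' := twistedConj ζ F d u
  {r | ∃ i j, r = (star u * u - 1) i j ∨ r = (u * star u - 1) i j ∨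
    r = (star u' * u' - 1) i j ∨ r = (u' * star u' - 1) i j}

theorem isUnitaryPair_iff {D : Type*} [Ring D] [StarRing D] [Algebra ℂ D]
    (ζ : Circle) (F : GL (Fin n) ℂ) (d : Fin n → ℤ)
    (φ : FreeStar (Fin n × Fin n) →⋆ₐ[ℂ] D) :
    (∀ r ∈ unitaryRels ζ F d, φ r = 0) ↔
      IsUnitaryPair ζ F d (Matrix.of fun i j => φ (FreeStar.gen (i, j))) := by
  set u : Matrix (Fin n) (Fin n) (FreeStar (Fin n × Fin n)) :=
    Matrix.of fun i j => FreeStar.gen (i, j) with hu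
  have e : (Matrix.of fun i j => φ (FreeStar.gen (i, j)) : Matrix (Fin n) (Fin n) D) = u.map φ := rfl
  have hs : ∀ v : Matrix (Fin n) (Fin n) (FreeStar (Fin n × Fin n)),
      star (v.map φ) = (star v).map φ := fun v => by
    ext i j
    exact (map_star φ _).symm
  have hm : ∀ a b : Matrix (Fin n) (Fin n) (FreeStar (Fin n × Fin n)),
      a.map φ * b.map φ = (a * b).map φ := fun a b =>
    (Matrix.map_mul (f := (φ : FreeStar (Fin n × Fin n) →+* D))).symm
  have h1 : (1 : Matrix (Fin n) (Fin n) (FreeStar (Fin n × Fin n))).map φ = 1 :=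
    Matrix.map_one _ (map_zero φ) (map_one φ)
  have h0 : ∀ a : Matrix (Fin n) (Fin n) (FreeStar (Fin n × Fin n)),
      a.map φ = 1 ↔ ∀ i j, φ ((a - 1) i j) = 0 := fun a => by
    rw [← h1, ← Matrix.ext_iff]
    simp only [Matrix.map_apply, Matrix.sub_apply, map_sub, sub_eq_zero]
  rw [e, IsUnitaryPair, twistedConj_map, Unitary.mem_iff, Unitary.mem_iff, hs, hs, hm, hm, hm, hm,
    h0, h0, h0, h0]
  constructor
  · intro h
    exact ⟨⟨fun i j => h _ ⟨i, j, Or.inl rfl⟩, fun i j => h _ ⟨i, j, Or.inr (Or.inl rfl)⟩⟩,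
      fun i j => h _ ⟨i, j, Or.inr (Or.inr (Or.inl rfl))⟩,
      fun i j => h _ ⟨i, j, Or.inr (Or.inr (Or.inr rfl))⟩⟩
  · rintro ⟨⟨a, b⟩, c, e⟩ r ⟨i, j, rfl | rfl | rfl | rfl⟩
    exacts [a i j, b i j, c i j, e i j]

/-- The entries of a unitary matrix over a C*-algebra have norm at most one. -/
theorem norm_entry_le_one {D : Type*} [CStarAlgebra D] {u : Matrix (Fin n) (Fin n) D}
    (h : u ∈ unitary (Matrix (Fin n) (Fin n) D)) (i j : Fin n) : ‖u i j‖ ≤ 1 := by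
  let _ := CStarAlgebra.spectralOrder D
  have := CStarAlgebra.spectralOrderedRing D
  have h1 : ∑ k, star (u k j) * u k j = 1 := by
    have := congrFun (congrFun (Unitary.mem_iff.mp h).1 j) j
    rwa [Matrix.mul_apply, Matrix.one_apply_eq] at this
  have h2 : star (u i j) * u i j ≤ 1 := by
    rw [← h1]
    exact Finset.single_le_sum (f := fun k => star (u k j) * u k j)
      (fun k _ => star_mul_self_nonneg (u k j)) (Finset.mem_univ i)
  have h3 : ‖star (u i j) * u i j‖ ≤ 1 :=
    (CStarAlgebra.norm_le_one_iff_of_nonneg _ (star_mul_self_nonneg (u i j))).mpr h2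
  rw [CStarRing.norm_star_mul_self] at h3
  nlinarith [norm_nonneg (u i j)]

theorem unitaryRels_bounding (ζ : Circle) (F : GL (Fin n) ℂ) (d : Fin n → ℤ) :
    FreeStar.Bounding (unitaryRels ζ F d) := by
  rintro ⟨i, j⟩
  refine ⟨1, fun p hp => ?_⟩
  have h := (isUnitaryPair_iff ζ F d p.ofStar).mp fun r hr => by
    have : ‖p.ofStar r‖ = p r := p.norm_of r
    rw [hp r hr] at this
    exact norm_eq_zero.mp this
  have := norm_entry_le_one h.1 i j
  exact (p.norm_of _).symm.trans_le this

variable (ζ : Circle) (F : GL (Fin n) ℂ) (d : Fin n → ℤ)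

/-- `C(U_ζ⁺(F))`: the universal unital C*-algebra generated by the entries of a matrix `u` such that
`u` and `F ū_ζ F⁻¹` are unitary. -/
def AlgU : Type := UnivCStar (unitaryRels ζ F d) (unitaryRels_bounding ζ F d)

instance : CStarAlgebra (AlgU ζ F d) :=
  inferInstanceAs (CStarAlgebra (UnivCStar (unitaryRels ζ F d) (unitaryRels_bounding ζ F d)))

namespace AlgU

/-- The quotient map from the free *-algebra. -/
def of : FreeStar (Fin n × Fin n) →⋆ₐ[ℂ] AlgU ζ F d := UnivCStar.of (unitaryRels_bounding ζ F d)

theorem denseRange_of : DenseRange (of ζ F d) := CStarSeminorm.denseRange_of _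

/-- The matrix `u` of generators. -/
def u : Matrix (Fin n) (Fin n) (AlgU ζ F d) :=
  Matrix.of fun i j => of ζ F d (FreeStar.gen (i, j))

theorem isUnitaryPair_u : IsUnitaryPair ζ F d (u ζ F d) :=
  (isUnitaryPair_iff ζ F d (of ζ F d)).mp fun _ hr =>
    UnivCStar.of_rel _ hr

variable {ζ F d}

/-- The universal property of `C(U_ζ⁺(F))`. -/
def lift {D : Type*} [CStarAlgebra D] (v : Matrix (Fin n) (Fin n) D) (hv : IsUnitaryPair ζ F d v) :
    AlgU ζ F d →⋆ₐ[ℂ] D :=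
  UnivCStar.lift (unitaryRels_bounding ζ F d) (fun p => v p.1 p.2)
    ((isUnitaryPair_iff ζ F d _).mpr (by simp only [FreeStar.lift_gen]; exact hv))

theorem lift_u {D : Type*} [CStarAlgebra D] (v : Matrix (Fin n) (Fin n) D)
    (hv : IsUnitaryPair ζ F d v) (i j : Fin n) : lift v hv (u ζ F d i j) = v i j :=
  UnivCStar.lift_gen _ _ _ (i, j)

theorem hom_ext {D : Type*} [CStarAlgebra D] {φ ψ : AlgU ζ F d →⋆ₐ[ℂ] D}
    (h : ∀ i j, φ (u ζ F d i j) = ψ (u ζ F d i j)) : φ = ψ :=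
  UnivCStar.hom_ext _ fun p => h p.1 p.2

end AlgU

end FreeUnitary

section Coaction

variable {n : ℕ} {ζ : Circle} {F : GL (Fin n) ℂ} {d d' : Fin n → ℤ} {δ : ℤ}

/-- Diagonal unitary matrices. -/
theorem diagonal_mem_unitary {D : Type*} [CStarAlgebra D] (g : Fin n → unitary D) :
    Matrix.diagonal (fun i => (g i : D)) ∈ unitary (Matrix (Fin n) (Fin n) D) := by
  rw [Unitary.mem_iff, Matrix.star_eq_conjTranspose, Matrix.diagonal_conjTranspose,
    Matrix.diagonal_mul_diagonal, Matrix.diagonal_mul_diagonal, ← Matrix.diagonal_one]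
  constructor
  · congr 1
    funext i
    exact Unitary.star_mul_self_of_mem (g i).2
  · congr 1
    funext i
    exact Unitary.mul_star_self_of_mem (g i).2

/-- If `c` is a unitary that commutes with the entries of `u`, then `(u i j * c ^ (d j - d i))`
satisfies the same relations as `u`. -/
theorem IsUnitaryPair.mul_zpow (hF : Admissible F d d' δ) {D : Type*} [CStarAlgebra D]
    {u : Matrix (Fin n) (Fin n) D} (hu : IsUnitaryPair ζ F d u) (c : unitary D)
    (hc : ∀ i j, Commute (c : D) (u i j)) : IsUnitaryPair ζ F d
      (Matrix.of fun i j => u i j * ((c ^ (d j - d i) : unitary D) : D)) := by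
  have hcz : ∀ (k : ℤ) i j, Commute ((c ^ k : unitary D) : D) (u i j) := fun k i j => by
    have h1 : Commute (star (c : D)) (u i j) := by
      have := hc i j
      rw [commute_iff_eq] at this ⊢
      calc star (c : D) * u i j = star (c : D) * (u i j * (c * star (c : D))) := by
            rw [Unitary.mul_star_self_of_mem c.2, mul_one]
        _ = star (c : D) * (c * u i j) * star (c : D) := by rw [this]; simp only [mul_assoc]
        _ = u i j * star (c : D) := by
            rw [← mul_assoc, Unitary.star_mul_self_of_mem c.2, one_mul]
    obtain ⟨m, rfl | rfl⟩ := Int.eq_nat_or_neg k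
    · rw [zpow_natCast]
      exact (hc i j).pow_left m
    · rw [zpow_neg, zpow_natCast, ← inv_pow, ← Unitary.star_eq_inv]
      exact h1.pow_left m
  have hczs : ∀ (k : ℤ) i j, Commute ((c ^ k : unitary D) : D) (star (u i j)) := fun k i j => by
    have := (hcz (-k) i j).star_star
    rwa [star_coe_zpow, neg_neg] at this
  -- conjugation of a matrix by a diagonal matrix of powers of `c`
  have key : ∀ (v : Matrix (Fin n) (Fin n) D) (e : Fin n → ℤ),
      (∀ (k : ℤ) i j, Commute ((c ^ k : unitary D) : D) (v i j)) →
      v ∈ unitary (Matrix (Fin n) (Fin n) D) →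
      (Matrix.of fun i j => v i j * ((c ^ (e j - e i) : unitary D) : D)) ∈
        unitary (Matrix (Fin n) (Fin n) D) := by
    intro v e hv hvu
    have h1 := mul_mem (mul_mem (diagonal_mem_unitary fun i => c ^ (-e i)) hvu)
      (diagonal_mem_unitary fun i => c ^ (e i))
    convert h1 using 1
    ext i j
    rw [Matrix.mul_diagonal, Matrix.diagonal_mul, Matrix.of_apply, (hv _ i j).eq, mul_assoc,
      coe_zpow_mul, neg_add_eq_sub]
  refine ⟨key u d hcz hu.1, ?_⟩
  have ht : twistedConj ζ F d (Matrix.of fun i j => u i j * ((c ^ (d j - d i) : unitary D) : D)) =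
      Matrix.of fun i j => twistedConj ζ F d u i j * ((c ^ (d' j - d' i) : unitary D) : D) := by
    ext i j
    rw [Matrix.of_apply, twistedConj_apply, twistedConj_apply, Finset.sum_mul]
    refine Finset.sum_congr rfl fun β _ => ?_
    rw [Finset.sum_mul]
    refine Finset.sum_congr rfl fun α _ => ?_
    by_cases h1 : -d α + δ = d' i
    · by_cases h2 : -d β + δ = d' j
      · have : d' j - d' i = -(d β - d α) := by omega
        rw [this, ← star_coe_zpow, conjMatrix, conjMatrix, Matrix.of_apply, Matrix.of_apply,
          Matrix.of_apply, star_mul, smul_mul_assoc, smul_mul_assoc, star_coe_zpow,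
          (hczs _ α β).eq]
      · rw [(hF j β h2).2, mul_zero, zero_smul, zero_smul, zero_mul]
    · rw [(hF i α h1).1, zero_mul, zero_smul, zero_smul, zero_mul]
  rw [ht]
  refine key _ d' (fun k i j => ?_) hu.2
  rw [twistedConj_apply]
  refine Commute.sum_right _ _ _ fun β _ => Commute.sum_right _ _ _ fun α _ => ?_
  exact ((hczs k α β).smul_right _).smul_right _

namespace AlgU

/-- The coaction of `C(𝕋)` on `C(U_ζ⁺(F))` as a *-homomorphism,
`u i j ↦ u i j ⊗ z ^ (d j - d i)`. -/
def rho (ζ : Circle) (hF : Admissible F d d' δ) : AlgU ζ F d →⋆ₐ[ℂ] AlgU ζ F d ⊗min CT :=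
  AlgU.lift (Matrix.of fun i j => (u ζ F d).map MinTensor.inl i j *
      ((tmulU 1 coordZ ^ (d j - d i) : unitary (AlgU ζ F d ⊗min CT)) : AlgU ζ F d ⊗min CT))
    (((isUnitaryPair_u ζ F d).map MinTensor.inl).mul_zpow hF (tmulU 1 coordZ) fun i j => by
      change MinTensor.tmul _ _ * MinTensor.tmul _ _ = MinTensor.tmul _ _ * MinTensor.tmul _ _
      rw [MinTensor.tmul_mul_tmul, MinTensor.tmul_mul_tmul]
      simp)

theorem rho_u (ζ : Circle) (hF : Admissible F d d' δ) (i j : Fin n) : rho ζ hF (u ζ F d i j) =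
    MinTensor.tmul (u ζ F d i j) ((coordZ ^ (d j - d i) : unitary CT) : CT) := by
  rw [rho, lift_u, Matrix.of_apply, tmulU_zpow]
  change MinTensor.tmul _ _ * MinTensor.tmul _ _ = _
  rw [MinTensor.tmul_mul_tmul]
  simp

/-- `C(U_ζ⁺(F))` as a `𝕋`-C*-algebra; `u i j` is homogeneous of degree `d j - d i`. -/
def coaction (ζ : Circle) (hF : Admissible F d d' δ) : CircleCoaction (AlgU ζ F d) where
  coact := rho ζ hF
  dense_homogeneous := by
    set S := Submodule.span ℂ {x : AlgU ζ F d | ∃ k : ℤ,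
      rho ζ hF x = MinTensor.tmul x ((coordZ ^ k : unitary CT) : CT)} with hS
    have h1 : ∀ a : FreeStar (Fin n × Fin n),
        of ζ F d a ∈ S := by
      intro a
      refine FreeStar.induction (P := fun a => of ζ F d a ∈ S)
        (fun c => ?_) (fun y => ?_) (fun a b ha hb => ?_) (fun a b ha hb => ?_) a
      · rw [AlgHomClass.commutes, Algebra.algebraMap_eq_smul_one]
        refine Submodule.smul_mem _ _ (Submodule.subset_span ⟨0, ?_⟩)
        rw [zpow_zero]
        exact (map_one (rho ζ hF)).trans MinTensor.tmul_one_one.symm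
      · rcases y with ⟨i, j⟩ | ⟨i, j⟩
        · exact Submodule.subset_span ⟨d j - d i, rho_u ζ hF i j⟩
        · rw [FreeStar.letter_inr, map_star]
          refine Submodule.subset_span ⟨-(d j - d i), ?_⟩
          change rho ζ hF (star (u ζ F d i j)) = _
          rw [map_star, rho_u, MinTensor.star_tmul, star_coe_zpow]
          rfl
      · rw [map_mul]
        have h := Submodule.mul_mem_mul ha hb
        rw [hS, Submodule.span_mul_span] at h
        refine Submodule.span_mono ?_ h
        rintro _ ⟨x, ⟨k, hx⟩, y, ⟨l, hy⟩, rfl⟩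
        refine ⟨k + l, ?_⟩
        change rho ζ hF (x * y) = MinTensor.tmul (x * y) _
        rw [map_mul, hx, hy, MinTensor.tmul_mul_tmul, coe_zpow_mul]
      · rw [map_add]; exact add_mem ha hb
    have h2 : DenseRange (of ζ F d) :=
      denseRange_of ζ F d
    rw [eq_top_iff]
    intro x _
    refine closure_mono ?_ (h2 x)
    rintro _ ⟨a, rfl⟩
    exact h1 a

theorem isHomogeneous_u (ζ : Circle) (hF : Admissible F d d' δ) (i j : Fin n) :
    (coaction ζ hF).IsHomogeneous (d j - d i) (u ζ F d i j) := rho_u ζ hF i j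

/-- `C(U_ζ⁺(F)) ⊠_ζ C(U_ζ⁺(F))`. -/
abbrev Braid₂ (ζ : Circle) (hF : Admissible F d d' δ) : Type :=
  BraidedTensor ζ (coaction ζ hF) (coaction ζ hF)

theorem isUnitaryPair_comul (ζ : Circle) (hF : Admissible F d d' δ) : IsUnitaryPair ζ F d
    ((u ζ F d).map (BraidedTensor.j₁ ζ (coaction ζ hF) (coaction ζ hF)) *
      (u ζ F d).map (BraidedTensor.j₂ ζ (coaction ζ hF) (coaction ζ hF))) := by
  set J₁ := BraidedTensor.j₁ ζ (coaction ζ hF) (coaction ζ hF)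
  set J₂ := BraidedTensor.j₂ ζ (coaction ζ hF) (coaction ζ hF)
  have hu := isUnitaryPair_u ζ F d
  have hc : conjMatrix ζ d ((u ζ F d).map J₁ * (u ζ F d).map J₂) =
      conjMatrix ζ d ((u ζ F d).map J₁) * conjMatrix ζ d ((u ζ F d).map J₂) := by
    ext i j
    simp only [conjMatrix, Matrix.mul_apply, Matrix.of_apply, Matrix.map_apply, star_sum, star_mul,
      Finset.smul_sum]
    refine Finset.sum_congr rfl fun k _ => ?_
    have h := BraidedTensor.j₂_mul_j₁ ζ (isHomogeneous_u ζ hF i k).star (isHomogeneous_u ζ hF k j).star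
    rw [map_star, map_star] at h
    rw [h, smul_smul, smul_mul_smul_comm, ← Circle.coe_mul, ← Circle.coe_mul, ← zpow_add,
      ← zpow_add]
    congr 3
    ring
  refine ⟨mul_mem (map_mem_unitary J₁ hu.1) (map_mem_unitary J₂ hu.1), ?_⟩
  have hFF : ((F⁻¹ : GL (Fin n) ℂ) : Matrix (Fin n) (Fin n) ℂ).map (algebraMap ℂ (Braid₂ ζ hF)) *
      (F : Matrix (Fin n) (Fin n) ℂ).map (algebraMap ℂ (Braid₂ ζ hF)) = 1 := by
    rw [← Matrix.map_mul, ← Units.val_mul, inv_mul_cancel, Units.val_one]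
    exact Matrix.map_one _ (map_zero _) (map_one _)
  have ht : twistedConj ζ F d ((u ζ F d).map J₁ * (u ζ F d).map J₂) =
      twistedConj ζ F d ((u ζ F d).map J₁) * twistedConj ζ F d ((u ζ F d).map J₂) := by
    rw [twistedConj, hc, twistedConj, twistedConj]
    set f := (F : Matrix (Fin n) (Fin n) ℂ).map (algebraMap ℂ (Braid₂ ζ hF))
    set g := ((F⁻¹ : GL (Fin n) ℂ) : Matrix (Fin n) (Fin n) ℂ).map
      (algebraMap ℂ (Braid₂ ζ hF))
    calc f * (conjMatrix ζ d ((u ζ F d).map J₁) * conjMatrix ζ d ((u ζ F d).map J₂)) * g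
        = f * conjMatrix ζ d ((u ζ F d).map J₁) * 1 * (conjMatrix ζ d ((u ζ F d).map J₂) * g) := by
          simp only [mul_assoc, one_mul]
      _ = _ := by rw [← hFF]; simp only [mul_assoc]
  rw [ht]
  exact mul_mem (hu.map J₁).2 (hu.map J₂).2

/-- The comultiplication of `U_ζ⁺(F)`, `Δ (u i j) = ∑ k, j₁ (u i k) * j₂ (u k j)`. -/
def comul (ζ : Circle) (hF : Admissible F d d' δ) : AlgU ζ F d →⋆ₐ[ℂ] Braid₂ ζ hF :=
  AlgU.lift _ (isUnitaryPair_comul ζ hF)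

theorem comul_u (ζ : Circle) (hF : Admissible F d d' δ) (i j : Fin n) : comul ζ hF (u ζ F d i j) =
    ∑ k, BraidedTensor.j₁ ζ (coaction ζ hF) (coaction ζ hF) (u ζ F d i k) *
      BraidedTensor.j₂ ζ (coaction ζ hF) (coaction ζ hF) (u ζ F d k j) := by
  rw [comul, lift_u, Matrix.mul_apply]
  rfl

end AlgU

end Coaction

/-! ### Bosonization and crossed products -/

section Bosonization

variable (ζ : Circle)

/-- `ρ` is the coaction on `X ⊠_ζ Y` for which `j₁` and `j₂` are `𝕋`-equivariant. -/
def IsBraidedCoaction {X Y : Type} [CStarAlgebra X] [CStarAlgebra Y] (ρX : CircleCoaction X)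
    (ρY : CircleCoaction Y) (ρ : CircleCoaction (BraidedTensor ζ ρX ρY)) : Prop :=
  ρX.IsEquivariant ρ (BraidedTensor.j₁ ζ ρX ρY) ∧ ρY.IsEquivariant ρ (BraidedTensor.j₂ ζ ρX ρY)

/-- `Φ = f ⊠_ζ g`, that is, `Φ (j₁ x * j₂ y) = j₁ (f x) * j₂ (g y)`. -/
def IsBraidedMap {X Y X' Y' : Type} [CStarAlgebra X] [CStarAlgebra Y] [CStarAlgebra X']
    [CStarAlgebra Y'] (ρX : CircleCoaction X) (ρY : CircleCoaction Y) (ρX' : CircleCoaction X')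
    (ρY' : CircleCoaction Y') (f : X →⋆ₐ[ℂ] X') (g : Y →⋆ₐ[ℂ] Y')
    (Φ : BraidedTensor ζ ρX ρY →⋆ₐ[ℂ] BraidedTensor ζ ρX' ρY') : Prop :=
  ∀ x y, Φ (BraidedTensor.j₁ ζ ρX ρY x * BraidedTensor.j₂ ζ ρX ρY y) =
    BraidedTensor.j₁ ζ ρX' ρY' (f x) * BraidedTensor.j₂ ζ ρX' ρY' (g y)

/-- `ψ : C(𝕋) ⊠ X ⊠ Y → (C(𝕋) ⊠ X) ⊗ (C(𝕋) ⊠ Y)` is the morphism with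
`ψ (j₁ f) = (j₁ ⊗ j₁) (Δ_𝕋 f)`, `ψ (j₂ a) = (j₂ ⊗ j₁) (ρ a)` and `ψ (j₃ b) = 1 ⊗ j₂ b`.
Here `C(𝕋) ⊠ X ⊠ Y` is `C(𝕋) ⊠ (X ⊠ Y)`, with the second and third embedding `j₂ ∘ j₁` and
`j₂ ∘ j₂`. -/
def IsPsi {X Y : Type} [CStarAlgebra X] [CStarAlgebra Y] (ρX : CircleCoaction X)
    (ρY : CircleCoaction Y) (ρXY : CircleCoaction (BraidedTensor ζ ρX ρY))
    (ψ : BraidedTensor ζ coactionT ρXY →⋆ₐ[ℂ]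
      BraidedTensor ζ coactionT ρX ⊗min BraidedTensor ζ coactionT ρY) : Prop :=
  (∀ f : CT, ψ (BraidedTensor.j₁ ζ coactionT ρXY f) =
    MinTensor.map (BraidedTensor.j₁ ζ coactionT ρX) (BraidedTensor.j₁ ζ coactionT ρY)
      (deltaT f)) ∧
  (∀ a : X, ψ (BraidedTensor.j₂ ζ coactionT ρXY (BraidedTensor.j₁ ζ ρX ρY a)) =
    MinTensor.map (BraidedTensor.j₂ ζ coactionT ρX) (BraidedTensor.j₁ ζ coactionT ρY)
      (ρX.coact a)) ∧
  (∀ b : Y, ψ (BraidedTensor.j₂ ζ coactionT ρXY (BraidedTensor.j₂ ζ ρX ρY b)) =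
    MinTensor.tmul 1 (BraidedTensor.j₂ ζ coactionT ρY b))

/-- `Δ` is the comultiplication `ψ ∘ (id ⊠ Δ_A)` of the bosonization of `(A, ρ, Δ_A)`. The coaction on
`A ⊠ A`, the morphism `id ⊠ Δ_A` and `ψ` are determined by their defining properties; that they
exist is part of the assertion. -/
def IsBosonizationComul {A : Type} [CStarAlgebra A] (ρ : CircleCoaction A)
    (ΔA : A →⋆ₐ[ℂ] BraidedTensor ζ ρ ρ)
    (Δ : BraidedTensor ζ coactionT ρ →⋆ₐ[ℂ]
      BraidedTensor ζ coactionT ρ ⊗min BraidedTensor ζ coactionT ρ) : Prop :=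
  ∃ ρAA : CircleCoaction (BraidedTensor ζ ρ ρ), IsBraidedCoaction ζ ρ ρ ρAA ∧
    ∃ Φ : BraidedTensor ζ coactionT ρ →⋆ₐ[ℂ] BraidedTensor ζ coactionT ρAA,
      IsBraidedMap ζ coactionT ρ coactionT ρAA (StarAlgHom.id ℂ CT) ΔA Φ ∧
    ∃ ψ : BraidedTensor ζ coactionT ρAA →⋆ₐ[ℂ]
        BraidedTensor ζ coactionT ρ ⊗min BraidedTensor ζ coactionT ρ,
      IsPsi ζ ρ ρ ρAA ψ ∧ Δ = ψ.comp Φ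

/-- `B`, together with `ι : A → B` and the unitary `w`, is the crossed product `A ⋊_α ℤ` of `A` by the
automorphism `α`: the universal C*-algebra generated by a copy of `A` and a unitary `w` such that
`w a w* = α a`. -/
structure IsCrossedProduct.{v} {A B : Type} [CStarAlgebra A] [CStarAlgebra B] (α : A ≃⋆ₐ[ℂ] A)
    (ι : A →⋆ₐ[ℂ] B) (w : unitary B) : Prop where
  covariant : ∀ a, (w : B) * ι a * star (w : B) = ι (α a)
  generates : (StarAlgebra.adjoin ℂ (Set.range ι ∪ {(w : B)})).topologicalClosure = ⊤
  universal : ∀ (D : Type v) [CStarAlgebra D] (π : A →⋆ₐ[ℂ] D) (v : unitary D),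
    (∀ a, (v : D) * π a * star (v : D) = π (α a)) →
      ∃! φ : B →⋆ₐ[ℂ] D, (∀ a, φ (ι a) = π a) ∧ φ w = v

variable {n : ℕ} {F : GL (Fin n) ℂ} {d d' : Fin n → ℤ} {δ : ℤ}

/-- The relations on `z` and `u = (u i j)`: `z` is unitary, `z u i j = ζ ^ (d i - d j) u i j z`, and
`u` and `F ū_ζ F⁻¹` are unitary. -/
def BosonizationRels {D : Type*} [CStarAlgebra D] (F : GL (Fin n) ℂ) (d : Fin n → ℤ) (z : D)
    (u : Matrix (Fin n) (Fin n) D) : Prop :=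
  z ∈ unitary D ∧ (∀ i j, z * u i j = ((ζ ^ (d i - d j) : Circle) : ℂ) • (u i j * z)) ∧
    IsUnitaryPair ζ F d u

/-- The C*-algebra `C(U_ζ⁺(F) ⋊ 𝕋) = C(𝕋) ⊠_ζ C(U_ζ⁺(F))` of the bosonization. -/
abbrev Bosonization (hF : Admissible F d d' δ) : Type :=
  BraidedTensor ζ coactionT (AlgU.coaction ζ hF)

namespace Bosonization

variable (hF : Admissible F d d' δ)

/-- The unitary `z = j₁(z)`. -/
def z : unitary (Bosonization ζ hF) :=
  mapU (BraidedTensor.j₁ ζ coactionT (AlgU.coaction ζ hF)) coordZ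

/-- The embedding `j₂` of `C(U_ζ⁺(F))`. -/
def ι : AlgU ζ F d →⋆ₐ[ℂ] Bosonization ζ hF := BraidedTensor.j₂ ζ coactionT (AlgU.coaction ζ hF)

/-- The matrix `u = (j₂(u i j))`. -/
def u : Matrix (Fin n) (Fin n) (Bosonization ζ hF) := (AlgU.u ζ F d).map (ι ζ hF)

end Bosonization

end Bosonization

end BraidedUnitary

end

open BraidedUnitary

universe v

noncomputable section

namespace BraidedUnitary

/-! ### Faithful representations -/

/-! The heart of the matter is that covariant data define *-homomorphisms on the spatially defined
algebra `X ⊠_ζ Y`. Let `v` be a unitary of `M` and let `φ : Y → M` satisfy `φ(y) v = ζ^l v φ(y)` for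
`y` of degree `l`. The elements `x ⊗ v^k` (`x` of degree `k`) and `1 ⊗ φ(y)` of `X ⊗ M` then obey
the same commutation relations as `j₁(x)` and `j₂(y)`. Since `X ⊠_ζ Y` is a subalgebra of `X ⊗ Y ⊗
C(𝕋²_ζ)` and not a universal object, what needs proof is a norm inequality between *-polynomials in
these two families.

The inequality comes from the amenability of `ℤ`. Let `U` act on `ℓ²(ℤ)` as the shift and `V` by `V
e_n = ζ^n e_n`. For representations `π` of `X` on `H` and `σ` of `M` on `K`, put `Z = 1 ⊗ σ(v)` on
`H ⊗ K` and `Ω_N q = (N+1)^(-1/2) ∑_{0≤n≤N} Z^(-n) q ⊗ e_n`. These isometries carry `1 ⊗ σ(φ(y))`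
exactly to `1 ⊗ σ(φ(y)) ⊗ V^l`, because the phases of `V^l` cancel those from moving `σ(φ(y))` past
`Z^(-n)`. They carry `π(x) ⊗ σ(v)^k` to `π(x) ⊗ 1 ⊗ U^k` up to boundary terms of order `N^(-1/2)`.
Letting `N → ∞` bounds every polynomial (`norm_le_of_tendsto_intertwine`, `norm_tensorRep_lift_le`),
and `BraidedTensor.exists_hom_of_covariant` follows.

For `X = C(𝕋)` the coordinate goes to `z ⊗ v`, and evaluating the first leg at `1` leaves a map into
`M`. With `Y = A` this is the universal property of `B`. The crossed product has the same universal
property, since `w a w* = α(a)` on the generators of `A` is the commutation relation of `z` and `u`.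

For the comultiplication, `A ⊠ A` needs a coaction. The scalings of its generators are restrictions
of `U ↦ sU`, `V ↦ sV`; a second averaging argument, over roots of unity, assembles them into a map
to `(A ⊠ A) ⊗ C(𝕋)` (`CircleCoaction.exists_of_scale`). The map `id ⊠ Δ_A` then comes from the
universal property of `B`, and `ψ` from the covariant pair formed by `z ⊗ z` and a map `A ⊠ A → A ⊗
B → B ⊗ B`, itself an instance of the extension theorem with `v = z`. The values on `z` and `u` are
forced by the defining properties, which gives uniqueness. -/

open scoped ComplexOrder in
/-- A functional of norm at most one with value `1` at `1` is positive. -/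
theorem nonneg_of_norm_le_one {A : Type*} [CStarAlgebra A] [PartialOrder A] [StarOrderedRing A]
    (g : StrongDual ℂ A) (hg : ‖g‖ ≤ 1) (h1 : g 1 = 1) {a : A} (ha : 0 ≤ a) : 0 ≤ g a := by
  have hle : ∀ x : A, ‖g x‖ ≤ ‖x‖ := fun x =>
    (g.le_opNorm x).trans (mul_le_of_le_one_left (norm_nonneg x) hg)
  have hsa : IsSelfAdjoint a := IsSelfAdjoint.of_nonneg ha
  have hone : ‖(1 : A)‖ ≤ 1 := by
    have := CStarRing.norm_star_mul_self (x := (1 : A))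
    rw [star_one, mul_one] at this
    nlinarith [norm_nonneg (1 : A)]
  have him : (g a).im = 0 := by
    -- The C*-identity for `a + i t` gives `‖a + i t‖² = ‖a² + t²‖ ≤ ‖a‖² + t²`, while `g` shifts
    -- the imaginary part by exactly `t`.
    have key : ∀ t : ℝ, (g a).re ^ 2 + ((g a).im + t) ^ 2 ≤ ‖a‖ ^ 2 + t ^ 2 := by
      intro t
      set x : A := a + ((t : ℂ) * Complex.I) • (1 : A) with hx
      have e1 : star x * x = a * a + ((t ^ 2 : ℝ) : ℂ) • (1 : A) := by
        rw [hx, star_add, hsa.star_eq, star_smul, star_one, add_mul, mul_add, mul_add]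
        simp only [mul_smul_comm, smul_mul_assoc, mul_one, one_mul, smul_smul]
        have e2 : star ((t : ℂ) * Complex.I) = -((t : ℂ) * Complex.I) := by simp
        have e3 : ((t : ℂ) * Complex.I) * -((t : ℂ) * Complex.I) = ((t ^ 2 : ℝ) : ℂ) := by
          push_cast
          linear_combination (-(t : ℂ) ^ 2) * Complex.I_sq
        rw [e2, e3, neg_smul]
        abel
      have e4 : ‖x‖ ^ 2 ≤ ‖a‖ ^ 2 + t ^ 2 := by
        rw [sq, ← CStarRing.norm_star_mul_self, e1]
        refine (norm_add_le _ _).trans (add_le_add ?_ ?_)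
        · rw [sq]; exact norm_mul_le _ _
        · rw [norm_smul, Complex.norm_real, Real.norm_eq_abs, abs_of_nonneg (sq_nonneg t)]
          exact mul_le_of_le_one_right (sq_nonneg t) hone
      have e5 : g x = g a + (t : ℂ) * Complex.I := by
        rw [hx, map_add, map_smul, h1, smul_eq_mul, mul_one]
      have e6 : ‖g x‖ ^ 2 = (g a).re ^ 2 + ((g a).im + t) ^ 2 := by
        rw [e5, ← Complex.normSq_eq_norm_sq, Complex.normSq_apply]
        simp
        ring
      rw [← e6]
      exact (pow_le_pow_left₀ (norm_nonneg _) (hle x) 2).trans e4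
    by_contra hne
    -- The terms `t²` cancel and leave `2 t Im g(a) ≤ ‖a‖²`; this `t` makes the left side `‖a‖² +
    -- 1`.
    have h2 := key ((‖a‖ ^ 2 + 1) / (2 * (g a).im))
    have h3 : 2 * (g a).im * ((‖a‖ ^ 2 + 1) / (2 * (g a).im)) = ‖a‖ ^ 2 + 1 := by
      field_simp
    nlinarith [sq_nonneg (g a).re, sq_nonneg (g a).im]
  have hre : 0 ≤ (g a).re := by
    -- From `0 ≤ ‖a‖ - a ≤ ‖a‖`, contractivity of `g` yields `‖a‖ - Re g(a) ≤ ‖a‖`.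
    have h2 : ‖algebraMap ℝ A ‖a‖ - a‖ ≤ ‖a‖ := by
      have h3 : ‖algebraMap ℝ A ‖a‖ - a‖ ≤ ‖algebraMap ℝ A ‖a‖‖ :=
        CStarAlgebra.norm_le_norm_of_nonneg_of_le
          (sub_nonneg.mpr (IsSelfAdjoint.le_algebraMap_norm_self hsa)) (sub_le_self _ ha)
      refine h3.trans ?_
      rw [Algebra.algebraMap_eq_smul_one, norm_smul, norm_norm]
      exact mul_le_of_le_one_right (norm_nonneg a) hone
    have h4 : g (algebraMap ℝ A ‖a‖ - a) = ((‖a‖ : ℝ) : ℂ) - g a := by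
      rw [map_sub, Algebra.algebraMap_eq_smul_one, ← Complex.coe_smul, map_smul, h1, smul_eq_mul,
        mul_one]
    have h5 := (Complex.re_le_norm _).trans ((hle (algebraMap ℝ A ‖a‖ - a)).trans h2)
    rw [h4] at h5
    simpa using h5
  exact Complex.nonneg_iff.mpr ⟨hre, him.symm⟩

open scoped ComplexOrder in
/-- A positive element has a state that attains its norm. -/
theorem exists_state_apply_eq_norm {A : Type*} [CStarAlgebra A] [PartialOrder A]
    [StarOrderedRing A] [Nontrivial A] {b : A} (hb : 0 ≤ b) :
    ∃ f : A →ₚ[ℂ] ℂ, f 1 = 1 ∧ f b = ‖b‖ := by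
  obtain ⟨g, hg, h1, h2⟩ : ∃ g : StrongDual ℂ A, ‖g‖ ≤ 1 ∧ g 1 = 1 ∧ g b = ‖b‖ := by
    rcases eq_or_ne b 0 with rfl | hb0
    · obtain ⟨g, hg, h1⟩ := exists_dual_vector'' ℂ (1 : A)
      exact ⟨g, hg, by simpa using h1, by simp⟩
    have hpos : 0 < ‖b‖ := norm_pos_iff.mpr hb0
    -- A functional norming `b` alone need not be unital. Since `‖b‖` lies in the spectrum of `b`,
    -- this sum has norm `2‖b‖`, so a norming functional must be maximal on both summands.
    set x : A := algebraMap ℝ A ‖b‖ + b with hx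
    have hnx : ‖x‖ = 2 * ‖b‖ := by
      apply le_antisymm
      · refine (norm_add_le _ _).trans ?_
        rw [norm_algebraMap', norm_norm, two_mul]
      · have hmem : ‖b‖ + ‖b‖ ∈ spectrum ℝ x :=
          spectrum.add_mem_add_iff.mpr (CStarAlgebra.norm_mem_spectrum_of_nonneg hb)
        have := spectrum.norm_le_norm_of_mem hmem
        rw [Real.norm_of_nonneg (by positivity)] at this
        linarith
    obtain ⟨g, hg, hgx⟩ := exists_dual_vector'' ℂ x
    have hle : ∀ y : A, (g y).re ≤ ‖y‖ := fun y => (Complex.re_le_norm _).trans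
      ((g.le_opNorm y).trans (mul_le_of_le_one_left (norm_nonneg y) hg))
    have hle' : ∀ y : A, ‖g y‖ ≤ ‖y‖ := fun y =>
      ((g.le_opNorm y).trans (mul_le_of_le_one_left (norm_nonneg y) hg))
    have hsum : ((‖b‖ : ℝ) : ℂ) * g 1 + g b = ((2 * ‖b‖ : ℝ) : ℂ) := by
      rw [← hnx]
      refine Eq.trans ?_ hgx
      rw [hx, map_add, Algebra.algebraMap_eq_smul_one, ← Complex.coe_smul, map_smul, smul_eq_mul]
    have hre := congrArg Complex.re hsum
    simp only [Complex.add_re, Complex.re_ofReal_mul, Complex.ofReal_re] at hre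
    have h1' := hle 1
    rw [norm_one] at h1'
    have hb' := hle b
    -- Two real parts bounded by `‖b‖` add up to `2‖b‖`, so both bounds are attained; then `|g 1| ≤
    -- 1` kills the imaginary part of `g 1`.
    have r1 : (g 1).re = 1 := by nlinarith
    have g1 : g 1 = 1 := by
      have hn := hle' 1
      rw [norm_one] at hn
      have hn2 : ‖g 1‖ ^ 2 ≤ 1 := by nlinarith [norm_nonneg (g 1)]
      rw [← Complex.normSq_eq_norm_sq, Complex.normSq_apply, r1] at hn2
      have : (g 1).im = 0 := by nlinarith
      exact Complex.ext r1 this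
    refine ⟨g, hg, g1, ?_⟩
    rw [g1, mul_one] at hsum
    push_cast at hsum
    linear_combination hsum
  exact ⟨PositiveLinearMap.mk₀ (g : A →ₗ[ℂ] ℂ) fun a ha => nonneg_of_norm_le_one g hg h1 ha,
    h1, h2⟩

open scoped ComplexOrder in
/-- Every element of a C*-algebra attains its norm in some representation on a Hilbert space. -/
theorem exists_rep_norm_le.{u} {A : Type u} [CStarAlgebra A] (a : A) :
    ∃ (H : Type u) (_ : NormedAddCommGroup H) (_ : InnerProductSpace ℂ H) (_ : CompleteSpace H)
      (π : A →⋆ₐ[ℂ] (H →L[ℂ] H)), ‖a‖ ≤ ‖π a‖ := by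
  let _ := CStarAlgebra.spectralOrder A
  have := CStarAlgebra.spectralOrderedRing A
  rcases subsingleton_or_nontrivial A with hA | hA
  -- The zero algebra has no state; any representation serves, and the zero functional supplies one.
  · obtain ⟨H, h1, h2, h3, π, -⟩ : ∃ (H : Type u) (_ : NormedAddCommGroup H)
        (_ : InnerProductSpace ℂ H) (_ : CompleteSpace H) (π : A →⋆ₐ[ℂ] (H →L[ℂ] H)), True :=
      ⟨_, inferInstance, inferInstance, inferInstance,
        (0 : A →ₚ[ℂ] ℂ).gnsStarAlgHom, trivial⟩
    refine ⟨H, h1, h2, h3, π, ?_⟩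
    rw [Subsingleton.elim a 0, norm_zero]
    exact norm_nonneg _
  -- In the GNS space of `f` the class of `1` is a unit vector `ξ`, and `‖π(a) ξ‖² = f(a* a) =
  -- ‖a‖²`.
  · obtain ⟨f, hf1, hfa⟩ := exists_state_apply_eq_norm (star_mul_self_nonneg a)
    refine ⟨f.GNS, inferInstance, inferInstance, inferInstance, f.gnsStarAlgHom, ?_⟩
    have hnorm : ∀ x : A, ‖((f.toPreGNS x : f.PreGNS) : f.GNS)‖ ^ 2 = (f (star x * x)).re := by
      intro x
      rw [UniformSpace.Completion.norm_coe]
      have := f.preGNS_norm_sq (f.toPreGNS x)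
      rw [PositiveLinearMap.ofPreGNS_toPreGNS] at this
      rw [← this]
      norm_cast
    have h1 : ‖((f.toPreGNS 1 : f.PreGNS) : f.GNS)‖ = 1 := by
      have := hnorm 1
      rw [star_one, mul_one, hf1, Complex.one_re] at this
      nlinarith [norm_nonneg ((f.toPreGNS 1 : f.PreGNS) : f.GNS)]
    have h2 : f.gnsStarAlgHom a ((f.toPreGNS 1 : f.PreGNS) : f.GNS) =
        ((f.toPreGNS a : f.PreGNS) : f.GNS) := by
      change f.gnsNonUnitalStarAlgHom a _ = _
      rw [PositiveLinearMap.gnsNonUnitalStarAlgHom_apply_coe]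
      congr 1
      change f.toPreGNS (a * 1) = _
      rw [mul_one]
    have h3 : ‖((f.toPreGNS a : f.PreGNS) : f.GNS)‖ = ‖a‖ := by
      have := hnorm a
      rw [hfa, Complex.ofReal_re, CStarRing.norm_star_mul_self, ← sq] at this
      exact (pow_left_inj₀ (norm_nonneg _) (norm_nonneg _) two_ne_zero).mp this
    have h4 := (f.gnsStarAlgHom a).le_opNorm ((f.toPreGNS 1 : f.PreGNS) : f.GNS)
    rwa [h2, h1, mul_one, h3] at h4

/-! ### Homomorphisms on generating sets and dense subalgebras -/

/-- *-homomorphisms that agree on a generating set are equal. -/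
theorem hom_ext_of_adjoin {Z D : Type*} [CStarAlgebra Z] [CStarAlgebra D] {S : Set Z}
    (hS : (StarAlgebra.adjoin ℂ S).topologicalClosure = ⊤) {φ ψ : Z →⋆ₐ[ℂ] D}
    (h : ∀ x ∈ S, φ x = ψ x) : φ = ψ := by
  have hle : StarAlgebra.adjoin ℂ S ≤ StarAlgHom.equalizer φ ψ := StarAlgebra.adjoin_le h
  have hcl : IsClosed ((StarAlgHom.equalizer φ ψ : StarSubalgebra ℂ Z) : Set Z) :=
    isClosed_eq (starHom_continuous φ) (starHom_continuous ψ)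
  have := StarSubalgebra.topologicalClosure_minimal hle hcl
  rw [hS] at this
  ext x
  exact this (StarSubalgebra.mem_top)

/-- The image of a generating set under a *-homomorphism generates the range. -/
theorem apply_mem_of_adjoin {Z D : Type*} [CStarAlgebra Z] [CStarAlgebra D] {S : Set Z}
    (hS : (StarAlgebra.adjoin ℂ S).topologicalClosure = ⊤) (φ : Z →⋆ₐ[ℂ] D)
    (T : StarSubalgebra ℂ D) (hT : IsClosed (T : Set D)) (h : ∀ x ∈ S, φ x ∈ T) (x : Z) :
    φ x ∈ T := by
  have hle : StarAlgebra.adjoin ℂ S ≤ T.comap φ := StarAlgebra.adjoin_le h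
  have := StarSubalgebra.topologicalClosure_minimal hle (hT.preimage (starHom_continuous φ))
  rw [hS] at this
  exact this (StarSubalgebra.mem_top)

/-- The free *-algebra on a generating family has dense image. -/
theorem denseRange_lift {X Z : Type*} [CStarAlgebra Z] {f : X → Z}
    (hf : (StarAlgebra.adjoin ℂ (Set.range f)).topologicalClosure = ⊤) :
    DenseRange (FreeStar.lift f) := by
  intro x
  have hx : x ∈ closure ((StarAlgebra.adjoin ℂ (Set.range f) : StarSubalgebra ℂ Z) : Set Z) := by
    rw [← StarSubalgebra.topologicalClosure_coe, hf]; trivial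
  refine closure_mono ?_ hx
  have : StarAlgebra.adjoin ℂ (Set.range f) ≤ (FreeStar.lift f).range := by
    refine StarAlgebra.adjoin_le ?_
    rintro _ ⟨y, rfl⟩
    exact ⟨FreeStar.gen y, FreeStar.lift_gen f y⟩
  exact this

/-- A *-homomorphism on a dense *-subalgebra that is norm-decreasing extends. -/
theorem exists_extension {R Z D : Type*} [Ring R] [StarRing R] [Algebra ℂ R] [StarModule ℂ R]
    [CStarAlgebra Z] [CStarAlgebra D] (F : R →⋆ₐ[ℂ] Z) (hF : DenseRange F) (G : R →⋆ₐ[ℂ] D)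
    (h : ∀ p, ‖G p‖ ≤ ‖F p‖) : ∃ Θ : Z →⋆ₐ[ℂ] D, ∀ p, Θ (F p) = G p := by
  set q : CStarSeminorm R := CStarSeminorm.ofHom F
  let e : q.Completion →⋆ₐ[ℂ] Z := q.lift F fun _ => le_rfl
  have he : ∀ p, e (q.of p) = F p := fun p => q.lift_of F (fun _ => le_rfl) p
  have hn : ∀ x, ‖e x‖ = ‖x‖ := by
    refine q.induction (P := fun x => ‖e x‖ = ‖x‖)
      (isClosed_eq (starHom_continuous e).norm continuous_norm) fun a => ?_
    rw [he, q.norm_of]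
    rfl
  have hiso : Isometry e := AddMonoidHomClass.isometry_of_norm e hn
  -- The range of an isometry on a complete space is closed, and here it is also dense. So `Z` is
  -- the completion of `R` in the seminorm `‖F p‖`, from which dominated maps extend.
  have hsurj : Function.Surjective e := by
    have hd : DenseRange e := hF.mono (by
      rintro _ ⟨p, rfl⟩
      exact ⟨q.of p, he p⟩)
    rw [← Set.range_eq_univ, ← hiso.isClosedEmbedding.isClosed_range.closure_eq]
    exact hd.closure_range
  let E : q.Completion ≃⋆ₐ[ℂ] Z := StarAlgEquiv.ofBijective e ⟨hiso.injective, hsurj⟩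
  refine ⟨(q.lift G h).comp (E.symm : Z →⋆ₐ[ℂ] q.Completion), fun p => ?_⟩
  have : E.symm (F p) = q.of p := by
    rw [← he p]
    exact E.symm_apply_apply (q.of p)
  change q.lift G h (E.symm (F p)) = G p
  rw [this]
  exact q.lift_of G h p

/-- Elements of a C*-algebra in any universe lie in a C*-subalgebra that is isomorphic to one in
the universe of their index set. -/
theorem exists_small_cstar.{u, w} {X : Type u} {D : Type w} [CStarAlgebra D] (f : X → D) :
    ∃ (D₀ : Type u) (_ : CStarAlgebra D₀) (j : D₀ →⋆ₐ[ℂ] D) (g : X → D₀),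
      Function.Injective j ∧ ∀ x, j (g x) = f x := by
  -- The free *-algebra on `X`, and hence its completion, stays in the universe of `X`; only the
  -- seminorm refers to `D`.
  set q : CStarSeminorm (FreeStar X) := CStarSeminorm.ofHom (FreeStar.lift f)
  let e : q.Completion →⋆ₐ[ℂ] D := q.lift (FreeStar.lift f) fun _ => le_rfl
  have he : ∀ p, e (q.of p) = FreeStar.lift f p := fun p =>
    q.lift_of (FreeStar.lift f) (fun _ => le_rfl) p
  have hn : ∀ x, ‖e x‖ = ‖x‖ := by
    refine q.induction (P := fun x => ‖e x‖ = ‖x‖)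
      (isClosed_eq (starHom_continuous e).norm continuous_norm) fun a => ?_
    rw [he, q.norm_of]
    rfl
  exact ⟨q.Completion, inferInstance, e, fun x => q.of (FreeStar.gen x),
    (AddMonoidHomClass.isometry_of_norm e hn).injective,
    fun x => (he _).trans (FreeStar.lift_gen f x)⟩

/-! ### Approximate intertwiners -/

open Filter Topology in
/-- If isometries `Ω N` intertwine `S` and `T N` approximately on the letters of a free *-algebra,
then a uniform bound for the `T N` also bounds `S`. -/
theorem norm_le_of_tendsto_intertwine {W : Type*} {Q : Type*} [NormedAddCommGroup Q]
    [InnerProductSpace ℂ Q] {L : ℕ → Type*} [∀ N, NormedAddCommGroup (L N)]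
    [∀ N, NormedSpace ℂ (L N)] (S : FreeStar W →ₐ[ℂ] (Q →L[ℂ] Q))
    (T : ∀ N, FreeStar W →ₐ[ℂ] Module.End ℂ (L N)) (C : FreeStar W → ℝ)
    (hT : ∀ N p ξ, ‖T N p ξ‖ ≤ C p * ‖ξ‖) (Ω : ∀ N, Q →ₗ[ℂ] L N) (hΩ : ∀ N q, ‖Ω N q‖ = ‖q‖)
    (h : ∀ y q, Tendsto (fun N => ‖T N (FreeStar.letter y) (Ω N q) -
      Ω N (S (FreeStar.letter y) q)‖) atTop (𝓝 0)) (p : FreeStar W) (hC : 0 ≤ C p) :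
    ‖S p‖ ≤ C p := by
  have key : ∀ q, Tendsto (fun N => ‖T N p (Ω N q) - Ω N (S p q)‖) atTop (𝓝 0) := by
    refine FreeStar.induction (P := fun p => ∀ q, Tendsto (fun N => ‖T N p (Ω N q) -
      Ω N (S p q)‖) atTop (𝓝 0)) (fun c q => ?_) h (fun a b ha hb q => ?_) (fun a b ha hb q => ?_) p
    · refine tendsto_const_nhds.congr fun N => ?_
      rw [AlgHom.commutes, AlgHom.commutes, Module.algebraMap_end_apply,
        Algebra.algebraMap_eq_smul_one, _root_.smul_apply,
        one_apply_eq_self, map_smul, sub_self, norm_zero]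
    · have h1 := ((hb q).const_mul (C a)).add (ha (S b q))
      rw [mul_zero, zero_add] at h1
      refine squeeze_zero (fun _ => norm_nonneg _) (fun N => ?_) h1
      -- The first error is multiplied by `T N a`, whose bound `C a` does not depend on `N`; the
      -- second is the hypothesis for `a` at the fixed vector `S b q`.
      have e : T N (a * b) (Ω N q) - Ω N (S (a * b) q) =
          T N a (T N b (Ω N q) - Ω N (S b q)) + (T N a (Ω N (S b q)) - Ω N (S a (S b q))) := by
        rw [map_mul, map_mul, Module.End.mul_apply, mul_apply_eq_comp, map_sub]
        abel
      rw [e]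
      exact (norm_add_le _ _).trans (by gcongr; exact hT _ _ _)
    · have h1 := (ha q).add (hb q)
      rw [zero_add] at h1
      refine squeeze_zero (fun _ => norm_nonneg _) (fun N => ?_) h1
      have e : T N (a + b) (Ω N q) - Ω N (S (a + b) q) =
          (T N a (Ω N q) - Ω N (S a q)) + (T N b (Ω N q) - Ω N (S b q)) := by
        rw [map_add, map_add, LinearMap.add_apply, _root_.add_apply, map_add]
        abel
      rw [e]
      exact norm_add_le _ _
  -- As `Ω N` is isometric, `‖S p q‖` is at most `C p * ‖q‖` plus an error that vanishes in the
  -- limit.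
  refine ContinuousLinearMap.opNorm_le_bound _ hC fun q => ?_
  have h1 : Tendsto (fun N => ‖T N p (Ω N q) - Ω N (S p q)‖ + C p * ‖q‖) atTop
      (𝓝 (0 + C p * ‖q‖)) := (key q).add tendsto_const_nhds
  rw [zero_add] at h1
  refine ge_of_tendsto' h1 fun N => ?_
  have h2 := hT N p (Ω N q)
  rw [hΩ] at h2
  calc ‖S p q‖ = ‖Ω N (S p q)‖ := (hΩ _ _).symm
    _ = ‖T N p (Ω N q) - (T N p (Ω N q) - Ω N (S p q))‖ := by rw [sub_sub_cancel]
    _ ≤ ‖T N p (Ω N q)‖ + ‖T N p (Ω N q) - Ω N (S p q)‖ := norm_sub_le _ _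
    _ ≤ _ := by rw [add_comm]; gcongr

/-- Bounded operators as linear endomorphisms. -/
def endOfCLM (L : Type*) [NormedAddCommGroup L] [NormedSpace ℂ L] :
    (L →L[ℂ] L) →ₐ[ℂ] Module.End ℂ L where
  toFun T := T
  map_one' := rfl
  map_mul' _ _ := rfl
  map_zero' := rfl
  map_add' _ _ := rfl
  commutes' _ := rfl

-- With one target space for all `N`, the operator norm of `T p` is the uniform bound. This form
-- serves the Følner vectors; the general one, with spaces varying with `N`, serves the Fourier
-- vectors.
open Filter Topology in
theorem norm_le_norm_of_tendsto_intertwine {W : Type*} {Q L : Type*} [NormedAddCommGroup Q]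
    [InnerProductSpace ℂ Q] [NormedAddCommGroup L] [NormedSpace ℂ L]
    (S : FreeStar W →ₐ[ℂ] (Q →L[ℂ] Q)) (T : FreeStar W →ₐ[ℂ] (L →L[ℂ] L)) (Ω : ℕ → Q →ₗ[ℂ] L)
    (hΩ : ∀ N q, ‖Ω N q‖ = ‖q‖) (h : ∀ y q, Tendsto (fun N => ‖T (FreeStar.letter y) (Ω N q) -
      Ω N (S (FreeStar.letter y) q)‖) atTop (𝓝 0)) (p : FreeStar W) : ‖S p‖ ≤ ‖T p‖ :=
  norm_le_of_tendsto_intertwine S (fun _ => (endOfCLM L).comp T) (fun p => ‖T p‖)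
    (fun _ p ξ => (T p).le_opNorm ξ) Ω hΩ h p (ContinuousLinearMap.opNorm_nonneg _)

/-! ### Representations of minimal tensor products -/

section

variable {H K : Type*} [NormedAddCommGroup H] [InnerProductSpace ℂ H]
  [NormedAddCommGroup K] [InnerProductSpace ℂ K]

/-- The operator `ξ ↦ ξ ⊗ η`. -/
def tensorVec (η : K) : H →ₗ[ℂ] HilbertTensor H K :=
  (UniformSpace.Completion.toComplₗᵢ (𝕜 := ℂ) (E := H ⊗[ℂ] K)).toLinearMap ∘ₗ
    (TensorProduct.mk ℂ H K).flip η

theorem ampLeft_tensorVec [CompleteSpace H] (T : H →L[ℂ] H) (η : K) (ξ : H) :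
    ampLeft H K T (tensorVec η ξ) = tensorVec η (T ξ) := by
  change (T.rTensor K).completion ((ξ ⊗ₜ[ℂ] η : H ⊗[ℂ] K) : HilbertTensor H K) = _
  rw [ContinuousLinearMap.completion_apply_coe, ContinuousLinearMap.rTensor_tmul]
  rfl

theorem ampRight_tensorVec [CompleteSpace K] (T : K →L[ℂ] K) (η : K) (ξ : H) :
    ampRight H K T (tensorVec η ξ) = tensorVec (T η) ξ := by
  change (T.lTensor H).completion ((ξ ⊗ₜ[ℂ] η : H ⊗[ℂ] K) : HilbertTensor H K) = _
  rw [ContinuousLinearMap.completion_apply_coe, ContinuousLinearMap.lTensor_tmul]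
  rfl

theorem inner_tensorVec (η η' : K) (ξ ξ' : H) :
    inner ℂ (tensorVec η ξ) (tensorVec η' ξ') = inner ℂ ξ ξ' * inner ℂ η η' := by
  change inner ℂ ((ξ ⊗ₜ[ℂ] η : H ⊗[ℂ] K) : HilbertTensor H K)
    ((ξ' ⊗ₜ[ℂ] η' : H ⊗[ℂ] K) : HilbertTensor H K) = _
  rw [UniformSpace.Completion.inner_coe, TensorProduct.inner_tmul]

theorem norm_tensorVec (η : K) (ξ : H) : ‖tensorVec η ξ‖ = ‖ξ‖ * ‖η‖ := by
  change ‖((ξ ⊗ₜ[ℂ] η : H ⊗[ℂ] K) : HilbertTensor H K)‖ = _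
  rw [UniformSpace.Completion.norm_coe, TensorProduct.norm_tmul]

theorem tensorVec_smul (c : ℂ) (η : K) (ξ : H) :
    tensorVec (c • η) ξ = c • tensorVec η ξ := by
  change (((ξ ⊗ₜ[ℂ] (c • η) : H ⊗[ℂ] K)) : HilbertTensor H K) = _
  rw [TensorProduct.tmul_smul, UniformSpace.Completion.coe_smul]
  rfl

end

/-- The representation `π ⊗ σ` of the minimal tensor product. -/
def MinTensor.rep {A B : Type} [CStarAlgebra A] [CStarAlgebra B] {H K : Type}
    [NormedAddCommGroup H] [InnerProductSpace ℂ H] [CompleteSpace H]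
    [NormedAddCommGroup K] [InnerProductSpace ℂ K] [CompleteSpace K]
    (π : A →⋆ₐ[ℂ] (H →L[ℂ] H)) (σ : B →⋆ₐ[ℂ] (K →L[ℂ] K)) :
    A ⊗min B →⋆ₐ[ℂ] (HilbertTensor H K →L[ℂ] HilbertTensor H K) :=
  CStarSeminorm.lift (D := HilbertTensor H K →L[ℂ] HilbertTensor H K) _ (tensorRep π σ)
    (MinTensor.norm_tensorRep_le π σ)

theorem MinTensor.rep_tmul {A B : Type} [CStarAlgebra A] [CStarAlgebra B] {H K : Type}
    [NormedAddCommGroup H] [InnerProductSpace ℂ H] [CompleteSpace H]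
    [NormedAddCommGroup K] [InnerProductSpace ℂ K] [CompleteSpace K]
    (π : A →⋆ₐ[ℂ] (H →L[ℂ] H)) (σ : B →⋆ₐ[ℂ] (K →L[ℂ] K)) (a : A) (b : B) :
    MinTensor.rep π σ (MinTensor.tmul a b) = ampLeft H K (π a) * ampRight H K (σ b) :=
  (CStarSeminorm.lift_of (D := HilbertTensor H K →L[ℂ] HilbertTensor H K) _ _ _ _).trans
    (tensorRep_tmul π σ a b)

/-- The slice map `χ ⊗ id` of a character `χ`. -/
theorem MinTensor.exists_slice {A B : Type} [CStarAlgebra A] [CStarAlgebra B]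
    (χ : A →⋆ₐ[ℂ] ℂ) : ∃ s : A ⊗min B →⋆ₐ[ℂ] B, ∀ a b, s (MinTensor.tmul a b) = χ a • b := by
  let f : A →⋆ₐ[ℂ] B := (StarAlgHom.ofId ℂ B).comp χ
  have hf : ∀ a, f a = algebraMap ℂ B (χ a) := fun a => rfl
  have hcomm : ∀ a b, Commute (f a) (StarAlgHom.id ℂ B b) := fun a b => by
    rw [hf]; exact Algebra.commutes _ _
  have hle : ∀ x, ‖algLift f (StarAlgHom.id ℂ B) hcomm x‖ ≤ minSeminorm A B x := by
    intro x
    -- The representation `σ` attains the norm of the sliced element, which is thereby compared with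
    -- the single spatial representation `χ ⊗ σ` on `ℂ ⊗ K`.
    obtain ⟨K, _, _, _, σ, hσ⟩ := exists_rep_norm_le (algLift f (StarAlgHom.id ℂ B) hcomm x)
    refine hσ.trans (le_trans ?_ (MinTensor.norm_tensorRep_le
      ((StarAlgHom.ofId ℂ (ℂ →L[ℂ] ℂ)).comp χ) σ x))
    refine ContinuousLinearMap.opNorm_le_bound _ (ContinuousLinearMap.opNorm_nonneg _) fun η => ?_
    -- The isometry `η ↦ 1 ⊗ η` of `K` into `ℂ ⊗ K` intertwines `σ ∘ (χ ⊗ id)` with `χ ⊗ σ`.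
    have e : tensorRep ((StarAlgHom.ofId ℂ (ℂ →L[ℂ] ℂ)).comp χ) σ x (tensorVec η 1) =
        tensorVec (σ (algLift f (StarAlgHom.id ℂ B) hcomm x) η) 1 := by
      clear hσ
      induction x with
      | zero =>
        rw [map_zero, map_zero, map_zero]
        exact (map_zero ((UniformSpace.Completion.toComplₗᵢ (𝕜 := ℂ)
          (E := ℂ ⊗[ℂ] K)).toLinearMap ∘ₗ TensorProduct.mk ℂ ℂ K 1)).symm
      | add x y hx hy =>
        rw [map_add, map_add, map_add, _root_.add_apply,
          _root_.add_apply, hx, hy]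
        exact (map_add ((UniformSpace.Completion.toComplₗᵢ (𝕜 := ℂ)
          (E := ℂ ⊗[ℂ] K)).toLinearMap ∘ₗ TensorProduct.mk ℂ ℂ K 1) _ _).symm
      | tmul a b =>
        rw [tensorRep_tmul, algLift_tmul, mul_apply_eq_comp, ampRight_tensorVec,
          ampLeft_tensorVec, hf, ← Algebra.smul_def, map_smul]
        change tensorVec (σ b η) (χ a • (1 : ℂ)) = tensorVec (χ a • σ b η) 1
        rw [map_smul, tensorVec_smul]
    have h1 := (tensorRep ((StarAlgHom.ofId ℂ (ℂ →L[ℂ] ℂ)).comp χ) σ x).le_opNorm (tensorVec η 1)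
    rwa [e, norm_tensorVec, norm_tensorVec, norm_one, one_mul, one_mul] at h1
  refine ⟨CStarSeminorm.lift _ (algLift f (StarAlgHom.id ℂ B) hcomm) hle, fun a b => ?_⟩
  refine (CStarSeminorm.lift_of _ _ _ _).trans ?_
  rw [algLift_tmul, hf, ← Algebra.smul_def]
  rfl

/-! ### Representations of the noncommutative torus -/

namespace NCTorus

variable {ζ : Circle} {D : Type*} [CStarAlgebra D]

/-- The universal property of the noncommutative torus. -/
def lift (a b : unitary D) (h : (b : D) * a = (ζ : ℂ) • ((a : D) * b)) : NCTorus ζ →⋆ₐ[ℂ] D :=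
  UnivCStar.lift (torusRels_bounding ζ) ![(a : D), b] (by
    have ha := Unitary.mem_iff.mp a.2
    have hb := Unitary.mem_iff.mp b.2
    rintro r (rfl | rfl | rfl | rfl | rfl) <;>
      simp only [map_sub, map_mul, map_star, map_one, map_smul, FreeStar.lift_gen,
        Matrix.cons_val_zero, Matrix.cons_val_one, sub_eq_zero]
    exacts [ha.1, ha.2, hb.1, hb.2, h])

theorem lift_U_zpow (a b : unitary D) (h : (b : D) * a = (ζ : ℂ) • ((a : D) * b)) (k : ℤ) :
    lift a b h ((U ζ ^ k : unitary (NCTorus ζ)) : NCTorus ζ) = ((a ^ k : unitary D) : D) := by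
  rw [map_zpow_coe]
  congr 2
  exact Subtype.ext (UnivCStar.lift_gen (torusRels_bounding ζ) _ _ 0)

theorem lift_V_zpow (a b : unitary D) (h : (b : D) * a = (ζ : ℂ) • ((a : D) * b)) (k : ℤ) :
    lift a b h ((V ζ ^ k : unitary (NCTorus ζ)) : NCTorus ζ) = ((b ^ k : unitary D) : D) := by
  rw [map_zpow_coe]
  congr 2
  exact Subtype.ext (UnivCStar.lift_gen (torusRels_bounding ζ) _ _ 1)

end NCTorus

/-! ### Integer powers of unitaries and scalar commutation relations -/

section Unitary

variable {Q : Type*} [NormedAddCommGroup Q] [InnerProductSpace ℂ Q] [CompleteSpace Q]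

theorem unitary_inv_apply_self (Z : unitary (Q →L[ℂ] Q)) (q : Q) :
    ((Z⁻¹ : unitary (Q →L[ℂ] Q)) : Q →L[ℂ] Q) ((Z : Q →L[ℂ] Q) q) = q := by
  change (((Z⁻¹ * Z : unitary (Q →L[ℂ] Q)) : Q →L[ℂ] Q)) q = q
  rw [inv_mul_cancel]; rfl

theorem unitary_zpow_add_apply (Z : unitary (Q →L[ℂ] Q)) (k l : ℤ) (q : Q) :
    ((Z ^ (k + l) : unitary (Q →L[ℂ] Q)) : Q →L[ℂ] Q) q =
      ((Z ^ k : unitary (Q →L[ℂ] Q)) : Q →L[ℂ] Q)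
        (((Z ^ l : unitary (Q →L[ℂ] Q)) : Q →L[ℂ] Q) q) := by
  rw [zpow_add]; rfl

theorem shift_zpow_apply (Z : unitary (Q →L[ℂ] Q)) {e : ℤ → Q}
    (h : ∀ n, (Z : Q →L[ℂ] Q) (e n) = e (n + 1)) (k n : ℤ) :
    ((Z ^ k : unitary (Q →L[ℂ] Q)) : Q →L[ℂ] Q) (e n) = e (n + k) := by
  have h1 : ∀ n, ((Z ^ (-1 : ℤ) : unitary (Q →L[ℂ] Q)) : Q →L[ℂ] Q) (e n) = e (n - 1) := fun n => by
    have := h (n - 1)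
    rw [sub_add_cancel] at this
    rw [← this, zpow_neg_one, unitary_inv_apply_self]
  induction k using Int.induction_on generalizing n with
  | zero => rw [zpow_zero, add_zero]; rfl
  | succ k ih => rw [unitary_zpow_add_apply, zpow_one, h, ih]; congr 1; ring
  | pred k ih => rw [sub_eq_add_neg, unitary_zpow_add_apply, h1, ih]; congr 1; ring

theorem eigen_zpow_apply (Z : unitary (Q →L[ℂ] Q)) {c : Circle} {x : Q}
    (h : (Z : Q →L[ℂ] Q) x = (c : ℂ) • x) (k : ℤ) :
    ((Z ^ k : unitary (Q →L[ℂ] Q)) : Q →L[ℂ] Q) x = ((c ^ k : Circle) : ℂ) • x := by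
  have h1 : ((Z ^ (-1 : ℤ) : unitary (Q →L[ℂ] Q)) : Q →L[ℂ] Q) x = ((c⁻¹ : Circle) : ℂ) • x := by
    have h2 : ((c⁻¹ : Circle) : ℂ) • (Z : Q →L[ℂ] Q) x = x := by
      rw [h, smul_smul, ← Circle.coe_mul, inv_mul_cancel, Circle.coe_one, one_smul]
    conv_lhs => rw [← h2]
    rw [map_smul, zpow_neg_one, unitary_inv_apply_self]
  induction k using Int.induction_on with
  | zero => rw [zpow_zero, zpow_zero, Circle.coe_one, one_smul]; rfl
  | succ k ih =>
    rw [unitary_zpow_add_apply, zpow_one, h, map_smul, ih, smul_smul, ← Circle.coe_mul,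
      zpow_add_one, mul_comm]
  | pred k ih =>
    rw [sub_eq_add_neg, unitary_zpow_add_apply, h1, map_smul, ih, smul_smul, ← Circle.coe_mul,
      zpow_add, zpow_neg_one, mul_comm]

/-- If `b v = c v b` for a scalar `c`, then `b v ^ k = c ^ k v ^ k b`. -/
theorem mul_zpow_of_mul_eq_smul {D : Type*} [CStarAlgebra D] {v : unitary D} {b : D} {c : Circle}
    (h : b * v = (c : ℂ) • ((v : D) * b)) (k : ℤ) :
    b * ((v ^ k : unitary D) : D) = ((c ^ k : Circle) : ℂ) • (((v ^ k : unitary D) : D) * b) := by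
  have h1 : b * ((v ^ (-1 : ℤ) : unitary D) : D) =
      ((c⁻¹ : Circle) : ℂ) • (((v ^ (-1 : ℤ) : unitary D) : D) * b) := by
    have e1 : ((v ^ (-1 : ℤ) : unitary D) : D) * v = 1 := by
      rw [zpow_neg_one]
      exact congrArg Subtype.val (inv_mul_cancel v)
    have e2 : (v : D) * ((v ^ (-1 : ℤ) : unitary D) : D) = 1 := by
      rw [zpow_neg_one]
      exact congrArg Subtype.val (mul_inv_cancel v)
    calc b * ((v ^ (-1 : ℤ) : unitary D) : D)
        = ((v ^ (-1 : ℤ) : unitary D) : D) * (((c⁻¹ : Circle) : ℂ) • ((c : ℂ) • ((v : D) * b))) *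
            ((v ^ (-1 : ℤ) : unitary D) : D) := by
          rw [smul_smul, ← Circle.coe_mul, inv_mul_cancel, Circle.coe_one, one_smul, ← mul_assoc,
            e1, one_mul]
      _ = ((c⁻¹ : Circle) : ℂ) • (((v ^ (-1 : ℤ) : unitary D) : D) * b *
            ((v : D) * ((v ^ (-1 : ℤ) : unitary D) : D))) := by
          rw [← h]
          simp only [mul_smul_comm, smul_mul_assoc, mul_assoc]
      _ = _ := by rw [e2, mul_one]
  induction k using Int.induction_on with
  | zero => rw [zpow_zero, zpow_zero, Circle.coe_one, one_smul]; simp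
  | succ k ih =>
    rw [← coe_zpow_mul, ← mul_assoc, ih, smul_mul_assoc, mul_assoc, zpow_one, h, mul_smul_comm,
      smul_smul, ← Circle.coe_mul, zpow_add_one, mul_assoc]
  | pred k ih =>
    rw [sub_eq_add_neg, ← coe_zpow_mul, ← mul_assoc, ih, smul_mul_assoc, mul_assoc, h1,
      mul_smul_comm, smul_smul, ← Circle.coe_mul, zpow_add, zpow_neg_one c, mul_assoc]

/-- Take adjoints, then multiply by `v` on both sides. Passing to the adjoint inverts the scalar,
just as it negates the degree of a homogeneous element. -/
theorem star_mul_eq_smul {D : Type*} [CStarAlgebra D] {v : unitary D} {b : D} {c : Circle}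
    (h : b * v = (c : ℂ) • ((v : D) * b)) :
    star b * v = ((c⁻¹ : Circle) : ℂ) • ((v : D) * star b) := by
  have h1 := congrArg (fun x => (v : D) * star x * v) h
  simp only [star_mul, star_smul] at h1
  have e : star (c : ℂ) = ((c⁻¹ : Circle) : ℂ) := (Circle.coe_inv_eq_conj c).symm
  rw [e] at h1
  calc star b * v = (v : D) * (star (v : D) * star b) * v := by
        rw [← mul_assoc, Unitary.mul_star_self_of_mem v.2, one_mul]
    _ = _ := by
        rw [h1, mul_smul_comm, smul_mul_assoc]
        simp only [mul_assoc]
        rw [Unitary.star_mul_self_of_mem v.2, mul_one]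

end Unitary

/-- The representation of the noncommutative torus on `ℓ²(ℤ)`. -/
theorem NCTorus.exists_rep (ζ : Circle) : ∃ (K : Type) (_ : NormedAddCommGroup K)
    (_ : InnerProductSpace ℂ K) (_ : CompleteSpace K) (e : ℤ → K)
    (ϖ : NCTorus ζ →⋆ₐ[ℂ] (K →L[ℂ] K)), Orthonormal ℂ e ∧
      (∀ k n : ℤ, ϖ ((U ζ ^ k : unitary (NCTorus ζ)) : NCTorus ζ) (e n) = e (n + k)) ∧
      ∀ l n : ℤ, ϖ ((V ζ ^ l : unitary (NCTorus ζ)) : NCTorus ζ) (e n) =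
        ((ζ ^ (n * l) : Circle) : ℂ) • e n := by
  let K : Type := lp (fun _ : ℤ => ℂ) 2
  let e : HilbertBasis ℤ ℂ K := HilbertBasis.ofRepr (LinearIsometryEquiv.refl ℂ K)
  have heo : Orthonormal ℂ e := e.orthonormal
  have hed : ⊤ ≤ (Submodule.span ℂ (Set.range e)).topologicalClosure := e.dense_span.ge
  have h1o : Orthonormal ℂ (e ∘ fun n : ℤ => n + 1) := heo.comp _ (add_left_injective 1)
  have h1d : ⊤ ≤ (Submodule.span ℂ (Set.range (e ∘ fun n : ℤ => n + 1))).topologicalClosure := by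
    rwa [(show Function.Surjective (fun n : ℤ => n + 1) from
      fun n => ⟨n - 1, sub_add_cancel n 1⟩).range_comp]
  let e1 : HilbertBasis ℤ ℂ K := HilbertBasis.mk h1o h1d
  have h2o : Orthonormal ℂ (fun n : ℤ => ((ζ ^ n : Circle) : ℂ) • e n) := by
    constructor
    · intro n
      rw [norm_smul, Circle.norm_coe, one_mul, heo.1]
    · intro m n hmn
      change inner ℂ (((ζ ^ m : Circle) : ℂ) • e m) (((ζ ^ n : Circle) : ℂ) • e n) = 0
      rw [inner_smul_left, inner_smul_right, heo.2 hmn, mul_zero, mul_zero]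
  have h2d : ⊤ ≤ (Submodule.span ℂ (Set.range
      (fun n : ℤ => ((ζ ^ n : Circle) : ℂ) • e n))).topologicalClosure := by
    refine hed.trans (Submodule.topologicalClosure_mono (Submodule.span_le.mpr ?_))
    rintro _ ⟨n, rfl⟩
    have : e n = ((ζ ^ n : Circle) : ℂ)⁻¹ • (((ζ ^ n : Circle) : ℂ) • e n) := by
      rw [smul_smul, inv_mul_cancel₀ (Circle.coe_ne_zero _), one_smul]
    rw [this]
    exact Submodule.smul_mem _ _ (Submodule.subset_span ⟨n, rfl⟩)
  let e2 : HilbertBasis ℤ ℂ K := HilbertBasis.mk h2o h2d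
  -- The unitary that carries the standard basis to the basis `b`. The shifted basis gives `U`, the
  -- basis rescaled by the phases `ζ^n` gives `V`.
  let mkU : HilbertBasis ℤ ℂ K → unitary (K →L[ℂ] K) := fun b =>
    Unitary.linearIsometryEquiv.symm (e.repr.trans b.repr.symm)
  have hmk : ∀ (b : HilbertBasis ℤ ℂ K) n, (mkU b : K →L[ℂ] K) (e n) = b n := by
    classical
    intro b n
    change b.repr.symm (e.repr (e n)) = b n
    rw [HilbertBasis.repr_self, HilbertBasis.repr_symm_single]
  have hU : ∀ n, (mkU e1 : K →L[ℂ] K) (e n) = e (n + 1) := fun n => by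
    rw [hmk, HilbertBasis.coe_mk]; rfl
  have hV : ∀ n, (mkU e2 : K →L[ℂ] K) (e n) = ((ζ ^ n : Circle) : ℂ) • e n := fun n => by
    rw [hmk, HilbertBasis.coe_mk]
  -- On `e n` the product `V U` gives `ζ^(n+1) e (n+1)` and `U V` gives `ζ^n e (n+1)`.
  have hrel : (mkU e2 : K →L[ℂ] K) * mkU e1 =
      (ζ : ℂ) • ((mkU e1 : K →L[ℂ] K) * mkU e2) := by
    refine ContinuousLinearMap.ext_on (s := Set.range e)
      (Submodule.dense_iff_topologicalClosure_eq_top.mpr e.dense_span) ?_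
    rintro _ ⟨n, rfl⟩
    rw [_root_.smul_apply, mul_apply_eq_comp, mul_apply_eq_comp, hU, hV, hV, map_smul, hU, smul_smul,
      ← Circle.coe_mul, ← zpow_one_add, add_comm 1 n]
  refine ⟨K, inferInstance, inferInstance, inferInstance, e,
    NCTorus.lift (D := K →L[ℂ] K) (mkU e1) (mkU e2) hrel, heo, fun k n => ?_, fun l n => ?_⟩
  · rw [NCTorus.lift_U_zpow]
    exact shift_zpow_apply (mkU e1) hU k n
  · rw [NCTorus.lift_V_zpow, eigen_zpow_apply (mkU e2) (hV n), ← zpow_mul]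

open Filter Topology in
/-- Approximate intertwiners of `D 1` and `Z` are approximate intertwiners of `D k` and `Z ^ k`. -/
theorem tendsto_intertwine_zpow {Q : Type*} [NormedAddCommGroup Q] [InnerProductSpace ℂ Q]
    [CompleteSpace Q] {L : ℕ → Type*} [∀ N, NormedAddCommGroup (L N)] [∀ N, NormedSpace ℂ (L N)]
    (Z : unitary (Q →L[ℂ] Q)) (D : ∀ N, ℤ → L N →ₗ[ℂ] L N) (hD : ∀ N k ξ, ‖D N k ξ‖ = ‖ξ‖)
    (hD0 : ∀ N ξ, D N 0 ξ = ξ) (hDadd : ∀ N k l ξ, D N (k + l) ξ = D N k (D N l ξ))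
    (Ω : ∀ N, Q →ₗ[ℂ] L N)
    (step : ∀ q, Tendsto (fun N => ‖D N 1 (Ω N q) - Ω N ((Z : Q →L[ℂ] Q) q)‖) atTop (𝓝 0))
    (k : ℤ) (q : Q) : Tendsto (fun N => ‖D N k (Ω N q) -
      Ω N (((Z ^ k : unitary (Q →L[ℂ] Q)) : Q →L[ℂ] Q) q)‖) atTop (𝓝 0) := by
  have stepInv : ∀ q, Tendsto (fun N => ‖D N (-1) (Ω N q) -
      Ω N (((Z ^ (-1 : ℤ) : unitary (Q →L[ℂ] Q)) : Q →L[ℂ] Q) q)‖) atTop (𝓝 0) := by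
    intro q
    -- The estimate at `q' = Z⁻¹ q` compares `D 1 (Ω q')` with `Ω q`; the isometry `D (-1)` turns it
    -- into one between `Ω q'` and `D (-1) (Ω q)`.
    refine (step (((Z ^ (-1 : ℤ) : unitary (Q →L[ℂ] Q)) : Q →L[ℂ] Q) q)).congr fun N => ?_
    set q' := ((Z ^ (-1 : ℤ) : unitary (Q →L[ℂ] Q)) : Q →L[ℂ] Q) q with hq'
    have hq : (Z : Q →L[ℂ] Q) q' = q := by
      have := unitary_zpow_add_apply Z 1 (-1) q
      rw [add_neg_cancel, zpow_zero, zpow_one] at this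
      exact this.symm
    rw [hq, ← hD N (-1), map_sub, ← hDadd, neg_add_cancel, hD0, norm_sub_rev]
  have comb : ∀ k l : ℤ,
      (∀ q, Tendsto (fun N => ‖D N k (Ω N q) -
        Ω N (((Z ^ k : unitary (Q →L[ℂ] Q)) : Q →L[ℂ] Q) q)‖) atTop (𝓝 0)) →
      (∀ q, Tendsto (fun N => ‖D N l (Ω N q) -
        Ω N (((Z ^ l : unitary (Q →L[ℂ] Q)) : Q →L[ℂ] Q) q)‖) atTop (𝓝 0)) →
      ∀ q, Tendsto (fun N => ‖D N (k + l) (Ω N q) -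
        Ω N (((Z ^ (k + l) : unitary (Q →L[ℂ] Q)) : Q →L[ℂ] Q) q)‖) atTop (𝓝 0) := by
    intro k l hk hl q
    have h1 := (hl q).add (hk (((Z ^ l : unitary (Q →L[ℂ] Q)) : Q →L[ℂ] Q) q))
    rw [zero_add] at h1
    refine squeeze_zero (fun _ => norm_nonneg _) (fun N => ?_) h1
    rw [unitary_zpow_add_apply, hDadd, ← hD N k (D N l (Ω N q) - _), map_sub]
    exact norm_sub_le_norm_sub_add_norm_sub _ _ _
  induction k using Int.induction_on generalizing q with
  | zero =>
    refine tendsto_const_nhds.congr fun N => ?_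
    rw [zpow_zero, hD0, OneMemClass.coe_one, one_apply_eq_self, sub_self, norm_zero]
  | succ k ih => exact comb k 1 (fun q => ih q) (by simpa only [zpow_one] using step) q
  | pred k ih => exact comb (-k) (-1) (fun q => ih q) stepInv q

/-! ### Følner vectors -/

section Folner

variable {Q K : Type*} [NormedAddCommGroup Q] [InnerProductSpace ℂ Q] [CompleteSpace Q]
  [NormedAddCommGroup K] [InnerProductSpace ℂ K]

/-- The map `q ↦ (N + 1) ^ (-1/2) ∑_{0 ≤ n ≤ N} Z⁻ⁿ q ⊗ e n`. -/
def folner (Z : unitary (Q →L[ℂ] Q)) (e : ℤ → K) (N : ℕ) : Q →ₗ[ℂ] HilbertTensor Q K :=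
  (((Real.sqrt (N + 1))⁻¹ : ℝ) : ℂ) • ∑ n ∈ Finset.range (N + 1), tensorVec (e n) ∘ₗ
    (((Z ^ (-(n : ℤ)) : unitary (Q →L[ℂ] Q)) : Q →L[ℂ] Q) : Q →ₗ[ℂ] Q)

theorem folner_apply (Z : unitary (Q →L[ℂ] Q)) (e : ℤ → K) (N : ℕ) (q : Q) :
    folner Z e N q = (((Real.sqrt (N + 1))⁻¹ : ℝ) : ℂ) • ∑ n ∈ Finset.range (N + 1),
      tensorVec (e n) (((Z ^ (-(n : ℤ)) : unitary (Q →L[ℂ] Q)) : Q →L[ℂ] Q) q) := by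
  rw [folner, LinearMap.smul_apply, LinearMap.sum_apply]
  rfl

/-- The `N + 1` summands are orthogonal because the `e n` are, and each has norm `‖q‖` because `Z`
is unitary; the square root in the definition normalizes the sum. -/
theorem norm_folner (Z : unitary (Q →L[ℂ] Q)) {e : ℤ → K} (he : Orthonormal ℂ e) (N : ℕ) (q : Q) :
    ‖folner Z e N q‖ = ‖q‖ := by
  have h1 : ‖∑ n ∈ Finset.range (N + 1),
      (tensorVec (e n) (((Z ^ (-(n : ℤ)) : unitary (Q →L[ℂ] Q)) : Q →L[ℂ] Q) q) :
        HilbertTensor Q K)‖ ^ 2 = (N + 1) * ‖q‖ ^ 2 := by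
    rw [← inner_self_eq_norm_sq (𝕜 := ℂ), sum_inner]
    have : ∀ n ∈ Finset.range (N + 1), inner ℂ
        (tensorVec (e n) (((Z ^ (-(n : ℤ)) : unitary (Q →L[ℂ] Q)) : Q →L[ℂ] Q) q) :
          HilbertTensor Q K)
        (∑ m ∈ Finset.range (N + 1),
          tensorVec (e m) (((Z ^ (-(m : ℤ)) : unitary (Q →L[ℂ] Q)) : Q →L[ℂ] Q) q)) =
        ((‖q‖ ^ 2 : ℝ) : ℂ) := by
      intro n hn
      rw [inner_sum, Finset.sum_eq_single_of_mem n hn]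
      · rw [inner_tensorVec, inner_self_eq_norm_sq_to_K, inner_self_eq_norm_sq_to_K, he.1,
          Unitary.norm_map]
        simp
      · intro m _ hmn
        rw [inner_tensorVec, he.2 (by simpa using hmn.symm), mul_zero]
    rw [Finset.sum_congr rfl this, Finset.sum_const, Finset.card_range, nsmul_eq_mul]
    simp only [RCLike.re_eq_complex_re]
    rw [← Complex.ofReal_natCast, ← Complex.ofReal_mul, Complex.ofReal_re]
    push_cast
    ring
  have hN : (0 : ℝ) < N + 1 := by positivity
  rw [folner_apply, norm_smul, Complex.norm_real, Real.norm_of_nonneg (by positivity)]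
  refine (pow_left_inj₀ (by positivity) (norm_nonneg q) two_ne_zero).mp ?_
  rw [mul_pow, h1, inv_pow, Real.sq_sqrt hN.le, ← mul_assoc, inv_mul_cancel₀ hN.ne', one_mul]

theorem ampLeft_folner (Z : unitary (Q →L[ℂ] Q)) (e : ℤ → K) (N : ℕ) {A : Q →L[ℂ] Q}
    (hA : Commute A (Z : Q →L[ℂ] Q)) (q : Q) :
    ampLeft Q K A (folner Z e N q) = folner Z e N (A q) := by
  rw [folner_apply, folner_apply, map_smul, map_sum]
  congr 1
  refine Finset.sum_congr rfl fun n _ => ?_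
  have h := mul_zpow_of_mul_eq_smul (D := Q →L[ℂ] Q) (v := Z) (b := A) (c := 1)
    (by rw [Circle.coe_one, one_smul]; exact hA) (-(n : ℤ))
  rw [one_zpow, Circle.coe_one, one_smul] at h
  rw [ampLeft_tensorVec]
  exact congrArg _ (DFunLike.congr_fun h q)

variable [CompleteSpace K]

/-- Moving `B` past `Z⁻ⁿ` costs the phase `ζ^(-ln)`, which the eigenvalue `ζ^(nl)` of `R` on `e n`
cancels term by term. The intertwining is therefore exact for each `N`. -/
theorem ampLeft_ampRight_folner (Z : unitary (Q →L[ℂ] Q)) {e : ℤ → K} (N : ℕ) {B : Q →L[ℂ] Q}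
    {R : K →L[ℂ] K} {ζ : Circle} {l : ℤ}
    (hR : ∀ n : ℤ, R (e n) = ((ζ ^ (n * l) : Circle) : ℂ) • e n)
    (hB : B * Z = ((ζ ^ l : Circle) : ℂ) • ((Z : Q →L[ℂ] Q) * B)) (q : Q) :
    ampLeft Q K B (ampRight Q K R (folner Z e N q)) = folner Z e N (B q) := by
  rw [folner_apply, folner_apply, map_smul, map_sum, map_smul, map_sum]
  congr 1
  refine Finset.sum_congr rfl fun n _ => ?_
  have h := DFunLike.congr_fun
    (mul_zpow_of_mul_eq_smul (D := Q →L[ℂ] Q) (v := Z) (b := B) hB (-(n : ℤ))) q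
  rw [mul_apply_eq_comp, _root_.smul_apply, mul_apply_eq_comp] at h
  rw [ampRight_tensorVec, ampLeft_tensorVec, h, hR, tensorVec_smul, map_smul, smul_smul,
    ← Circle.coe_mul, ← zpow_mul, ← zpow_add,
    show (n : ℤ) * l + l * -(n : ℤ) = 0 by ring, zpow_zero, Circle.coe_one, one_smul]

-- A shift on the second leg acts like `Z` on `q`: it replaces `Z⁻ⁿ q ⊗ e n` by `Z^(-(n+1)) (Z q) ⊗
-- e (n+1)`, a term of the vector belonging to `Z q`. The two sums differ only at the ends of the
-- interval, by at most `2‖q‖ / √(N+1)`.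
open Filter Topology in
theorem tendsto_shift_folner (Z : unitary (Q →L[ℂ] Q)) {e : ℤ → K} (he : ∀ n, ‖e n‖ = 1)
    (R : unitary (K →L[ℂ] K)) (hR : ∀ n : ℤ, (R : K →L[ℂ] K) (e n) = e (n + 1)) (k : ℤ) (q : Q) :
    Tendsto (fun N => ‖ampRight Q K ((R ^ k : unitary (K →L[ℂ] K)) : K →L[ℂ] K) (folner Z e N q) -
      folner Z e N (((Z ^ k : unitary (Q →L[ℂ] Q)) : Q →L[ℂ] Q) q)‖) atTop (𝓝 0) := by
  have step : ∀ q, Tendsto (fun N => ‖ampRight Q K (R : K →L[ℂ] K) (folner Z e N q) -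
      folner Z e N ((Z : Q →L[ℂ] Q) q)‖) atTop (𝓝 0) := by
    intro q
    have hbd : ∀ N : ℕ, ‖ampRight Q K (R : K →L[ℂ] K) (folner Z e N q) - folner Z e N ((Z : Q →L[ℂ] Q) q)‖ ≤
        (Real.sqrt (N + 1))⁻¹ * (2 * ‖q‖) := by
      intro N
      -- With this family the shifted vector is the sum of `g (n + 1)` and the vector of `Z q` is
      -- the sum of `g n`, so the difference telescopes to `g (N + 1) - g 0`.
      let g : ℕ → HilbertTensor Q K := fun n =>
        tensorVec (e n) (((Z ^ (1 - (n : ℤ)) : unitary (Q →L[ℂ] Q)) : Q →L[ℂ] Q) q)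
      have h1 : ampRight Q K (R : K →L[ℂ] K) (folner Z e N q) = (((Real.sqrt (N + 1))⁻¹ : ℝ) : ℂ) •
          ∑ n ∈ Finset.range (N + 1), g (n + 1) := by
        rw [folner_apply, map_smul, map_sum]
        congr 1
        refine Finset.sum_congr rfl fun n _ => ?_
        rw [ampRight_tensorVec, hR]
        simp only [g]
        push_cast
        rw [show (1 : ℤ) - (n + 1) = -n by ring]
      have h2 : folner Z e N ((Z : Q →L[ℂ] Q) q) = (((Real.sqrt (N + 1))⁻¹ : ℝ) : ℂ) •
          ∑ n ∈ Finset.range (N + 1), g n := by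
        rw [folner_apply]
        congr 1
        refine Finset.sum_congr rfl fun n _ => ?_
        simp only [g]
        rw [show (1 : ℤ) - n = -n + 1 by ring, unitary_zpow_add_apply, zpow_one]
      have hg : ∀ n, ‖g n‖ = ‖q‖ := fun n => by
        simp only [g]
        rw [norm_tensorVec, he, mul_one, Unitary.norm_map]
      rw [h1, h2, ← smul_sub, ← Finset.sum_sub_distrib, Finset.sum_range_sub, norm_smul,
        Complex.norm_real, Real.norm_of_nonneg (by positivity)]
      gcongr
      refine (norm_sub_le _ _).trans ?_
      rw [hg, hg, two_mul]
    have hlim : Tendsto (fun N : ℕ => (Real.sqrt (N + 1))⁻¹ * (2 * ‖q‖)) atTop (𝓝 0) := by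
      have h3 : Tendsto (fun N : ℕ => (Real.sqrt (N + 1))⁻¹) atTop (𝓝 0) :=
        (Real.tendsto_sqrt_atTop.comp
          (tendsto_atTop_add_const_right _ 1 tendsto_natCast_atTop_atTop)).inv_tendsto_atTop
      simpa using h3.mul_const (2 * ‖q‖)
    exact squeeze_zero (fun _ => norm_nonneg _) hbd hlim
  refine tendsto_intertwine_zpow Z (L := fun _ => HilbertTensor Q K)
    (fun _ k => (ampRight Q K ((R ^ k : unitary (K →L[ℂ] K)) : K →L[ℂ] K)).toLinearMap)
    (fun N k ξ => ?_) (fun N ξ => ?_) (fun N k l ξ => ?_) (folner Z e) (fun q => ?_) k q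
  · exact ContinuousLinearMap.norm_map_of_mem_unitary
      (Unitary.map_mem (ampRight Q K) (R ^ k : unitary (K →L[ℂ] K)).2) ξ
  · change ampRight Q K ((R ^ (0 : ℤ) : unitary (K →L[ℂ] K)) : K →L[ℂ] K) ξ = ξ
    rw [zpow_zero, OneMemClass.coe_one, map_one, one_apply_eq_self]
  · change ampRight Q K ((R ^ (k + l) : unitary (K →L[ℂ] K)) : K →L[ℂ] K) ξ =
      ampRight Q K ((R ^ k : unitary (K →L[ℂ] K)) : K →L[ℂ] K)
        (ampRight Q K ((R ^ l : unitary (K →L[ℂ] K)) : K →L[ℂ] K) ξ)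
    rw [← coe_zpow_mul, map_mul, mul_apply_eq_comp]
  · refine (step q).congr fun N => ?_
    rw [zpow_one]
    rfl

open Filter Topology in
theorem tendsto_ampLeft_shift_folner (Z : unitary (Q →L[ℂ] Q)) {e : ℤ → K} (he : ∀ n, ‖e n‖ = 1)
    (R : unitary (K →L[ℂ] K)) (hR : ∀ n : ℤ, (R : K →L[ℂ] K) (e n) = e (n + 1)) {A : Q →L[ℂ] Q}
    (hA : Commute A (Z : Q →L[ℂ] Q)) (k : ℤ) (q : Q) :
    Tendsto (fun N => ‖ampLeft Q K A
        (ampRight Q K ((R ^ k : unitary (K →L[ℂ] K)) : K →L[ℂ] K) (folner Z e N q)) -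
      folner Z e N (A (((Z ^ k : unitary (Q →L[ℂ] Q)) : Q →L[ℂ] Q) q))‖) atTop (𝓝 0) := by
  have h1 := (tendsto_shift_folner Z he R hR k q).const_mul ‖ampLeft Q K A‖
  rw [mul_zero] at h1
  refine squeeze_zero (fun _ => norm_nonneg _) (fun N => ?_) h1
  rw [← ampLeft_folner Z e N hA, ← map_sub]
  exact ContinuousLinearMap.le_opNorm _ _

end Folner

/-! ### *-homomorphisms out of braided tensor products -/

namespace BraidedTensor

variable (ζ : Circle) {X Y : Type} [CStarAlgebra X] [CStarAlgebra Y]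
  (ρX : CircleCoaction X) (ρY : CircleCoaction Y)

/-- Generating families of `X` and `Y` give one of `X ⊠_ζ Y`. -/
theorem adjoin_sumElim_eq_top {I J : Type*} {x : I → X} {y : J → Y}
    (hx : (StarAlgebra.adjoin ℂ (Set.range x)).topologicalClosure = ⊤)
    (hy : (StarAlgebra.adjoin ℂ (Set.range y)).topologicalClosure = ⊤) :
    (StarAlgebra.adjoin ℂ (Set.range (Sum.elim (fun i => j₁ ζ ρX ρY (x i))
      fun j => j₂ ζ ρX ρY (y j)))).topologicalClosure = ⊤ := by
  set T := (StarAlgebra.adjoin ℂ (Set.range (Sum.elim (fun i => j₁ ζ ρX ρY (x i))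
      fun j => j₂ ζ ρX ρY (y j)))).topologicalClosure with hT
  have hcl : IsClosed (T : Set (BraidedTensor ζ ρX ρY)) :=
    StarSubalgebra.isClosed_topologicalClosure _
  have hmem : ∀ s, Sum.elim (fun i => j₁ ζ ρX ρY (x i)) (fun j => j₂ ζ ρX ρY (y j)) s ∈ T :=
    fun s => StarSubalgebra.le_topologicalClosure _ (StarAlgebra.subset_adjoin ℂ _ ⟨s, rfl⟩)
  rw [eq_top_iff, ← adjoin_eq_top ζ ρX ρY]
  refine StarSubalgebra.topologicalClosure_minimal (StarAlgebra.adjoin_le ?_) hcl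
  rintro _ (⟨a, rfl⟩ | ⟨b, rfl⟩)
  · refine apply_mem_of_adjoin hx _ T hcl ?_ a
    rintro _ ⟨i, rfl⟩
    exact hmem (Sum.inl i)
  · refine apply_mem_of_adjoin hy _ T hcl ?_ b
    rintro _ ⟨j, rfl⟩
    exact hmem (Sum.inr j)

variable {ρX ρY}

/-! ### Spatial representations and their limits along Følner vectors -/

section Representation

open Filter Topology

variable {H K E : Type} [NormedAddCommGroup H] [InnerProductSpace ℂ H] [CompleteSpace H]
  [NormedAddCommGroup K] [InnerProductSpace ℂ K] [CompleteSpace K]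
  [NormedAddCommGroup E] [InnerProductSpace ℂ E] [CompleteSpace E]
  (π : X →⋆ₐ[ℂ] (H →L[ℂ] H)) (τ : Y →⋆ₐ[ℂ] (K →L[ℂ] K)) (ϖ : NCTorus ζ →⋆ₐ[ℂ] (E →L[ℂ] E))

variable (ρX ρY) in
/-- The representation of `X ⊠_ζ Y ⊆ X ⊗ Y ⊗ C(𝕋²_ζ)` on `H ⊗ K ⊗ E`. -/
def rep : BraidedTensor ζ ρX ρY →⋆ₐ[ℂ]
    (HilbertTensor (HilbertTensor H K) E →L[ℂ] HilbertTensor (HilbertTensor H K) E) :=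
  (MinTensor.rep (MinTensor.rep π τ) ϖ).comp (incl ζ ρX ρY)

theorem rep_j₁ {k : ℤ} {a : X} (ha : ρX.IsHomogeneous k a) :
    rep ζ ρX ρY π τ ϖ (j₁ ζ ρX ρY a) = ampLeft (HilbertTensor H K) E (ampLeft H K (π a)) *
      ampRight (HilbertTensor H K) E (ϖ ((NCTorus.U ζ ^ k : unitary (NCTorus ζ)) : NCTorus ζ)) := by
  change MinTensor.rep (MinTensor.rep π τ) ϖ (incl ζ ρX ρY (j₁ ζ ρX ρY a)) = _
  rw [incl_j₁ ζ ha, MinTensor.rep_tmul, MinTensor.rep_tmul, map_one, map_one, mul_one]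

theorem rep_j₂ {l : ℤ} {b : Y} (hb : ρY.IsHomogeneous l b) :
    rep ζ ρX ρY π τ ϖ (j₂ ζ ρX ρY b) = ampLeft (HilbertTensor H K) E (ampRight H K (τ b)) *
      ampRight (HilbertTensor H K) E (ϖ ((NCTorus.V ζ ^ l : unitary (NCTorus ζ)) : NCTorus ζ)) := by
  change MinTensor.rep (MinTensor.rep π τ) ϖ (incl ζ ρX ρY (j₂ ζ ρX ρY b)) = _
  rw [incl_j₂ ζ hb, MinTensor.rep_tmul, MinTensor.rep_tmul, map_one, map_one, one_mul]

/-- The unitary `1 ⊗ v`. -/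
def ampRightU (H : Type*) [NormedAddCommGroup H] [InnerProductSpace ℂ H] [CompleteSpace H]
    {K : Type*} [NormedAddCommGroup K] [InnerProductSpace ℂ K] [CompleteSpace K] :
    unitary (K →L[ℂ] K) →* unitary (HilbertTensor H K →L[ℂ] HilbertTensor H K) :=
  mapU (A := K →L[ℂ] K) (B := HilbertTensor H K →L[ℂ] HilbertTensor H K) (ampRight H K)

theorem coe_ampRightU_zpow (v : unitary (K →L[ℂ] K)) (k : ℤ) :
    ((ampRightU H v ^ k : unitary (HilbertTensor H K →L[ℂ] HilbertTensor H K)) :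
      HilbertTensor H K →L[ℂ] HilbertTensor H K) =
      ampRight H K ((v ^ k : unitary (K →L[ℂ] K)) : K →L[ℂ] K) := by
  rw [← map_zpow]
  rfl

/-- Here `Q = H ⊗ K` and `Z = 1 ⊗ v`. The operator `π(a) ⊗ 1` commutes with `Z`, and `U^k` on the
third leg is the `k`-fold shift, which is traded for `1 ⊗ v^k`. -/
theorem tendsto_rep_j₁ (v : unitary (K →L[ℂ] K)) {e : ℤ → E} (he : ∀ n, ‖e n‖ = 1)
    (hU : ∀ k n : ℤ, ϖ ((NCTorus.U ζ ^ k : unitary (NCTorus ζ)) : NCTorus ζ) (e n) = e (n + k))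
    {k : ℤ} {a : X} (ha : ρX.IsHomogeneous k a) (q : HilbertTensor H K) :
    Tendsto (fun N => ‖rep ζ ρX ρY π τ ϖ (j₁ ζ ρX ρY a) (folner (ampRightU H v) e N q) -
      folner (ampRightU H v) e N ((ampLeft H K (π a) *
        ampRight H K ((v ^ k : unitary (K →L[ℂ] K)) : K →L[ℂ] K)) q)‖) atTop (𝓝 0) := by
  obtain ⟨R, hR⟩ : ∃ R : unitary (E →L[ℂ] E), ∀ k : ℤ,
      ϖ ((NCTorus.U ζ ^ k : unitary (NCTorus ζ)) : NCTorus ζ) =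
        ((R ^ k : unitary (E →L[ℂ] E)) : E →L[ℂ] E) :=
    ⟨_, map_zpow_coe (B := E →L[ℂ] E) ϖ (NCTorus.U ζ)⟩
  have hR1 : ∀ n, (R : E →L[ℂ] E) (e n) = e (n + 1) := fun n => by
    have := hU 1 n
    rwa [hR, zpow_one] at this
  have hc : Commute (ampLeft H K (π a))
      (ampRightU H v : HilbertTensor H K →L[ℂ] HilbertTensor H K) := commute_amp H K _ _
  have h := tendsto_ampLeft_shift_folner (ampRightU H v) he R hR1 hc k q
  rw [coe_ampRightU_zpow, ← hR] at h
  rw [rep_j₁ ζ π τ ϖ ha]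
  exact h

/-- The covariance of `τ b` with `v` matches the eigenvalues of `V^l`, so the difference is zero for
every `N`. -/
theorem tendsto_rep_j₂ (v : unitary (K →L[ℂ] K)) {e : ℤ → E}
    (hV : ∀ l n : ℤ, ϖ ((NCTorus.V ζ ^ l : unitary (NCTorus ζ)) : NCTorus ζ) (e n) =
        ((ζ ^ (n * l) : Circle) : ℂ) • e n)
    {l : ℤ} {b : Y} (hb : ρY.IsHomogeneous l b)
    (hv : τ b * v = ((ζ ^ l : Circle) : ℂ) • ((v : K →L[ℂ] K) * τ b)) (q : HilbertTensor H K) :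
    Tendsto (fun N => ‖rep ζ ρX ρY π τ ϖ (j₂ ζ ρX ρY b) (folner (ampRightU H v) e N q) -
      folner (ampRightU H v) e N (ampRight H K (τ b) q)‖) atTop (𝓝 0) := by
  refine tendsto_const_nhds.congr fun N => ?_
  have hB : ampRight H K (τ b) * (ampRightU H v : HilbertTensor H K →L[ℂ] HilbertTensor H K) =
      ((ζ ^ l : Circle) : ℂ) • ((ampRightU H v : HilbertTensor H K →L[ℂ] HilbertTensor H K) *
        ampRight H K (τ b)) := by
    have := congrArg (ampRight H K) hv
    rwa [map_mul, map_smul, map_mul] at this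
  rw [rep_j₂ ζ π τ ϖ hb, mul_apply_eq_comp,
    ampLeft_ampRight_folner _ N (fun n => hV l n) hB, sub_self, norm_zero]

end Representation

-- The operators of `X ⊗ M` on `H ⊗ K` are limits, along the Følner isometries, of operators of `X
-- ⊠_ζ Y` on `H ⊗ K ⊗ ℓ²(ℤ)`. Working with *-polynomials in the generators avoids presupposing the
-- homomorphism that this estimate is to produce.
open Filter Topology in
theorem norm_tensorRep_lift_le {M : Type} [CStarAlgebra M] {I J : Type*} {x : I → X} {dx : I → ℤ}
    (hx : ∀ i, ρX.IsHomogeneous (dx i) (x i)) {y : J → Y} {dy : J → ℤ}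
    (hy : ∀ j, ρY.IsHomogeneous (dy j) (y j)) (v : unitary M) (φ : Y →⋆ₐ[ℂ] M)
    (hφ : ∀ j, φ (y j) * v = ((ζ ^ dy j : Circle) : ℂ) • ((v : M) * φ (y j)))
    {H K : Type} [NormedAddCommGroup H] [InnerProductSpace ℂ H] [CompleteSpace H]
    [NormedAddCommGroup K] [InnerProductSpace ℂ K] [CompleteSpace K]
    (π : X →⋆ₐ[ℂ] (H →L[ℂ] H)) (σ : M →⋆ₐ[ℂ] (K →L[ℂ] K)) (p : FreeStar (I ⊕ J)) :
    ‖tensorRep π σ (FreeStar.lift (Sum.elim (fun i => x i ⊗ₜ[ℂ] ((v ^ dx i : unitary M) : M))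
      fun j => 1 ⊗ₜ[ℂ] φ (y j)) p)‖ ≤ ‖FreeStar.lift
        (Sum.elim (fun i => j₁ ζ ρX ρY (x i)) fun j => j₂ ζ ρX ρY (y j)) p‖ := by
  obtain ⟨E, _, _, _, e, ϖ, heo, hU, hV⟩ := NCTorus.exists_rep ζ
  set f : I ⊕ J → BraidedTensor ζ ρX ρY :=
    Sum.elim (fun i => j₁ ζ ρX ρY (x i)) fun j => j₂ ζ ρX ρY (y j)
  set g : I ⊕ J → X ⊗[ℂ] M :=
    Sum.elim (fun i => x i ⊗ₜ ((v ^ dx i : unitary M) : M)) fun j => 1 ⊗ₜ φ (y j)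
  have hw : ∀ k : ℤ, σ ((v ^ k : unitary M) : M) =
      ((mapU (B := K →L[ℂ] K) σ v ^ k : unitary (K →L[ℂ] K)) : K →L[ℂ] K) :=
    map_zpow_coe (B := K →L[ℂ] K) σ v
  -- The leg `Y` is represented on the space of `M` through `φ`, so that `σ(v)` acts on the same
  -- space and is covariant with it.
  set T := rep ζ ρX ρY π (σ.comp φ) ϖ
  set Ω := folner (ampRightU H (mapU (B := K →L[ℂ] K) σ v)) e
  have key₁ : ∀ {k : ℤ} {a : X}, ρX.IsHomogeneous k a → ∀ q, Tendsto (fun N =>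
      ‖T (j₁ ζ ρX ρY a) (Ω N q) - Ω N (tensorRep π σ (a ⊗ₜ ((v ^ k : unitary M) : M)) q)‖)
        atTop (𝓝 0) := fun ha q => by
    rw [tensorRep_tmul, hw]
    exact tendsto_rep_j₁ ζ π (σ.comp φ) ϖ _ heo.1 hU ha q
  have key₂ : ∀ {l : ℤ} {b : Y}, ρY.IsHomogeneous l b →
      φ b * v = ((ζ ^ l : Circle) : ℂ) • ((v : M) * φ b) → ∀ q, Tendsto (fun N =>
      ‖T (j₂ ζ ρX ρY b) (Ω N q) - Ω N (tensorRep π σ (1 ⊗ₜ φ b) q)‖) atTop (𝓝 0) :=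
    fun {l b} hb hb' q => by
      rw [tensorRep_tmul, map_one, map_one, one_mul]
      refine tendsto_rep_j₂ ζ π (σ.comp φ) ϖ _ hV hb ?_ q
      have := congrArg σ hb'
      rwa [map_mul, map_smul, map_mul] at this
  have hgen : ∀ s q, Tendsto (fun N => ‖T (FreeStar.lift f (FreeStar.letter s)) (Ω N q) -
      Ω N (tensorRep π σ (FreeStar.lift g (FreeStar.letter s)) q)‖) atTop (𝓝 0) := by
    rintro (s | s) q
    · rw [show (FreeStar.letter (Sum.inl s) : FreeStar (I ⊕ J)) = FreeStar.gen s from rfl,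
        FreeStar.lift_gen, FreeStar.lift_gen]
      rcases s with i | j
      · exact key₁ (hx i) q
      · exact key₂ (hy j) (hφ j) q
    -- The adjoint letters are again of the two kinds, with opposite degree, so `key₁` and `key₂`
    -- apply to them as well.
    · rw [FreeStar.letter_inr, map_star (FreeStar.lift f), map_star (FreeStar.lift g),
        FreeStar.lift_gen, FreeStar.lift_gen]
      rcases s with i | j
      · have e1 : star (f (Sum.inl i)) = j₁ ζ ρX ρY (star (x i)) := (map_star _ _).symm
        have e2 : star (g (Sum.inl i)) = star (x i) ⊗ₜ ((v ^ (-dx i) : unitary M) : M) := by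
          rw [← star_coe_zpow]; exact TensorProduct.star_tmul _ _
        rw [e1, e2]
        exact key₁ (hx i).star q
      · have e1 : star (f (Sum.inr j)) = j₂ ζ ρX ρY (star (y j)) := (map_star _ _).symm
        have e2 : star (g (Sum.inr j)) = 1 ⊗ₜ φ (star (y j)) := by
          rw [map_star]
          refine (TensorProduct.star_tmul _ _).trans ?_
          rw [star_one]
        rw [e1, e2]
        refine key₂ (hy j).star ?_ q
        rw [map_star, zpow_neg]
        exact star_mul_eq_smul (hφ j)
  refine (norm_le_norm_of_tendsto_intertwine
    (AlgHom.comp (tensorRep π σ).toAlgHom (FreeStar.lift g).toAlgHom)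
    (AlgHom.comp T.toAlgHom (FreeStar.lift f).toAlgHom) Ω (norm_folner _ heo) hgen p).trans ?_
  exact NonUnitalStarAlgHom.norm_apply_le (B := HilbertTensor (HilbertTensor H K) E →L[ℂ]
    HilbertTensor (HilbertTensor H K) E) T _

/-- Let `v` be a unitary of `M` and `φ : Y → M` with `φ y * v = ζ ^ l • v * φ y` for `y` homogeneous
of degree `l`. Then there is a *-homomorphism `X ⊠_ζ Y → X ⊗ M` with `j₁ x ↦ x ⊗ v ^ k` for `x`
homogeneous of degree `k` and `j₂ y ↦ 1 ⊗ φ y`. -/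
theorem exists_hom_of_covariant {M : Type} [CStarAlgebra M] {I J : Type*} {x : I → X} {dx : I → ℤ}
    (hx : ∀ i, ρX.IsHomogeneous (dx i) (x i))
    (hgx : (StarAlgebra.adjoin ℂ (Set.range x)).topologicalClosure = ⊤) {y : J → Y} {dy : J → ℤ}
    (hy : ∀ j, ρY.IsHomogeneous (dy j) (y j))
    (hgy : (StarAlgebra.adjoin ℂ (Set.range y)).topologicalClosure = ⊤)
    (v : unitary M) (φ : Y →⋆ₐ[ℂ] M)
    (hφ : ∀ j, φ (y j) * v = ((ζ ^ dy j : Circle) : ℂ) • ((v : M) * φ (y j))) :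
    ∃ Θ : BraidedTensor ζ ρX ρY →⋆ₐ[ℂ] X ⊗min M,
      (∀ i, Θ (j₁ ζ ρX ρY (x i)) = MinTensor.tmul (x i) ((v ^ dx i : unitary M) : M)) ∧
      ∀ b, Θ (j₂ ζ ρX ρY b) = MinTensor.tmul 1 (φ b) := by
  let f : I ⊕ J → BraidedTensor ζ ρX ρY :=
    Sum.elim (fun i => j₁ ζ ρX ρY (x i)) fun j => j₂ ζ ρX ρY (y j)
  let g : I ⊕ J → X ⊗[ℂ] M :=
    Sum.elim (fun i => x i ⊗ₜ ((v ^ dx i : unitary M) : M)) fun j => 1 ⊗ₜ φ (y j)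
  obtain ⟨Θ, hΘ⟩ := exists_extension (FreeStar.lift f)
    (denseRange_lift (adjoin_sumElim_eq_top ζ ρX ρY hgx hgy))
    ((MinTensor.of (A := X) (B := M)).comp (FreeStar.lift g)) fun p => by
    rw [StarAlgHom.comp_apply, MinTensor.norm_of]
    -- The minimal norm is the supremum over all pairs `π`, `σ`, and each pair is bounded by the
    -- norm of `X ⊠_ζ Y`.
    refine CStarSeminorm.sup_le _ _ (norm_nonneg _) ?_
    rintro _ ⟨H, K, _, _, _, _, _, _, π, σ, rfl⟩
    exact norm_tensorRep_lift_le ζ hx hy v φ hφ π σ p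
  have hΘg : ∀ s, Θ (f s) = MinTensor.of (g s) := fun s => by
    have := hΘ (FreeStar.gen s)
    rwa [FreeStar.lift_gen, StarAlgHom.comp_apply, FreeStar.lift_gen] at this
  refine ⟨Θ, fun i => hΘg (Sum.inl i), fun b => ?_⟩
  refine DFunLike.congr_fun (hom_ext_of_adjoin hgy (φ := Θ.comp (j₂ ζ ρX ρY))
    (ψ := (MinTensor.inr : M →⋆ₐ[ℂ] X ⊗min M).comp φ) ?_) b
  rintro _ ⟨j, rfl⟩
  exact hΘg (Sum.inr j)

end BraidedTensor

/-! ### Coactions of the circle from scalings of generators -/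

section Fourier

/-- The `j`-th `(N + 1)`-st root of unity. -/
def rootOfUnity (N : ℕ) (j : ℕ) : Circle := Circle.exp (2 * Real.pi / (N + 1)) ^ j

/-- Orthogonality of the characters of `ℤ/(N+1)`: off the diagonal this is a geometric sum over the
powers of a nontrivial root of unity. -/
theorem sum_rootOfUnity (N : ℕ) {m n : ℕ} (hm : m ∈ Finset.range (N + 1))
    (hn : n ∈ Finset.range (N + 1)) : ∑ j : Fin (N + 1),
      starRingEnd ℂ ((rootOfUnity N j : ℂ) ^ m) * (rootOfUnity N j : ℂ) ^ n =
        if m = n then (N + 1 : ℂ) else 0 := by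
  set w : ℂ := (Circle.exp (2 * Real.pi / (N + 1)) : ℂ) with hw
  have hw0 : w ≠ 0 := Circle.coe_ne_zero _
  have hprim : IsPrimitiveRoot w (N + 1) := by
    have := Complex.isPrimitiveRoot_exp (N + 1) N.succ_ne_zero
    convert this using 1
    rw [hw, Circle.coe_exp]
    congr 1
    push_cast
    ring
  have hconj : starRingEnd ℂ w = w⁻¹ := by
    rw [hw, ← Circle.coe_inv_eq_conj, Circle.coe_inv]
  have hterm : ∀ j : ℕ, starRingEnd ℂ ((rootOfUnity N j : ℂ) ^ m) * (rootOfUnity N j : ℂ) ^ n =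
      (w ^ ((n : ℤ) - m)) ^ j := by
    intro j
    rw [rootOfUnity, Circle.coe_pow, ← hw, map_pow, map_pow, hconj, zpow_sub₀ hw0, zpow_natCast,
      zpow_natCast, div_pow, ← pow_mul, ← pow_mul, ← pow_mul, ← pow_mul, mul_comm j m, mul_comm j n,
      inv_pow, div_eq_inv_mul]
  simp only [hterm]
  rw [Fin.sum_univ_eq_sum_range (fun j => (w ^ ((n : ℤ) - m)) ^ j)]
  split_ifs with hmn
  · simp [hmn]
  · have hne : w ^ ((n : ℤ) - m) ≠ 1 := by
      intro h
      rw [hprim.zpow_eq_one_iff_dvd] at h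
      rw [Finset.mem_range] at hm hn
      obtain ⟨c, hc⟩ := h
      push_cast at hc
      have h1 : c < 1 := by
        by_contra hcc
        nlinarith
      have h2 : -1 < c := by
        by_contra hcc
        nlinarith
      have : c = 0 := by omega
      subst this
      omega
    have hpow : (w ^ ((n : ℤ) - m)) ^ (N + 1) = 1 := by
      rw [← zpow_natCast, ← zpow_mul, mul_comm, zpow_mul, zpow_natCast, hprim.pow_eq_one, one_zpow]
    rw [geom_sum_eq hne, hpow, sub_self, zero_div]

variable {Q : Type*} [NormedAddCommGroup Q] [InnerProductSpace ℂ Q]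

/-- Parseval's identity for the finite Fourier transform of vectors. -/
theorem sum_norm_sq_fourier (N : ℕ) (a : ℕ → Q) :
    ∑ j : Fin (N + 1), ‖∑ n ∈ Finset.range (N + 1), (rootOfUnity N j : ℂ) ^ n • a n‖ ^ 2 =
      (N + 1) * ∑ n ∈ Finset.range (N + 1), ‖a n‖ ^ 2 := by
  have key : (∑ j : Fin (N + 1), inner ℂ
      (∑ n ∈ Finset.range (N + 1), (rootOfUnity N j : ℂ) ^ n • a n)
      (∑ n ∈ Finset.range (N + 1), (rootOfUnity N j : ℂ) ^ n • a n)) =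
      (N + 1) * ∑ n ∈ Finset.range (N + 1), inner ℂ (a n) (a n) := by
    have hexp : ∀ j : Fin (N + 1), inner ℂ
        (∑ n ∈ Finset.range (N + 1), (rootOfUnity N j : ℂ) ^ n • a n)
        (∑ n ∈ Finset.range (N + 1), (rootOfUnity N j : ℂ) ^ n • a n) =
        ∑ m ∈ Finset.range (N + 1), ∑ n ∈ Finset.range (N + 1),
          starRingEnd ℂ ((rootOfUnity N j : ℂ) ^ m) *
            ((rootOfUnity N j : ℂ) ^ n * inner ℂ (a m) (a n)) := fun j => by
      rw [sum_inner]
      refine Finset.sum_congr rfl fun m _ => ?_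
      rw [inner_smul_left, inner_sum, Finset.mul_sum]
      refine Finset.sum_congr rfl fun n _ => ?_
      rw [inner_smul_right]
    rw [Finset.sum_congr rfl fun j _ => hexp j, Finset.sum_comm, Finset.mul_sum]
    refine Finset.sum_congr rfl fun m hm => ?_
    rw [Finset.sum_comm]
    have : ∀ n ∈ Finset.range (N + 1), (∑ j : Fin (N + 1),
        starRingEnd ℂ ((rootOfUnity N j : ℂ) ^ m) *
          ((rootOfUnity N j : ℂ) ^ n * inner ℂ (a m) (a n))) =
        if m = n then (N + 1) * inner ℂ (a m) (a n) else 0 := by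
      intro n hn
      simp only [← mul_assoc]
      rw [← Finset.sum_mul, sum_rootOfUnity N hm hn, ite_mul, zero_mul]
    rw [Finset.sum_congr rfl this, Finset.sum_ite_eq, if_pos hm]
  simp only [inner_self_eq_norm_sq_to_K] at key
  apply Complex.ofReal_injective
  push_cast
  exact key

/-- Diagonal operators on `Q ⊕ ⋯ ⊕ Q`. -/
def diagEnd (Q : Type*) [NormedAddCommGroup Q] [InnerProductSpace ℂ Q] (N : ℕ) :
    (Fin (N + 1) → (Q →L[ℂ] Q)) →ₐ[ℂ] Module.End ℂ (PiLp 2 (fun _ : Fin (N + 1) => Q)) where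
  toFun T :=
    { toFun := fun ξ => WithLp.toLp 2 fun j => T j (ξ j)
      map_add' := fun ξ η => by ext j; simp
      map_smul' := fun c ξ => by ext j; simp }
  map_one' := rfl
  map_mul' _ _ := rfl
  map_zero' := rfl
  map_add' _ _ := rfl
  commutes' _ := rfl

theorem diagEnd_apply (N : ℕ) (T : Fin (N + 1) → (Q →L[ℂ] Q))
    (ξ : PiLp 2 (fun _ : Fin (N + 1) => Q)) (j : Fin (N + 1)) : diagEnd Q N T ξ j = T j (ξ j) := rfl

theorem norm_diagEnd_le (N : ℕ) (T : Fin (N + 1) → (Q →L[ℂ] Q)) {C : ℝ} (hC : 0 ≤ C)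
    (hT : ∀ j, ‖T j‖ ≤ C) (ξ : PiLp 2 (fun _ : Fin (N + 1) => Q)) :
    ‖diagEnd Q N T ξ‖ ≤ C * ‖ξ‖ := by
  refine (pow_le_pow_iff_left₀ (norm_nonneg _) (by positivity) two_ne_zero).mp ?_
  rw [mul_pow, PiLp.norm_sq_eq_of_L2, PiLp.norm_sq_eq_of_L2, Finset.mul_sum]
  refine Finset.sum_le_sum fun j _ => ?_
  rw [diagEnd_apply, ← mul_pow]
  refine pow_le_pow_left₀ (norm_nonneg _) (((T j).le_opNorm _).trans ?_) 2
  gcongr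
  exact hT j

variable [CompleteSpace Q]

/-- The map `q ↦ ((N + 1)⁻¹ ∑_{0 ≤ n ≤ N} sⁿ t⁻ⁿ q)_s`, where `s` ranges over the roots of unity of
order `N + 1`. -/
def fourierVec (t : unitary (Q →L[ℂ] Q)) (N : ℕ) : Q →ₗ[ℂ] PiLp 2 (fun _ : Fin (N + 1) => Q) :=
  (WithLp.linearEquiv 2 ℂ (Fin (N + 1) → Q)).symm.toLinearMap ∘ₗ
    LinearMap.pi fun j => ((N + 1 : ℂ))⁻¹ • ∑ n ∈ Finset.range (N + 1),
      (rootOfUnity N j : ℂ) ^ n •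
        (((t ^ (-(n : ℤ)) : unitary (Q →L[ℂ] Q)) : Q →L[ℂ] Q) : Q →ₗ[ℂ] Q)

theorem fourierVec_apply (t : unitary (Q →L[ℂ] Q)) (N : ℕ) (q : Q) (j : Fin (N + 1)) :
    fourierVec t N q j = ((N + 1 : ℂ))⁻¹ • ∑ n ∈ Finset.range (N + 1),
      (rootOfUnity N j : ℂ) ^ n • ((t ^ (-(n : ℤ)) : unitary (Q →L[ℂ] Q)) : Q →L[ℂ] Q) q := by
  change (((N + 1 : ℂ))⁻¹ • ∑ n ∈ Finset.range (N + 1), (rootOfUnity N j : ℂ) ^ n •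
    (((t ^ (-(n : ℤ)) : unitary (Q →L[ℂ] Q)) : Q →L[ℂ] Q) : Q →ₗ[ℂ] Q)) q = _
  rw [LinearMap.smul_apply, LinearMap.sum_apply]
  rfl

theorem norm_inv_natCast_add_one (N : ℕ) : ‖((N + 1 : ℂ))⁻¹‖ = ((N : ℝ) + 1)⁻¹ := by
  rw [norm_inv, show (N + 1 : ℂ) = ((N + 1 : ℕ) : ℂ) by push_cast; rfl, Complex.norm_natCast]
  push_cast
  rfl

/-- Parseval gives `(N+1)⁻² · (N+1) · ∑ ‖t⁻ⁿ q‖²`, and the sum has `N + 1` terms equal to `‖q‖²`. -/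
theorem norm_fourierVec (t : unitary (Q →L[ℂ] Q)) (N : ℕ) (q : Q) : ‖fourierVec t N q‖ = ‖q‖ := by
  refine (pow_left_inj₀ (norm_nonneg _) (norm_nonneg q) two_ne_zero).mp ?_
  rw [PiLp.norm_sq_eq_of_L2]
  simp only [fourierVec_apply, norm_smul, mul_pow, norm_inv_natCast_add_one]
  rw [← Finset.mul_sum, sum_norm_sq_fourier]
  simp only [Unitary.norm_map]
  rw [Finset.sum_const, Finset.card_range, nsmul_eq_mul]
  have : (N : ℝ) + 1 ≠ 0 := by positivity
  push_cast
  field_simp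

theorem ofLp_fourierVec_commute (t : unitary (Q →L[ℂ] Q)) (N : ℕ) {A : Q →L[ℂ] Q}
    (hA : Commute A (t : Q →L[ℂ] Q)) (q : Q) (j : Fin (N + 1)) :
    A (fourierVec t N q j) = fourierVec t N (A q) j := by
  rw [fourierVec_apply, fourierVec_apply, map_smul, map_sum]
  congr 1
  refine Finset.sum_congr rfl fun n _ => ?_
  have h := mul_zpow_of_mul_eq_smul (D := Q →L[ℂ] Q) (v := t) (b := A) (c := 1)
    (by rw [Circle.coe_one, one_smul]; exact hA) (-(n : ℤ))
  rw [one_zpow, Circle.coe_one, one_smul] at h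
  rw [map_smul]
  exact congrArg _ (DFunLike.congr_fun h q)

-- Multiplying the component at `s` by `s` turns `sⁿ t⁻ⁿ q` into `s^(n+1) t^(-(n+1)) (t q)`. Thus
-- the scalars `s^k` stand in for `t^k`, up to boundary terms, while `A` passes through exactly.
open Filter Topology in
theorem tendsto_fourierVec (t : unitary (Q →L[ℂ] Q)) {A : Q →L[ℂ] Q}
    (hA : Commute A (t : Q →L[ℂ] Q)) (k : ℤ) (q : Q) :
    Tendsto (fun N => ‖diagEnd Q N (fun j => ((rootOfUnity N j ^ k : Circle) : ℂ) • A)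
        (fourierVec t N q) -
      fourierVec t N ((A * ((t ^ k : unitary (Q →L[ℂ] Q)) : Q →L[ℂ] Q)) q)‖) atTop (𝓝 0) := by
  let D : ∀ N, ℤ → Module.End ℂ (PiLp 2 (fun _ : Fin (N + 1) => Q)) := fun N k =>
    diagEnd Q N fun j => ((rootOfUnity N j ^ k : Circle) : ℂ) • 1
  have hD : ∀ N k ξ j, D N k ξ j = ((rootOfUnity N j ^ k : Circle) : ℂ) • ξ j := fun _ _ _ _ => rfl
  have step : ∀ q, Tendsto (fun N => ‖D N 1 (fourierVec t N q) -
      fourierVec t N ((t : Q →L[ℂ] Q) q)‖) atTop (𝓝 0) := by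
    intro q
    have hbd : ∀ N : ℕ, ‖D N 1 (fourierVec t N q) - fourierVec t N ((t : Q →L[ℂ] Q) q)‖ ≤
        (Real.sqrt (N + 1))⁻¹ * (2 * ‖q‖) := by
      intro N
      -- Each component telescopes to two terms, giving `2‖q‖ / (N+1)`. Summing squares over `N + 1`
      -- components yields `2‖q‖ / √(N+1)` in the `ℓ²` norm.
      have hj : ∀ j, ‖(D N 1 (fourierVec t N q) - fourierVec t N ((t : Q →L[ℂ] Q) q)) j‖ ≤
          ((N : ℝ) + 1)⁻¹ * (2 * ‖q‖) := by
        intro j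
        let g : ℕ → Q := fun n => (rootOfUnity N j : ℂ) ^ n •
          ((t ^ (1 - (n : ℤ)) : unitary (Q →L[ℂ] Q)) : Q →L[ℂ] Q) q
        have h1 : D N 1 (fourierVec t N q) j = ((N + 1 : ℂ))⁻¹ •
            ∑ n ∈ Finset.range (N + 1), g (n + 1) := by
          rw [hD, fourierVec_apply, smul_comm, Finset.smul_sum]
          congr 1
          refine Finset.sum_congr rfl fun n _ => ?_
          simp only [g]
          push_cast
          rw [show (1 : ℤ) - (n + 1) = -n by ring, zpow_one, smul_smul, pow_succ']
        have h2 : fourierVec t N ((t : Q →L[ℂ] Q) q) j = ((N + 1 : ℂ))⁻¹ •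
            ∑ n ∈ Finset.range (N + 1), g n := by
          rw [fourierVec_apply]
          congr 1
          refine Finset.sum_congr rfl fun n _ => ?_
          simp only [g]
          rw [show (1 : ℤ) - n = -n + 1 by ring, unitary_zpow_add_apply, zpow_one]
        have hg : ∀ n, ‖g n‖ = ‖q‖ := fun n => by
          simp only [g]
          rw [norm_smul, norm_pow, Circle.norm_coe, one_pow, one_mul, Unitary.norm_map]
        rw [PiLp.sub_apply, h1, h2, ← smul_sub, ← Finset.sum_sub_distrib, Finset.sum_range_sub,
          norm_smul, norm_inv_natCast_add_one]
        gcongr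
        refine (norm_sub_le _ _).trans ?_
        rw [hg, hg, two_mul]
      have hN : (0 : ℝ) < N + 1 := by positivity
      refine (pow_le_pow_iff_left₀ (norm_nonneg _) (by positivity) two_ne_zero).mp ?_
      rw [PiLp.norm_sq_eq_of_L2]
      refine (Finset.sum_le_sum fun j _ => pow_le_pow_left₀ (norm_nonneg _) (hj j) 2).trans ?_
      rw [Finset.sum_const, Finset.card_univ, Fintype.card_fin, nsmul_eq_mul]
      simp only [mul_pow, inv_pow, Real.sq_sqrt hN.le]
      push_cast
      apply le_of_eq
      field_simp
    have hlim : Tendsto (fun N : ℕ => (Real.sqrt (N + 1))⁻¹ * (2 * ‖q‖)) atTop (𝓝 0) := by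
      have h3 : Tendsto (fun N : ℕ => (Real.sqrt (N + 1))⁻¹) atTop (𝓝 0) :=
        (Real.tendsto_sqrt_atTop.comp
          (tendsto_atTop_add_const_right _ 1 tendsto_natCast_atTop_atTop)).inv_tendsto_atTop
      simpa using h3.mul_const (2 * ‖q‖)
    exact squeeze_zero (fun _ => norm_nonneg _) hbd hlim
  have hk := tendsto_intertwine_zpow t D (fun N k ξ => by
      refine (pow_left_inj₀ (norm_nonneg _) (norm_nonneg _) two_ne_zero).mp ?_
      rw [PiLp.norm_sq_eq_of_L2, PiLp.norm_sq_eq_of_L2]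
      simp only [hD, norm_smul, Circle.norm_coe, one_mul])
    (fun N ξ => by
      ext j
      rw [hD, zpow_zero, Circle.coe_one, one_smul])
    (fun N k l ξ => by
      ext j
      rw [hD, hD, hD, zpow_add, Circle.coe_mul, smul_smul])
    (fourierVec t) step k q
  have h1 := hk.const_mul ‖A‖
  rw [mul_zero] at h1
  refine squeeze_zero (fun _ => norm_nonneg _) (fun N => ?_) h1
  refine le_trans (le_of_eq ?_)
    (norm_diagEnd_le N (fun _ => A) (norm_nonneg A) (fun _ => le_rfl) _)
  congr 1
  ext j
  rw [diagEnd_apply, PiLp.sub_apply, PiLp.sub_apply, map_sub, hD, map_smul,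
    mul_apply_eq_comp, ofLp_fourierVec_commute t N hA]
  congr 1
  · rw [diagEnd_apply, _root_.smul_apply, ofLp_fourierVec_commute t N hA]
  · exact (ofLp_fourierVec_commute t N hA _ j).symm

end Fourier

/-! ### Coactions from contractive scalings -/

section Coaction

variable {Z W : Type} [CStarAlgebra Z] {f : W → Z} {deg : W → ℤ}

-- Morally an element of `Z ⊗ C(𝕋)` is a function on `𝕋`, and the coaction sends `x` to `s ↦
-- α_s(x)`, each value of which has norm at most `‖x‖`. The Fourier vectors realize this without
-- identifying `Z ⊗ C(𝕋)` with functions: `π(f w) ⊗ σ(z)^(deg w)` is a limit of diagonal operators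
-- with entries `π(s^(deg w) f w) ⊗ 1`, where `s` runs over roots of unity.
open Filter Topology in
theorem norm_tensorRep_lift_scale_le
    (hs : ∀ (s : Circle) p, ‖FreeStar.lift (fun w => ((s ^ deg w : Circle) : ℂ) • f w) p‖ ≤
      ‖FreeStar.lift f p‖)
    {H K : Type} [NormedAddCommGroup H] [InnerProductSpace ℂ H] [CompleteSpace H]
    [NormedAddCommGroup K] [InnerProductSpace ℂ K] [CompleteSpace K]
    (π : Z →⋆ₐ[ℂ] (H →L[ℂ] H)) (σ : CT →⋆ₐ[ℂ] (K →L[ℂ] K)) (p : FreeStar W) :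
    ‖tensorRep π σ (FreeStar.lift (fun w => f w ⊗ₜ[ℂ] ((coordZ ^ deg w : unitary CT) : CT)) p)‖ ≤
      ‖FreeStar.lift f p‖ := by
  set g : W → Z ⊗[ℂ] CT := fun w => f w ⊗ₜ[ℂ] ((coordZ ^ deg w : unitary CT) : CT)
  set t := BraidedTensor.ampRightU H (mapU (B := K →L[ℂ] K) σ coordZ)
  have ht : ∀ k : ℤ, ampRight H K (σ ((coordZ ^ k : unitary CT) : CT)) =
      ((t ^ k : unitary (HilbertTensor H K →L[ℂ] HilbertTensor H K)) :
        HilbertTensor H K →L[ℂ] HilbertTensor H K) := fun k => by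
    rw [BraidedTensor.coe_ampRightU_zpow]
    exact congrArg _ (map_zpow_coe (B := K →L[ℂ] K) σ coordZ k)
  let a : Circle → FreeStar W →⋆ₐ[ℂ] Z := fun s =>
    FreeStar.lift (fun w => ((s ^ deg w : Circle) : ℂ) • f w)
  let πH : Z →⋆ₐ[ℂ] (HilbertTensor H K →L[ℂ] HilbertTensor H K) := (ampLeft H K).comp π
  have hπ : ∀ z, ‖πH z‖ ≤ ‖z‖ := fun z =>
    NonUnitalStarAlgHom.norm_apply_le (B := HilbertTensor H K →L[ℂ] HilbertTensor H K) πH z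
  have key : ∀ (k : ℤ) (z : Z) q, Tendsto (fun N =>
      ‖diagEnd (HilbertTensor H K) N (fun j => πH (((rootOfUnity N j ^ k : Circle) : ℂ) • z))
        (fourierVec t N q) -
      fourierVec t N (tensorRep π σ (z ⊗ₜ ((coordZ ^ k : unitary CT) : CT)) q)‖) atTop (𝓝 0) := by
    intro k z q
    have hc : Commute (πH z) (t : HilbertTensor H K →L[ℂ] HilbertTensor H K) := commute_amp H K _ _
    have h := tendsto_fourierVec t hc k q
    simp only [← map_smul] at h
    rw [tensorRep_tmul, ht]
    exact h
  -- The entry at `s` of the diagonal operator is the polynomial evaluated at the scaled generators;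
  -- `hs` bounds all entries by `‖FreeStar.lift f p‖`, uniformly in `N`.
  refine norm_le_of_tendsto_intertwine
    (AlgHom.comp (tensorRep π σ).toAlgHom (FreeStar.lift g).toAlgHom)
    (fun N => (diagEnd (HilbertTensor H K) N).comp
      (AlgHom.pi fun j => AlgHom.comp πH.toAlgHom (a (rootOfUnity N j)).toAlgHom))
    (fun p => ‖FreeStar.lift f p‖) (fun N p ξ => ?_) (fourierVec t) (norm_fourierVec t)
    (fun y q => ?_) p (norm_nonneg _)
  · exact norm_diagEnd_le N (fun j => πH (a (rootOfUnity N j) p)) (norm_nonneg _)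
      (fun j => (hπ _).trans (hs _ p)) ξ
  · change Tendsto (fun N => ‖diagEnd (HilbertTensor H K) N
      (fun j => πH (a (rootOfUnity N j) (FreeStar.letter y))) (fourierVec t N q) -
      fourierVec t N (tensorRep π σ (FreeStar.lift g (FreeStar.letter y)) q)‖) atTop (𝓝 0)
    rcases y with w | w
    · have e1 : ∀ s, a s (FreeStar.letter (Sum.inl w)) = ((s ^ deg w : Circle) : ℂ) • f w :=
        fun s => FreeStar.lift_gen _ w
      have e2 : FreeStar.lift g (FreeStar.letter (Sum.inl w)) = g w := FreeStar.lift_gen _ w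
      simp only [e1, e2]
      exact key (deg w) (f w) q
    · have e1 : ∀ s, a s (FreeStar.letter (Sum.inr w)) =
          ((s ^ (-deg w) : Circle) : ℂ) • star (f w) := fun s => by
        rw [FreeStar.letter_inr, map_star, FreeStar.lift_gen, star_smul, zpow_neg,
          Circle.coe_inv_eq_conj]
        rfl
      have e2 : FreeStar.lift g (FreeStar.letter (Sum.inr w)) =
          star (f w) ⊗ₜ ((coordZ ^ (-deg w) : unitary CT) : CT) := by
        rw [FreeStar.letter_inr, map_star (FreeStar.lift g), FreeStar.lift_gen, ← star_coe_zpow]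
        exact TensorProduct.star_tmul _ _
      simp only [e1, e2]
      exact key (-deg w) (star (f w)) q

/-- If the scalings `f w ↦ s ^ deg w • f w` of a generating family are contractive for all `s ∈ 𝕋`,
then there is a coaction of `C(𝕋)` for which `f w` is homogeneous of degree `deg w`. -/
theorem CircleCoaction.exists_of_scale
    (hf : (StarAlgebra.adjoin ℂ (Set.range f)).topologicalClosure = ⊤)
    (hs : ∀ (s : Circle) p, ‖FreeStar.lift (fun w => ((s ^ deg w : Circle) : ℂ) • f w) p‖ ≤
      ‖FreeStar.lift f p‖) :
    ∃ ρ : CircleCoaction Z, ∀ w, ρ.IsHomogeneous (deg w) (f w) := by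
  obtain ⟨ρ, hρ⟩ := exists_extension (FreeStar.lift f) (denseRange_lift hf)
    ((MinTensor.of (A := Z) (B := CT)).comp
      (FreeStar.lift (fun w => f w ⊗ₜ[ℂ] ((coordZ ^ deg w : unitary CT) : CT)))) fun p => by
    rw [StarAlgHom.comp_apply, MinTensor.norm_of]
    refine CStarSeminorm.sup_le _ _ (norm_nonneg _) ?_
    rintro _ ⟨H, K, _, _, _, _, _, _, π, σ, rfl⟩
    exact norm_tensorRep_lift_scale_le hs π σ p
  have hρf : ∀ w, ρ (f w) = MinTensor.tmul (f w) ((coordZ ^ deg w : unitary CT) : CT) := fun w => by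
    have := hρ (FreeStar.gen w)
    rwa [FreeStar.lift_gen, StarAlgHom.comp_apply, FreeStar.lift_gen] at this
  refine ⟨⟨ρ, ?_⟩, hρf⟩
  set S := Submodule.span ℂ {x : Z | ∃ k : ℤ,
    ρ x = MinTensor.tmul x ((coordZ ^ k : unitary CT) : CT)} with hS
  -- Words in the letters are homogeneous because degrees add under products and change sign under
  -- adjoints. Hence every *-polynomial in the generators is a sum of homogeneous elements.
  have h1 : ∀ a : FreeStar W, FreeStar.lift f a ∈ S := by
    intro a
    refine FreeStar.induction (P := fun a => FreeStar.lift f a ∈ S)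
      (fun c => ?_) (fun y => ?_) (fun a b ha hb => ?_) (fun a b ha hb => ?_) a
    · rw [AlgHomClass.commutes, Algebra.algebraMap_eq_smul_one]
      refine Submodule.smul_mem _ _ (Submodule.subset_span ⟨0, ?_⟩)
      rw [zpow_zero, map_one]
      exact MinTensor.tmul_one_one.symm
    · rcases y with w | w
      · exact Submodule.subset_span ⟨deg w, by
          rw [show (FreeStar.letter (Sum.inl w) : FreeStar W) = FreeStar.gen w from rfl,
            FreeStar.lift_gen, hρf]⟩
      · refine Submodule.subset_span ⟨-deg w, ?_⟩
        rw [FreeStar.letter_inr, map_star (FreeStar.lift f), FreeStar.lift_gen, map_star, hρf,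
          MinTensor.star_tmul, star_coe_zpow]
    · rw [map_mul]
      have h := Submodule.mul_mem_mul ha hb
      rw [hS, Submodule.span_mul_span] at h
      refine Submodule.span_mono ?_ h
      rintro _ ⟨x, ⟨k, hx⟩, y, ⟨l, hy⟩, rfl⟩
      refine ⟨k + l, ?_⟩
      change ρ (x * y) = MinTensor.tmul (x * y) _
      rw [map_mul, hx, hy, MinTensor.tmul_mul_tmul, coe_zpow_mul]
    · rw [map_add]; exact add_mem ha hb
  rw [eq_top_iff]
  intro x _
  refine closure_mono ?_ (denseRange_lift hf x)
  rintro _ ⟨a, rfl⟩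
  exact h1 a

end Coaction

/-! ### The coaction on a braided tensor product -/

namespace BraidedTensor

variable (ζ : Circle) {X Y : Type} [CStarAlgebra X] [CStarAlgebra Y]
  {ρX : CircleCoaction X} {ρY : CircleCoaction Y}

/-- The automorphism `U ↦ s U`, `V ↦ s V` of the noncommutative torus. -/
def torusScale (s : Circle) : NCTorus ζ →⋆ₐ[ℂ] NCTorus ζ :=
  NCTorus.lift (NCTorus.scalarU s * NCTorus.U ζ) (NCTorus.scalarU s * NCTorus.V ζ) (by
    change ((s : ℂ) • (1 : NCTorus ζ) * NCTorus.V ζ) * ((s : ℂ) • (1 : NCTorus ζ) * NCTorus.U ζ) =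
      (ζ : ℂ) • (((s : ℂ) • (1 : NCTorus ζ) * NCTorus.U ζ) *
        ((s : ℂ) • (1 : NCTorus ζ) * NCTorus.V ζ))
    rw [smul_one_mul, smul_one_mul, smul_mul_smul_comm, smul_mul_smul_comm, NCTorus.V_mul_U,
      smul_smul, smul_smul, mul_comm])

theorem coe_scalarU_mul_zpow {D : Type*} [CStarAlgebra D] (s : Circle) (v : unitary D) (k : ℤ) :
    (((NCTorus.scalarU s * v) ^ k : unitary D) : D) =
      ((s ^ k : Circle) : ℂ) • ((v ^ k : unitary D) : D) := by
  rw [(NCTorus.commute_scalarU s v).mul_zpow, ← map_zpow]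
  change ((s ^ k : Circle) : ℂ) • (1 : D) * _ = _
  rw [smul_one_mul]

/-- The coaction on `X ⊠_ζ Y` for which generating families are homogeneous. -/
theorem exists_coaction {I J : Type} {x : I → X} {dx : I → ℤ}
    (hx : ∀ i, ρX.IsHomogeneous (dx i) (x i))
    (hgx : (StarAlgebra.adjoin ℂ (Set.range x)).topologicalClosure = ⊤) {y : J → Y} {dy : J → ℤ}
    (hy : ∀ j, ρY.IsHomogeneous (dy j) (y j))
    (hgy : (StarAlgebra.adjoin ℂ (Set.range y)).topologicalClosure = ⊤) :
    ∃ ρ : CircleCoaction (BraidedTensor ζ ρX ρY), IsBraidedCoaction ζ ρX ρY ρ := by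
  let f : I ⊕ J → BraidedTensor ζ ρX ρY :=
    Sum.elim (fun i => j₁ ζ ρX ρY (x i)) fun j => j₂ ζ ρX ρY (y j)
  obtain ⟨ρ, hρ⟩ := CircleCoaction.exists_of_scale (f := f) (deg := Sum.elim dx dy)
    (adjoin_sumElim_eq_top ζ ρX ρY hgx hgy) fun s p => by
    -- An element of degree `k` carries `U^k` or `V^k` in its torus leg, so scaling both `U` and `V`
    -- by `s` multiplies it by `s^k`. Contractivity of the scaling is that of the *-homomorphism `γ`
    -- on the ambient algebra.
    set γ := MinTensor.map (StarAlgHom.id ℂ (X ⊗min Y)) (torusScale ζ s)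
    have hcomp : (incl ζ ρX ρY).comp
          (FreeStar.lift fun w => ((s ^ Sum.elim dx dy w : Circle) : ℂ) • f w) =
        (γ.comp (incl ζ ρX ρY)).comp (FreeStar.lift f) := by
      refine FreeStar.hom_ext fun w => ?_
      rw [StarAlgHom.comp_apply, StarAlgHom.comp_apply, StarAlgHom.comp_apply, FreeStar.lift_gen,
        FreeStar.lift_gen, map_smul]
      rcases w with i | j
      · change ((s ^ dx i : Circle) : ℂ) • incl ζ ρX ρY (j₁ ζ ρX ρY (x i)) =
          γ (incl ζ ρX ρY (j₁ ζ ρX ρY (x i)))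
        rw [incl_j₁ ζ (hx i), MinTensor.map_tmul, torusScale, NCTorus.lift_U_zpow,
          coe_scalarU_mul_zpow, MinTensor.tmul_smul]
        rfl
      · change ((s ^ dy j : Circle) : ℂ) • incl ζ ρX ρY (j₂ ζ ρX ρY (y j)) =
          γ (incl ζ ρX ρY (j₂ ζ ρX ρY (y j)))
        rw [incl_j₂ ζ (hy j), MinTensor.map_tmul, torusScale, NCTorus.lift_V_zpow,
          coe_scalarU_mul_zpow, MinTensor.tmul_smul]
        rfl
    have h1 := DFunLike.congr_fun hcomp p
    rw [StarAlgHom.comp_apply, StarAlgHom.comp_apply, StarAlgHom.comp_apply] at h1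
    calc ‖FreeStar.lift (fun w => ((s ^ Sum.elim dx dy w : Circle) : ℂ) • f w) p‖
        = ‖incl ζ ρX ρY (FreeStar.lift
            (fun w => ((s ^ Sum.elim dx dy w : Circle) : ℂ) • f w) p)‖ := rfl
      _ = ‖γ (incl ζ ρX ρY (FreeStar.lift f p))‖ := by rw [h1]
      _ ≤ ‖incl ζ ρX ρY (FreeStar.lift f p)‖ := NonUnitalStarAlgHom.norm_apply_le γ _
      _ = _ := rfl
  refine ⟨ρ, hom_ext_of_adjoin hgx ?_, hom_ext_of_adjoin hgy ?_⟩
  · rintro _ ⟨i, rfl⟩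
    have h1 : ρ.coact (j₁ ζ ρX ρY (x i)) = _ := hρ (Sum.inl i)
    rw [StarAlgHom.comp_apply, StarAlgHom.comp_apply, h1, hx i, MinTensor.map_tmul]
    rfl
  · rintro _ ⟨j, rfl⟩
    have h1 : ρ.coact (j₂ ζ ρX ρY (y j)) = _ := hρ (Sum.inr j)
    rw [StarAlgHom.comp_apply, StarAlgHom.comp_apply, h1, hy j, MinTensor.map_tmul]
    rfl

end BraidedTensor

/-! ### The bosonization -/

theorem adjoin_coordZ_eq_top :
    (StarAlgebra.adjoin ℂ (Set.range fun _ : Unit => (coordZ : CT))).topologicalClosure = ⊤ := by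
  refine ContinuousMap.starSubalgebra_topologicalClosure_eq_top_of_separatesPoints _ ?_
  intro x y hxy
  exact ⟨_, ⟨_, StarAlgebra.subset_adjoin ℂ _ ⟨(), rfl⟩, rfl⟩, fun h => hxy (Subtype.ext h)⟩

theorem AlgU.adjoin_eq_top {n : ℕ} (ζ : Circle) (F : GL (Fin n) ℂ) (d : Fin n → ℤ) :
    (StarAlgebra.adjoin ℂ (Set.range fun p : Fin n × Fin n =>
      AlgU.u ζ F d p.1 p.2)).topologicalClosure = ⊤ := by
  set T := StarAlgebra.adjoin ℂ (Set.range fun p : Fin n × Fin n => AlgU.u ζ F d p.1 p.2)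
  have hmem : ∀ p, AlgU.of ζ F d (FreeStar.gen p) ∈ T := fun p =>
    StarAlgebra.subset_adjoin ℂ _ ⟨p, rfl⟩
  have h1 : ∀ a : FreeStar (Fin n × Fin n), AlgU.of ζ F d a ∈ T := by
    intro a
    refine FreeStar.induction (P := fun a => AlgU.of ζ F d a ∈ T)
      (fun c => ?_) (fun y => ?_) (fun a b ha hb => ?_) (fun a b ha hb => ?_) a
    · rw [AlgHomClass.commutes]; exact T.algebraMap_mem c
    · rcases y with p | p
      · exact hmem p
      · rw [FreeStar.letter_inr, map_star]; exact star_mem (hmem p)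
    · rw [map_mul]; exact mul_mem ha hb
    · rw [map_add]; exact add_mem ha hb
  rw [eq_top_iff]
  intro x _
  refine closure_mono ?_ (AlgU.denseRange_of ζ F d x)
  rintro _ ⟨a, rfl⟩
  exact h1 a

/-- `C(𝕋) ⊠_ζ Y` is universal for covariant pairs. -/
theorem exists_hom_of_covariant_circle (ζ : Circle) {Y M : Type} [CStarAlgebra Y] [CStarAlgebra M]
    {ρY : CircleCoaction Y} {J : Type*} {y : J → Y} {dy : J → ℤ}
    (hy : ∀ j, ρY.IsHomogeneous (dy j) (y j))
    (hgy : (StarAlgebra.adjoin ℂ (Set.range y)).topologicalClosure = ⊤)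
    (v : unitary M) (φ : Y →⋆ₐ[ℂ] M)
    (hφ : ∀ j, φ (y j) * v = ((ζ ^ dy j : Circle) : ℂ) • ((v : M) * φ (y j))) :
    ∃ Θ : BraidedTensor ζ coactionT ρY →⋆ₐ[ℂ] M,
      Θ (BraidedTensor.j₁ ζ coactionT ρY (coordZ : CT)) = v ∧
      ∀ b, Θ (BraidedTensor.j₂ ζ coactionT ρY b) = φ b := by
  obtain ⟨Θ, h1, h2⟩ := BraidedTensor.exists_hom_of_covariant ζ (ρX := coactionT) (I := Unit)
    (fun _ => coactionT_isHomogeneous) adjoin_coordZ_eq_top hy hgy v φ hφ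
  -- The homomorphism into `C(𝕋) ⊗ M` sends `z` to `z ⊗ v`; the character with `z ↦ 1` strips the
  -- superfluous leg.
  obtain ⟨s, hs⟩ := MinTensor.exists_slice (A := CT) (B := M) (circleHom (1 : unitary ℂ))
  refine ⟨s.comp Θ, ?_, fun b => ?_⟩
  · rw [StarAlgHom.comp_apply, h1 (), hs, circleHom_coordZ, OneMemClass.coe_one, one_smul, zpow_one]
  · rw [StarAlgHom.comp_apply, h2, hs, map_one, one_smul]

section

variable {n : ℕ} (ζ : Circle) {F : GL (Fin n) ℂ} {d d' : Fin n → ℤ} {δ : ℤ}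

/-! ### Generators and relations of the bosonization -/

namespace Bosonization

variable (hF : Admissible F d d' δ)

theorem u_apply (i j : Fin n) : u ζ hF i j = ι ζ hF (AlgU.u ζ F d i j) := rfl

theorem coe_z : (z ζ hF : Bosonization ζ hF) =
    BraidedTensor.j₁ ζ coactionT (AlgU.coaction ζ hF) (coordZ : CT) := rfl

/-- The braided commutation relation for `z` of degree `1` and `u i j` of degree `d j - d i`. -/
theorem u_mul_z (i j : Fin n) : u ζ hF i j * z ζ hF =
    ((ζ ^ (d j - d i) : Circle) : ℂ) • ((z ζ hF : Bosonization ζ hF) * u ζ hF i j) := by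
  have h := BraidedTensor.j₂_mul_j₁ ζ coactionT_isHomogeneous (AlgU.isHomogeneous_u ζ hF i j)
  rwa [mul_one] at h

theorem rels : BosonizationRels ζ F d (z ζ hF : Bosonization ζ hF) (u ζ hF) := by
  refine ⟨(z ζ hF).2, fun i j => ?_, (AlgU.isUnitaryPair_u ζ F d).map _⟩
  rw [u_mul_z, smul_smul, ← Circle.coe_mul, ← zpow_add, show d i - d j + (d j - d i) = 0 by ring,
    zpow_zero, Circle.coe_one, one_smul]

theorem adjoin_eq_top : (StarAlgebra.adjoin ℂ ({(z ζ hF : Bosonization ζ hF)} ∪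
    {x | ∃ i j, x = u ζ hF i j})).topologicalClosure = ⊤ := by
  rw [eq_top_iff, ← BraidedTensor.adjoin_sumElim_eq_top ζ coactionT (AlgU.coaction ζ hF)
    adjoin_coordZ_eq_top (AlgU.adjoin_eq_top ζ F d)]
  refine StarSubalgebra.topologicalClosure_mono (StarAlgebra.adjoin_mono ?_)
  rintro _ ⟨i | p, rfl⟩
  · exact Or.inl rfl
  · exact Or.inr ⟨p.1, p.2, rfl⟩

theorem hom_ext {D : Type*} [CStarAlgebra D] {φ ψ : Bosonization ζ hF →⋆ₐ[ℂ] D}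
    (hz : φ (z ζ hF) = ψ (z ζ hF)) (hu : ∀ i j, φ (u ζ hF i j) = ψ (u ζ hF i j)) : φ = ψ := by
  refine hom_ext_of_adjoin (adjoin_eq_top ζ hF) ?_
  rintro _ (rfl | ⟨i, j, rfl⟩)
  exacts [hz, hu i j]

theorem mul_z_of_rels {D : Type*} [CStarAlgebra D] {z : D} {u : Matrix (Fin n) (Fin n) D}
    (h : BosonizationRels ζ F d z u) (i j : Fin n) :
    u i j * z = ((ζ ^ (d j - d i) : Circle) : ℂ) • (z * u i j) := by
  rw [h.2.1, smul_smul, ← Circle.coe_mul, ← zpow_add, show d j - d i + (d i - d j) = 0 by ring,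
    zpow_zero, Circle.coe_one, one_smul]

/-- The relations on `u'` define a map on `A`, and the one with `z'` makes it covariant; these are
the data needed for a map out of `C(𝕋) ⊠_ζ A`. The target has to live in `Type`, as minimal tensor
products do. -/
theorem exists_lift_small {D : Type} [CStarAlgebra D] {z' : D} {u' : Matrix (Fin n) (Fin n) D}
    (h : BosonizationRels ζ F d z' u') : ∃ φ : Bosonization ζ hF →⋆ₐ[ℂ] D,
      φ (z ζ hF) = z' ∧ ∀ i j, φ (u ζ hF i j) = u' i j := by
  obtain ⟨Θ, h1, h2⟩ := exists_hom_of_covariant_circle ζ (ρY := AlgU.coaction ζ hF)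
    (y := fun p : Fin n × Fin n => AlgU.u ζ F d p.1 p.2) (dy := fun p => d p.2 - d p.1)
    (fun p => AlgU.isHomogeneous_u ζ hF p.1 p.2) (AlgU.adjoin_eq_top ζ F d) ⟨z', h.1⟩
    (AlgU.lift u' h.2.2) (fun p => by
      rw [AlgU.lift_u]
      exact mul_z_of_rels ζ h p.1 p.2)
  exact ⟨Θ, h1, fun i j => (h2 _).trans (AlgU.lift_u u' h.2.2 i j)⟩

/-- The universal property of the bosonization. -/
theorem exists_lift.{w} {D : Type w} [CStarAlgebra D] {z' : D} {u' : Matrix (Fin n) (Fin n) D}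
    (h : BosonizationRels ζ F d z' u') : ∃ φ : Bosonization ζ hF →⋆ₐ[ℂ] D,
      φ (z ζ hF) = z' ∧ ∀ i j, φ (u ζ hF i j) = u' i j := by
  -- The finitely many elements `z'` and `u' i j` lie in a copy inside `D` of a C*-algebra in
  -- `Type`. Its embedding `j` is injective, so the relations can be checked after applying it.
  obtain ⟨D₀, _, j, g, hj, hg⟩ := exists_small_cstar
    (fun o : Option (Fin n × Fin n) => o.elim z' fun p => u' p.1 p.2)
  have hz : j (g none) = z' := hg none
  have hu : ∀ p, j (g (some p)) = u' p.1 p.2 := fun p => hg (some p)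
  have hrels : BosonizationRels ζ F d (g none)
      (Matrix.of fun i k => g (some (i, k)) : Matrix (Fin n) (Fin n) D₀) := by
    refine ⟨?_, fun i k => ?_, ?_⟩
    · have h1 := Unitary.mem_iff.mp h.1
      rw [Unitary.mem_iff]
      constructor <;> apply hj
      · rw [map_mul, map_star, hz, map_one, h1.1]
      · rw [map_mul, map_star, hz, map_one, h1.2]
    · apply hj
      rw [Matrix.of_apply, map_smul, map_mul, map_mul, hz, hu]
      exact h.2.1 i k
    -- Unitarity of the two matrices is restated as the vanishing of *-polynomials, a form that
    -- pulls back along an injective *-homomorphism.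
    · have h1 := (isUnitaryPair_iff ζ F d (FreeStar.lift fun p => g (some p))).mp fun r hr => by
        apply hj
        rw [map_zero]
        refine (isUnitaryPair_iff ζ F d (j.comp (FreeStar.lift fun p => g (some p)))).mpr ?_ r hr
        have h2 := h.2.2
        convert h2 using 1
        ext i k
        rw [Matrix.of_apply, StarAlgHom.comp_apply, FreeStar.lift_gen, hu]
      simpa only [FreeStar.lift_gen] using h1
  obtain ⟨φ, h1, h2⟩ := exists_lift_small ζ hF hrels
  refine ⟨j.comp φ, ?_, fun i k => ?_⟩
  · rw [StarAlgHom.comp_apply, h1, hz]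
  · rw [StarAlgHom.comp_apply, h2, Matrix.of_apply, hu]

end Bosonization

/-! ### The crossed product -/

namespace AlgU

/-- The endomorphism `u i j ↦ c ^ (d j - d i) • u i j` of `C(U_ζ⁺(F))`. -/
def scale (hF : Admissible F d d' δ) (c : Circle) : AlgU ζ F d →⋆ₐ[ℂ] AlgU ζ F d :=
  AlgU.lift _ ((isUnitaryPair_u ζ F d).mul_zpow hF (NCTorus.scalarU c) fun i j => by
    change ((c : ℂ) • (1 : AlgU ζ F d)) * _ = _ * ((c : ℂ) • (1 : AlgU ζ F d))
    rw [smul_one_mul, mul_smul_one])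

theorem scale_u (hF : Admissible F d d' δ) (c : Circle) (i j : Fin n) :
    scale ζ hF c (u ζ F d i j) = ((c ^ (d j - d i) : Circle) : ℂ) • u ζ F d i j := by
  rw [scale, lift_u, Matrix.of_apply, ← map_zpow]
  change _ * (((c ^ (d j - d i) : Circle) : ℂ) • (1 : AlgU ζ F d)) = _
  rw [mul_smul_one]

theorem scale_scale_inv (hF : Admissible F d d' δ) (c : Circle) (a : AlgU ζ F d) :
    scale ζ hF c (scale ζ hF c⁻¹ a) = a := by
  refine DFunLike.congr_fun (AlgU.hom_ext (φ := (scale ζ hF c).comp (scale ζ hF c⁻¹))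
    (ψ := StarAlgHom.id ℂ _) fun i j => ?_) a
  rw [StarAlgHom.comp_apply, scale_u, map_smul, scale_u, smul_smul, ← Circle.coe_mul, inv_zpow,
    inv_mul_cancel, Circle.coe_one, one_smul]
  rfl

/-- The automorphism `u i j ↦ c ^ (d j - d i) • u i j` of `C(U_ζ⁺(F))`. -/
def scaleEquiv (hF : Admissible F d d' δ) (c : Circle) : AlgU ζ F d ≃⋆ₐ[ℂ] AlgU ζ F d :=
  StarAlgEquiv.ofStarAlgHom (scale ζ hF c) (scale ζ hF c⁻¹)
    (StarAlgHom.ext fun a => by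
      have := scale_scale_inv ζ hF c⁻¹ a
      rwa [inv_inv] at this)
    (StarAlgHom.ext fun a => scale_scale_inv ζ hF c a)

end AlgU

/-- Scaling by `ζ⁻¹` multiplies `u i j` by `ζ^(d i - d j)`, the factor in `z u i j z*`. Covariance
on generators is thus the relation of `B`, and the two universal properties coincide. -/
theorem Bosonization.isCrossedProduct.{w} (hF : Admissible F d d' δ) :
    IsCrossedProduct.{w} (AlgU.scaleEquiv ζ hF ζ⁻¹) (Bosonization.ι ζ hF)
      (Bosonization.z ζ hF) where
  covariant a := by
    have hr := Bosonization.rels ζ hF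
    let conj : Bosonization ζ hF →⋆ₐ[ℂ] Bosonization ζ hF :=
      (Unitary.conjStarAlgAut ℂ (Bosonization ζ hF) (Bosonization.z ζ hF) :
        Bosonization ζ hF →⋆ₐ[ℂ] Bosonization ζ hF)
    refine DFunLike.congr_fun (AlgU.hom_ext (φ := conj.comp (Bosonization.ι ζ hF))
      (ψ := (Bosonization.ι ζ hF).comp (AlgU.scale ζ hF ζ⁻¹)) fun i j => ?_) a
    rw [StarAlgHom.comp_apply, StarAlgHom.comp_apply, AlgU.scale_u, map_smul]
    change (Bosonization.z ζ hF : Bosonization ζ hF) * Bosonization.u ζ hF i j *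
      star (Bosonization.z ζ hF : Bosonization ζ hF) = _ • Bosonization.u ζ hF i j
    rw [hr.2.1, smul_mul_assoc, mul_assoc, Unitary.mul_star_self_of_mem hr.1, mul_one, inv_zpow',
      neg_sub]
  generates := by
    rw [eq_top_iff, ← Bosonization.adjoin_eq_top ζ hF]
    refine StarSubalgebra.topologicalClosure_mono (StarAlgebra.adjoin_mono ?_)
    rintro _ (rfl | ⟨i, j, rfl⟩)
    · exact Or.inr rfl
    · exact Or.inl ⟨_, rfl⟩
  universal D _ π v hπ := by
    -- Multiplying the covariance relation at `u i j` by `v` on the right gives back the commutation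
    -- relation.
    have hrels : BosonizationRels ζ F d (v : D) ((AlgU.u ζ F d).map π) := by
      refine ⟨v.2, fun i j => ?_, (AlgU.isUnitaryPair_u ζ F d).map π⟩
      have h1 : (v : D) * π (AlgU.u ζ F d i j) * star (v : D) =
          π (AlgU.scale ζ hF ζ⁻¹ (AlgU.u ζ F d i j)) := hπ _
      rw [AlgU.scale_u, map_smul, inv_zpow', neg_sub] at h1
      rw [Matrix.map_apply, ← smul_mul_assoc, ← h1, mul_assoc, Unitary.star_mul_self_of_mem v.2,
        mul_one]
    obtain ⟨φ, h1, h2⟩ := Bosonization.exists_lift ζ hF hrels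
    have h3 : φ.comp (Bosonization.ι ζ hF) = π := AlgU.hom_ext fun i j => h2 i j
    refine ⟨φ, ⟨fun a => DFunLike.congr_fun h3 a, h1⟩, fun φ' hφ' => ?_⟩
    refine Bosonization.hom_ext ζ hF (hφ'.2.trans h1.symm) fun i j => ?_
    exact (hφ'.1 _).trans (h2 i j).symm

/-! ### The comultiplication -/

theorem CircleCoaction.IsHomogeneous.sum {X : Type} [CStarAlgebra X] {ρ : CircleCoaction X} {k : ℤ}
    {I : Type*} {s : Finset I} {x : I → X} (h : ∀ i, ρ.IsHomogeneous k (x i)) :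
    ρ.IsHomogeneous k (∑ i ∈ s, x i) := by
  have h1 : ∀ (a : X) (b : CT), MinTensor.tmul a b = MinTensor.inl a * MinTensor.inr b :=
    fun a b => by
      rw [MinTensor.inl_apply, MinTensor.inr_apply, MinTensor.tmul_mul_tmul, mul_one, one_mul]
  rw [IsHomogeneous, map_sum, h1, map_sum, Finset.sum_mul]
  refine Finset.sum_congr rfl fun i _ => ?_
  rw [h i, h1]

namespace Bosonization

variable (hF : Admissible F d d' δ)

/-- Putting `1` in one argument of `Φ` isolates its value on `z` or on `u i j`. In `∑ k, j₁(u i k)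
j₂(u k j)`, the map `ψ` turns the first factor into `u i k ⊗ z^(d k - d i)` and the second into `1 ⊗
u k j`. The result does not depend on the choice of coaction, `Φ` or `ψ`, whence the uniqueness of
`Δ`. -/
theorem comul_apply {Δ : Bosonization ζ hF →⋆ₐ[ℂ] Bosonization ζ hF ⊗min Bosonization ζ hF}
    (hΔ : IsBosonizationComul ζ (AlgU.coaction ζ hF) (AlgU.comul ζ hF) Δ) :
    Δ (z ζ hF) = MinTensor.tmul (z ζ hF : Bosonization ζ hF) (z ζ hF : Bosonization ζ hF) ∧
      ∀ i j, Δ (u ζ hF i j) = ∑ k, MinTensor.tmul (u ζ hF i k)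
          (((z ζ hF ^ (d k - d i) : unitary (Bosonization ζ hF)) : Bosonization ζ hF) *
            u ζ hF k j) := by
  obtain ⟨ρ, -, Φ, hΦ, ψ, ⟨hψ1, hψ2, hψ3⟩, rfl⟩ := hΔ
  constructor
  · have h1 := hΦ (coordZ : CT) 1
    rw [map_one, mul_one, map_one, map_one, mul_one] at h1
    rw [StarAlgHom.comp_apply, coe_z, h1]
    refine (hψ1 (coordZ : CT)).trans ?_
    rw [deltaT, circleHom_coordZ]
    exact MinTensor.map_tmul _ _ _ _
  · intro i j
    have h1 := hΦ 1 (AlgU.u ζ F d i j)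
    rw [map_one, one_mul, map_one, map_one, one_mul] at h1
    have h2 : Φ (u ζ hF i j) = _ := h1
    rw [StarAlgHom.comp_apply, h2, AlgU.comul_u, map_sum, map_sum]
    refine Finset.sum_congr rfl fun k _ => ?_
    rw [map_mul, map_mul, hψ2, hψ3, AlgU.isHomogeneous_u ζ hF i k, MinTensor.map_tmul,
      map_zpow_coe, MinTensor.tmul_mul_tmul, mul_one]
    rfl

theorem exists_comul : ∃ Δ : Bosonization ζ hF →⋆ₐ[ℂ] Bosonization ζ hF ⊗min Bosonization ζ hF,
    IsBosonizationComul ζ (AlgU.coaction ζ hF) (AlgU.comul ζ hF) Δ := by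
  have hhom := fun p : Fin n × Fin n => AlgU.isHomogeneous_u ζ hF p.1 p.2
  have hgen := AlgU.adjoin_eq_top ζ F d
  obtain ⟨ρ, hρ⟩ := BraidedTensor.exists_coaction ζ hhom hgen hhom hgen
  have hρ₁ : ∀ i j, ρ.IsHomogeneous (d j - d i)
      (BraidedTensor.j₁ ζ (AlgU.coaction ζ hF) (AlgU.coaction ζ hF) (AlgU.u ζ F d i j)) := by
    intro i j
    have h := DFunLike.congr_fun hρ.1 (AlgU.u ζ F d i j)
    rw [StarAlgHom.comp_apply, StarAlgHom.comp_apply, AlgU.isHomogeneous_u ζ hF i j,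
      MinTensor.map_tmul] at h
    exact h
  have hρ₂ : ∀ i j, ρ.IsHomogeneous (d j - d i)
      (BraidedTensor.j₂ ζ (AlgU.coaction ζ hF) (AlgU.coaction ζ hF) (AlgU.u ζ F d i j)) := by
    intro i j
    have h := DFunLike.congr_fun hρ.2 (AlgU.u ζ F d i j)
    rw [StarAlgHom.comp_apply, StarAlgHom.comp_apply, AlgU.isHomogeneous_u ζ hF i j,
      MinTensor.map_tmul] at h
    exact h
  -- Equivariance of `Δ_A` on generators: in each summand the degrees `d k - d i` and `d j - d k`
  -- add up to a value independent of `k`.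
  have hcomul : ∀ i j, ρ.IsHomogeneous (d j - d i) (AlgU.comul ζ hF (AlgU.u ζ F d i j)) := by
    intro i j
    rw [AlgU.comul_u]
    refine CircleCoaction.IsHomogeneous.sum fun k => ?_
    have := (hρ₁ i k).mul (hρ₂ k j)
    rwa [show d k - d i + (d j - d k) = d j - d i by ring] at this
  -- Because `Δ_A(u i j)` has the degree of `u i j`, it commutes with `z` in `C(𝕋) ⊠ (A ⊠ A)` up to
  -- the same phase, so the relations of `B` hold there.
  obtain ⟨Φ, hΦz, hΦu⟩ := exists_lift_small ζ hF
    (z' := BraidedTensor.j₁ ζ coactionT ρ (coordZ : CT))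
    (u' := (AlgU.u ζ F d).map ((BraidedTensor.j₂ ζ coactionT ρ).comp (AlgU.comul ζ hF)))
    ⟨Unitary.map_mem _ coordZ.2, fun i j => by
      have h := BraidedTensor.j₁_mul_j₂ ζ coactionT_isHomogeneous (hcomul i j)
      rwa [mul_one, neg_sub] at h, (AlgU.isUnitaryPair_u ζ F d).map _⟩
  -- The restriction of `ψ` to `A ⊠ A`, before the first leg is embedded: `j₁(u i j) ↦ u i j ⊗ z^(d
  -- j - d i)` and `j₂(b) ↦ 1 ⊗ b` in `A ⊗ B`. The covariant unitary is `z` itself.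
  obtain ⟨Θ, hΘ₁, hΘ₂⟩ := BraidedTensor.exists_hom_of_covariant ζ hhom hgen hhom hgen (z ζ hF)
    (ι ζ hF) fun p => u_mul_z ζ hF p.1 p.2
  let φ := (MinTensor.map (ι ζ hF) (StarAlgHom.id ℂ (Bosonization ζ hF))).comp Θ
  have hφ₁ : ∀ i j, φ (BraidedTensor.j₁ ζ _ _ (AlgU.u ζ F d i j)) =
      MinTensor.tmul (u ζ hF i j)
        ((z ζ hF ^ (d j - d i) : unitary (Bosonization ζ hF)) : Bosonization ζ hF) := fun i j => by
    rw [StarAlgHom.comp_apply, hΘ₁ (i, j), MinTensor.map_tmul]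
    rfl
  have hφ₂ : ∀ a, φ (BraidedTensor.j₂ ζ _ _ a) = MinTensor.tmul 1 (ι ζ hF a) := fun a => by
    rw [StarAlgHom.comp_apply, hΘ₂, MinTensor.map_tmul, map_one]
    rfl
  -- The unitary `z ⊗ z` is covariant with `φ`: it passes `u i j ⊗ z^k` with the phase from the
  -- first leg, as powers of `z` commute, and `1 ⊗ u i j` with the phase from the second.
  obtain ⟨ψ, hψ₁, hψ₂⟩ := exists_hom_of_covariant_circle ζ (ρY := ρ)
    (y := Sum.elim
      (fun p : Fin n × Fin n => BraidedTensor.j₁ ζ _ _ (AlgU.u ζ F d p.1 p.2))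
      fun p : Fin n × Fin n => BraidedTensor.j₂ ζ _ _ (AlgU.u ζ F d p.1 p.2))
    (dy := Sum.elim (fun p => d p.2 - d p.1) fun p => d p.2 - d p.1)
    (by rintro (p | p); exacts [hρ₁ p.1 p.2, hρ₂ p.1 p.2])
    (BraidedTensor.adjoin_sumElim_eq_top ζ _ _ hgen hgen) (tmulU (z ζ hF) (z ζ hF)) φ (by
      have hz : ((tmulU (z ζ hF) (z ζ hF) :
          unitary (Bosonization ζ hF ⊗min Bosonization ζ hF)) : _) =
          MinTensor.tmul (z ζ hF : Bosonization ζ hF) (z ζ hF : Bosonization ζ hF) := rfl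
      have hcomm : ∀ k : ℤ, ((z ζ hF ^ k : unitary (Bosonization ζ hF)) : Bosonization ζ hF) *
          z ζ hF = (z ζ hF : Bosonization ζ hF) *
            ((z ζ hF ^ k : unitary (Bosonization ζ hF)) : Bosonization ζ hF) := fun k =>
        congrArg Subtype.val ((Commute.refl (z ζ hF)).zpow_left k).eq
      rintro (⟨i, j⟩ | ⟨i, j⟩)
      · change φ (BraidedTensor.j₁ ζ _ _ (AlgU.u ζ F d i j)) * _ =
          ((ζ ^ (d j - d i) : Circle) : ℂ) • (_ * φ (BraidedTensor.j₁ ζ _ _ (AlgU.u ζ F d i j)))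
        rw [hφ₁, hz, MinTensor.tmul_mul_tmul, MinTensor.tmul_mul_tmul, u_mul_z, hcomm,
          MinTensor.smul_tmul]
      · change φ (BraidedTensor.j₂ ζ _ _ (AlgU.u ζ F d i j)) * _ =
          ((ζ ^ (d j - d i) : Circle) : ℂ) • (_ * φ (BraidedTensor.j₂ ζ _ _ (AlgU.u ζ F d i j)))
        rw [hφ₂, hz, MinTensor.tmul_mul_tmul, MinTensor.tmul_mul_tmul, one_mul, mul_one,
          ← u_apply, u_mul_z, MinTensor.tmul_smul])
  -- The remaining identities are equalities of *-homomorphisms on `C(𝕋)` or on `A`, so each is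
  -- settled on `z` or on the `u i j`.
  refine ⟨ψ.comp Φ, ρ, hρ, Φ, fun f a => ?_, ψ, ⟨fun f => ?_, fun a => ?_, fun b => ?_⟩, rfl⟩
  · have h1 : Φ.comp (BraidedTensor.j₁ ζ coactionT (AlgU.coaction ζ hF)) =
        BraidedTensor.j₁ ζ coactionT ρ :=
      hom_ext_of_adjoin adjoin_coordZ_eq_top (by rintro _ ⟨-, rfl⟩; exact hΦz)
    have h2 : Φ.comp (ι ζ hF) = (BraidedTensor.j₂ ζ coactionT ρ).comp (AlgU.comul ζ hF) :=
      AlgU.hom_ext hΦu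
    rw [map_mul]
    exact congrArg₂ _ (DFunLike.congr_fun h1 f) (DFunLike.congr_fun h2 a)
  · refine DFunLike.congr_fun (hom_ext_of_adjoin adjoin_coordZ_eq_top
      (φ := ψ.comp (BraidedTensor.j₁ ζ coactionT ρ)) (ψ := (MinTensor.map _ _).comp deltaT) ?_) f
    rintro _ ⟨-, rfl⟩
    rw [StarAlgHom.comp_apply, hψ₁, StarAlgHom.comp_apply, deltaT, circleHom_coordZ]
    exact (MinTensor.map_tmul _ _ _ _).symm
  · rw [hψ₂]
    refine DFunLike.congr_fun (AlgU.hom_ext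
      (φ := φ.comp (BraidedTensor.j₁ ζ (AlgU.coaction ζ hF) (AlgU.coaction ζ hF)))
      (ψ := (MinTensor.map _ _).comp (AlgU.coaction ζ hF).coact) fun i j => ?_) a
    rw [StarAlgHom.comp_apply, hφ₁, StarAlgHom.comp_apply, AlgU.isHomogeneous_u ζ hF i j,
      MinTensor.map_tmul, map_zpow_coe]
    rfl
  · rw [hψ₂, hφ₂]
    rfl

end Bosonization

end

end BraidedUnitary

end

theorem mainTheorem4 {n : ℕ} (ζ : Circle) (F : GL (Fin n) ℂ) (d d' : Fin n → ℤ) (δ : ℤ)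
    (hF : Admissible F d d' δ) :
    -- `C(𝕋) ⊠_ζ C(U_ζ⁺(F))` is the universal C*-algebra with the stated generators and relations
    (BosonizationRels ζ F d (Bosonization.z ζ hF : Bosonization ζ hF) (Bosonization.u ζ hF) ∧
      (StarAlgebra.adjoin ℂ ({(Bosonization.z ζ hF : Bosonization ζ hF)} ∪
        {x | ∃ i j, x = Bosonization.u ζ hF i j})).topologicalClosure = ⊤ ∧
      ∀ (D : Type v) [CStarAlgebra D] (z : D) (u : Matrix (Fin n) (Fin n) D),
        BosonizationRels ζ F d z u →
          ∃! φ : Bosonization ζ hF →⋆ₐ[ℂ] D,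
            φ (Bosonization.z ζ hF) = z ∧ ∀ i j, φ (Bosonization.u ζ hF i j) = u i j) ∧
    -- it is the crossed product of `C(U_ζ⁺(F))` by `ℤ`
    (∃ α : AlgU ζ F d ≃⋆ₐ[ℂ] AlgU ζ F d,
      (∀ i j, α (AlgU.u ζ F d i j) = ((ζ ^ (d i - d j) : Circle) : ℂ) • AlgU.u ζ F d i j) ∧
      IsCrossedProduct.{v} α (Bosonization.ι ζ hF) (Bosonization.z ζ hF)) ∧
    -- the comultiplication of the bosonization
    ∃ Δ : Bosonization ζ hF →⋆ₐ[ℂ] MinTensor (Bosonization ζ hF) (Bosonization ζ hF),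
      IsBosonizationComul ζ (AlgU.coaction ζ hF) (AlgU.comul ζ hF) Δ ∧
      (∀ Δ' : Bosonization ζ hF →⋆ₐ[ℂ] MinTensor (Bosonization ζ hF) (Bosonization ζ hF),
        IsBosonizationComul ζ (AlgU.coaction ζ hF) (AlgU.comul ζ hF) Δ' → Δ' = Δ) ∧
      Δ (Bosonization.z ζ hF) =
        MinTensor.tmul (Bosonization.z ζ hF : Bosonization ζ hF)
          (Bosonization.z ζ hF : Bosonization ζ hF) ∧
      ∀ i j, Δ (Bosonization.u ζ hF i j) =
        ∑ k, MinTensor.tmul (Bosonization.u ζ hF i k)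
          (((Bosonization.z ζ hF ^ (d k - d i) : unitary (Bosonization ζ hF)) :
            Bosonization ζ hF) * Bosonization.u ζ hF k j) := by
  obtain ⟨Δ, hΔ⟩ := Bosonization.exists_comul ζ hF
  refine ⟨⟨Bosonization.rels ζ hF, Bosonization.adjoin_eq_top ζ hF, fun D _ z u h => ?_⟩,
    ⟨AlgU.scaleEquiv ζ hF ζ⁻¹, fun i j => ?_, Bosonization.isCrossedProduct ζ hF⟩,
    Δ, hΔ, fun Δ' hΔ' => ?_, (Bosonization.comul_apply ζ hF hΔ).1,
    (Bosonization.comul_apply ζ hF hΔ).2⟩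
  · obtain ⟨φ, hφ⟩ := Bosonization.exists_lift ζ hF h
    exact ⟨φ, hφ, fun φ' hφ' => Bosonization.hom_ext ζ hF (hφ'.1.trans hφ.1.symm)
      fun i j => (hφ'.2 i j).trans (hφ.2 i j).symm⟩
  · refine (AlgU.scale_u ζ hF ζ⁻¹ i j).trans ?_
    rw [inv_zpow', neg_sub]
  -- Any two comultiplications take the same values on the generators of `B`.
  · have h := Bosonization.comul_apply ζ hF hΔ
    have h' := Bosonization.comul_apply ζ hF hΔ'
    exact Bosonization.hom_ext ζ hF (h'.1.trans h.1.symm)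
      fun i j => (h'.2 i j).trans (h.2 i j).symm
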